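/- **Setting.** Let $U$ be a real Hilbert space and let $V,H$ be separable real Hilbert spaces with a continuous, dense, injective embedding $V\hookrightarrow H$. Write $V^*$ for the dual of $V$, $\langle\cdot,\cdot\rangle$ for the duality pairing of $V^*$ and $V$, and identify $x\in H$ with $(x,\cdot)_H\in V^*$, so that $V\hookrightarrow H\hookrightarrow V^*$. Let $\mathcal L_2(U,H)$ be the space of Hilbert–Schmidt operators with its norm $|||\cdot|||_H$, let $\|\cdot\|_\beta$ be the norm of the complex interpolation space $[V^*,V]_\beta$, let $\mathbb R_+=[0,\infty)$, and let $$MR(0,T)=C([0,T];H)\cap L^2(0,T;V),\qquad \|u\|_{MR(0,T)}=\|u\|_{C([0,T];H)}+\|u\|_{L^2(0,T;V)}.$$ **Assumption on $(A,B)$.** 1. $A(t,v)=A_0(t,v)v-F(t,v)-f(t)$ and $B(t,v)=B_0(t,v)v+G(t,v)+g(t)$ for $t\in\mathbb R_+$, $v\in V$, where $A_0:\mathbb R_+\times H\to\mathcal L(V,V^*)$ and $B_0:\mathbb R_+\times H\to\mathcal L(V,\mathcal L_2(U,H))$ are such that $A_0(\cdot,\cdot)v$ and $B_0(\cdot,\cdot)v$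 are strongly $\mathcal B(\mathbb R_+)\otimes\mathcal B(H)$-measurable for every $v\in V$; $F:\mathbb R_+\times V\to V^*$ and $G:\mathbb R_+\times V\to\mathcal L_2(U,H)$ are strongly $\mathcal B(\mathbb R_+)\otimes\mathcal B(V)$-measurable; and $f\in L^2_{\rm loc}(\mathbb R_+;V^*)$, $g\in L^2_{\rm loc}(\mathbb R_+;\mathcal L_2(U,H))$ are strongly measurable. 2. For all $T>0$ and $n\ge 0$ there are $\theta_{n,T},M_{n,T}>0$ such that for all $t\in[0,T]$, $u\in H$ with $\|u\|_H\le n$, and $v\in V$, $$\langle A_0(t,u)v,v\rangle-\tfrac12|||B_0(t,u)v|||_H^2\ge\theta_{n,T}\|v\|_V^2-M_{n,T}\|v\|_H^2 .$$ 3. There are $m_F,m_G\in\mathbb N$ and, for $1\le j\le m_F+m_G$, numbers $\rho_j\ge0$ and $\beta_j\in(\frac12,1)$ with $2\beta_j\le 1+\frac1{1+\rho_j}$, such that for all $T>0$ and $n\ge0$ there is a constant $C_{n,T}$ with the following property: for all $t\in[0,T]$ and $u,v,w\in V$ with $\|u\|_H,\|v\|_H\le n$, $$\begin{aligned} \|A_0(t,u)w\|_{V^*}&\le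 C_{n,T}(1+\|u\|_H)\|w\|_V, &\|A_0(t,u)w-A_0(t,v)w\|_{V^*}&\le C_{n,T}\|u-v\|_H\|w\|_V,\\ |||B_0(t,u)w|||_H&\le C_{n,T}(1+\|u\|_H)\|w\|_V, &|||B_0(t,u)w-B_0(t,v)w|||_H&\le C_{n,T}\|u-v\|_H\|w\|_V, \end{aligned}$$ $$\begin{aligned} \|F(t,u)\|_{V^*}&\le C_{n,T}\sum_{j=1}^{m_F}\big(1+\|u\|_{\beta_j}^{\rho_j+1}\big),\\ \|F(t,u)-F(t,v)\|_{V^*}&\le C_{n,T}\sum_{j=1}^{m_F}\big(1+\|u\|_{\beta_j}^{\rho_j}+\|v\|_{\beta_j}^{\rho_j}\big)\|u-v\|_{\beta_j},\\ |||G(t,u)|||_H&\le C_{n,T}\sum_{j=m_F+1}^{m_F+m_G}\big(1+\|u\|_{\beta_j}^{\rho_j+1}\big),\\ |||G(t,u)-G(t,v)|||_H&\le C_{n,T}\sum_{j=m_F+1}^{m_F+m_G}\big(1+\|u\|_{\beta_j}^{\rho_j}+\|v\|_{\beta_j}^{\rho_j}\big)\|u-v\|_{\beta_j}. \end{aligned}$$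 **Strong solutions.** Let $T>0$ and $\psi\in L^2(0,T;U)$. For $\tilde T\in(0,T]$ and $x\in H$, a strong solution on $[0,\tilde T]$ of the skeleton equation $$u'(t)=-A(t,u(t))+B(t,u(t))\psi(t),\qquad u(0)=x,$$ is a $u\in MR(0,\tilde T)$ such that $A(\cdot,u(\cdot))-B(\cdot,u(\cdot))\psi(\cdot)\in L^2(0,\tilde T;V^*)+L^1(0,\tilde T;H)$ and, in $V^*$, $$u(t)=x-\int_0^t\big(A(s,u(s))-B(s,u(s))\psi(s)\big)\,ds\qquad\text{for all }t\in[0,\tilde T].$$ **Theorem.** Let $(A,B)$ satisfy the assumption above, let $T>0$, $\psi\in L^2(0,T;U)$ and $u_0\in H$. Then there exist $\tilde T\in(0,T]$ and $\varepsilon>0$ such that for each $v_0$ in the open ball $B_H(u_0,\varepsilon)$ the skeleton equation with initial value $v_0$ has a unique strong solution $u_{v_0}\in MR(0,\tilde T)$. Moreover, there is a constant $C>0$ such that for all $v_0,w_0\in B_H(u_0,\varepsilon)$, $$\|u_{v_0}-u_{w_0}\|_{MR(0,\tilde T)}\le C\|v_0-w_0\|_H .$$ -/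

import Mathlib

open MeasureTheory Set
open scoped NNReal ENNReal

noncomputable section

namespace CritVar

/-! ### Hilbert-Schmidt operators -/

section HilbertSchmidt

variable (U H : Type*)
  [NormedAddCommGroup U] [InnerProductSpace ℝ U] [CompleteSpace U]
  [NormedAddCommGroup H] [InnerProductSpace ℝ H]

/-- Index set of a fixed orthonormal (Hilbert) basis of `U`. -/
def basisIndex : Set U := (exists_hilbertBasis ℝ U).choose

/-- A fixed orthonormal (Hilbert) basis of `U`. -/
def stdBasis : HilbertBasis (basisIndex U) ℝ U := (exists_hilbertBasis ℝ U).choose_spec.choose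

/-- The bounded operators `S : U → H` with `∑ i, ‖S e_i‖ ^ 2 < ∞`. -/
def hilbertSchmidtSubmodule : Submodule ℝ (U →L[ℝ] H) where
  carrier := {S | Memℓp (fun i : basisIndex U => S (stdBasis U i)) 2}
  zero_mem' := by
    have h : Memℓp (0 : basisIndex U → H) 2 := zero_memℓp
    exact h
  add_mem' := fun {a b} ha hb => by
    have h := Memℓp.add ha hb
    exact h
  smul_mem' := fun c a ha => by
    have h := Memℓp.const_smul ha c
    exact h

/-- The space `L₂(U, H)` of Hilbert-Schmidt operators. It is a type of its own since it does not
carry the operator norm, but the norm `(∑ i, ‖S e_i‖ ^ 2) ^ (1/2)`. -/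
def HSOp : Type _ := hilbertSchmidtSubmodule U H

instance : AddCommGroup (HSOp U H) := inferInstanceAs (AddCommGroup (hilbertSchmidtSubmodule U H))

instance : Module ℝ (HSOp U H) := inferInstanceAs (Module ℝ (hilbertSchmidtSubmodule U H))

variable {U H}

/-- The bounded operator underlying a Hilbert-Schmidt operator. -/
def HSOp.toCLM (S : HSOp U H) : U →L[ℝ] H := Subtype.val S

variable (U H)

/-- The map `S ↦ (S e_i)_i` into `ℓ²(H)`. -/
def HSOp.toLp : HSOp U H →ₗ[ℝ] lp (fun _ : basisIndex U => H) 2 where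
  toFun S := ⟨fun i => S.toCLM (stdBasis U i), S.2⟩
  map_add' _ _ := rfl
  map_smul' _ _ := rfl

theorem HSOp.toLp_injective : Function.Injective (HSOp.toLp U H) := by
  intro S R h
  apply Subtype.ext
  refine ContinuousLinearMap.ext_on
    (Submodule.dense_iff_topologicalClosure_eq_top.mpr (stdBasis U).dense_span) ?_
  rintro _ ⟨i, rfl⟩
  exact congrFun (congrArg Subtype.val h) i

instance : NormedAddCommGroup (HSOp U H) :=
  NormedAddCommGroup.induced (HSOp U H) (lp (fun _ : basisIndex U => H) 2) (HSOp.toLp U H)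
    (HSOp.toLp_injective U H)

instance : NormedSpace ℝ (HSOp U H) := NormedSpace.induced ℝ (HSOp U H)
  (lp (fun _ : basisIndex U => H) 2) (HSOp.toLp U H)

theorem HSOp.norm_sq (S : HSOp U H) :
    ‖S‖ ^ 2 = ∑' i : basisIndex U, ‖S.toCLM (stdBasis U i)‖ ^ 2 := by
  have h := lp.norm_rpow_eq_tsum (p := 2) (by norm_num) (HSOp.toLp U H S)
  simp only [ENNReal.toReal_ofNat, Real.rpow_ofNat] at h
  exact h

end HilbertSchmidt

/-! ### Gelfand triple, complex interpolation -/

section Gelfand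

variable {V H : Type*}
  [NormedAddCommGroup V] [InnerProductSpace ℝ V]
  [NormedAddCommGroup H] [InnerProductSpace ℝ H]

/-- The embedding `j : H → V*`, `j x = (x, ι ·)_H`, of the Gelfand triple `(V, H, V*)` given by
`ι : V → H`. -/
def dualEmb (ι : V →L[ℝ] H) : H →L[ℝ] StrongDual ℝ V :=
  ((ContinuousLinearMap.compL ℝ V H ℝ).flip ι).comp (innerSL ℝ)

theorem dualEmb_apply (ι : V →L[ℝ] H) (x : H) (v : V) :
    dualEmb ι x v = inner ℝ x (ι v) := rfl

/-- The embedding of the complexification `V + iV` (pairs `(x, y)` with the Hilbert norm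
`(‖x‖ ^ 2 + ‖y‖ ^ 2) ^ (1/2)`) into the complexification of `V*`, which is the complex Banach
space `V →L[ℝ] ℂ` of complex-valued bounded real-linear functionals on `V`. -/
def complexEmb (ι : V →L[ℝ] H) (w : WithLp 2 (V × V)) : V →L[ℝ] ℂ :=
  Complex.ofRealCLM.comp (dualEmb ι (ι w.fst)) +
    Complex.I • Complex.ofRealCLM.comp (dualEmb ι (ι w.snd))

/-- The Hilbert norm `(‖Re φ‖ ^ 2 + ‖Im φ‖ ^ 2) ^ (1/2)` on the complexification of `V*`. -/
def complexDualNorm (φ : V →L[ℝ] ℂ) : ℝ :=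
  ‖WithLp.toLp 2 ((Complex.reCLM.comp φ : StrongDual ℝ V), (Complex.imCLM.comp φ : StrongDual ℝ V))‖

/-- `f` is an admissible function on the strip `0 ≤ Re z ≤ 1` for the complex interpolation of the
couple `(V*, V)`: bounded and continuous with values in (the complexification of) `V* + V = V*`,
holomorphic inside, and on the line `Re z = 1` it is a continuous function `g` with values in (the
complexification of) `V`. The bound `M` dominates the norms on the two boundary lines. -/
structure IsStripFunction (ι : V →L[ℝ] H) (f : ℂ → V →L[ℝ] ℂ) (g : ℝ → WithLp 2 (V × V))
    (M : ℝ) : Prop where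
  continuousOn : ContinuousOn f (Complex.re ⁻¹' Icc 0 1)
  bounded : ∃ K : ℝ, ∀ z ∈ Complex.re ⁻¹' Icc (0 : ℝ) 1, ‖f z‖ ≤ K
  holomorphic : DifferentiableOn ℂ f (Complex.re ⁻¹' Ioo 0 1)
  boundary_zero : ∀ t : ℝ, complexDualNorm (f (t * Complex.I)) ≤ M
  continuous_boundary : Continuous g
  boundary_one : ∀ t : ℝ, f (1 + t * Complex.I) = complexEmb ι (g t)
  norm_boundary_one : ∀ t : ℝ, ‖g t‖ ≤ M

/-- The norm `‖v‖_β` of `v ∈ V` in the complex interpolation space `[V*, V]_β`. -/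
def interpNorm (ι : V →L[ℝ] H) (β : ℝ) (v : V) : ℝ :=
  sInf {M : ℝ | ∃ f g, IsStripFunction ι f g M ∧ f β = complexEmb ι (WithLp.toLp 2 (v, 0))}

end Gelfand

/-! ### Coefficients and the standing assumption -/

section Coefficients

variable (U V H : Type*)
  [NormedAddCommGroup U] [InnerProductSpace ℝ U] [CompleteSpace U]
  [NormedAddCommGroup V] [InnerProductSpace ℝ V]
  [NormedAddCommGroup H] [InnerProductSpace ℝ H]

/-- The data `A₀, F, f` and `B₀, G, g` that make up the coefficients `A` and `B`. -/
structure Coefficients where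
  A₀ : ℝ≥0 → H → V →L[ℝ] StrongDual ℝ V
  F : ℝ≥0 → V → StrongDual ℝ V
  f : ℝ≥0 → StrongDual ℝ V
  B₀ : ℝ≥0 → H → V →L[ℝ] HSOp U H
  G : ℝ≥0 → V → HSOp U H
  g : ℝ≥0 → HSOp U H

variable {U V H}

/-- `A(t, v) = A₀(t, v) v - F(t, v) - f(t)`. -/
def Coefficients.A (c : Coefficients U V H) (ι : V →L[ℝ] H) (t : ℝ≥0) (v : V) : StrongDual ℝ V :=
  c.A₀ t (ι v) v - c.F t v - c.f t

/-- `B(t, v) = B₀(t, v) v + G(t, v) + g(t)`. -/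
def Coefficients.B (c : Coefficients U V H) (ι : V →L[ℝ] H) (t : ℝ≥0) (v : V) : HSOp U H :=
  c.B₀ t (ι v) v + c.G t v + c.g t

/-- The critical variational setting: measurability, coercivity of the leading part `(A₀, B₀)`, and
the growth and local Lipschitz bounds with (sub)critical exponents. Measurability of the
operator-valued maps `A₀` and `B₀` is required in the (weakest) strong operator sense. -/
structure CriticalVariational [MeasurableSpace V] [MeasurableSpace H]
    (ι : V →L[ℝ] H) (c : Coefficients U V H) : Prop where
  meas_A₀ : ∀ v : V, StronglyMeasurable fun p : ℝ≥0 × H => c.A₀ p.1 p.2 v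
  meas_B₀ : ∀ v : V, StronglyMeasurable fun p : ℝ≥0 × H => c.B₀ p.1 p.2 v
  meas_F : StronglyMeasurable fun p : ℝ≥0 × V => c.F p.1 p.2
  meas_G : StronglyMeasurable fun p : ℝ≥0 × V => c.G p.1 p.2
  meas_f : StronglyMeasurable c.f
  meas_g : StronglyMeasurable c.g
  memLp_f : ∀ T : ℝ, 0 < T → MemLp (fun t : ℝ => c.f t.toNNReal) 2 (volume.restrict (Icc 0 T))
  memLp_g : ∀ T : ℝ, 0 < T → MemLp (fun t : ℝ => c.g t.toNNReal) 2 (volume.restrict (Icc 0 T))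
  coercive : ∀ T : ℝ, 0 < T → ∀ n : ℝ, 0 ≤ n → ∃ θ M : ℝ, 0 < θ ∧ 0 < M ∧
    ∀ t : ℝ≥0, (t : ℝ) ≤ T → ∀ (u : H) (v : V), ‖u‖ ≤ n →
      θ * ‖v‖ ^ 2 - M * ‖ι v‖ ^ 2 ≤ c.A₀ t u v v - 1 / 2 * ‖c.B₀ t u v‖ ^ 2
  bounds : ∃ (mF mG : ℕ) (ρ β : ℕ → ℝ),
    (∀ j ∈ Finset.Icc 1 (mF + mG),
      0 ≤ ρ j ∧ 1 / 2 < β j ∧ β j < 1 ∧ 2 * β j ≤ 1 + 1 / (1 + ρ j)) ∧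
    ∀ T : ℝ, 0 < T → ∀ n : ℝ, 0 ≤ n → ∃ C : ℝ, ∀ t : ℝ≥0, (t : ℝ) ≤ T →
      ∀ u v w : V, ‖ι u‖ ≤ n → ‖ι v‖ ≤ n →
        ‖c.A₀ t (ι u) w‖ ≤ C * (1 + ‖ι u‖) * ‖w‖ ∧
        ‖c.A₀ t (ι u) w - c.A₀ t (ι v) w‖ ≤ C * ‖ι u - ι v‖ * ‖w‖ ∧
        ‖c.B₀ t (ι u) w‖ ≤ C * (1 + ‖ι u‖) * ‖w‖ ∧
        ‖c.B₀ t (ι u) w - c.B₀ t (ι v) w‖ ≤ C * ‖ι u - ι v‖ * ‖w‖ ∧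
        ‖c.F t u‖ ≤ C * ∑ j ∈ Finset.Icc 1 mF, (1 + interpNorm ι (β j) u ^ (ρ j + 1)) ∧
        ‖c.F t u - c.F t v‖ ≤ C * ∑ j ∈ Finset.Icc 1 mF,
          (1 + interpNorm ι (β j) u ^ ρ j + interpNorm ι (β j) v ^ ρ j) *
            interpNorm ι (β j) (u - v) ∧
        ‖c.G t u‖ ≤ C * ∑ j ∈ Finset.Icc (mF + 1) (mF + mG),
          (1 + interpNorm ι (β j) u ^ (ρ j + 1)) ∧
        ‖c.G t u - c.G t v‖ ≤ C * ∑ j ∈ Finset.Icc (mF + 1) (mF + mG),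
          (1 + interpNorm ι (β j) u ^ ρ j + interpNorm ι (β j) v ^ ρ j) *
            interpNorm ι (β j) (u - v)

end Coefficients

/-! ### Maximal regularity space and strong solutions -/

section Solutions

variable {U V H : Type*}
  [NormedAddCommGroup U] [InnerProductSpace ℝ U] [CompleteSpace U]
  [NormedAddCommGroup V] [InnerProductSpace ℝ V]
  [NormedAddCommGroup H] [InnerProductSpace ℝ H]

/-- The maximal regularity space `MR(0, T) = C([0, T]; H) ∩ L²(0, T; V)`: pairs of an element of
`C([0, T]; H)` and an element of `L²(0, T; V)` that coincide almost everywhere under `V ⊆ H`. Its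
norm is the sum of the two norms. -/
def MR (ι : V →L[ℝ] H) (T : ℝ) :
    Submodule ℝ (WithLp 1 (C(Icc (0 : ℝ) T, H) × Lp V 2 (volume.restrict (Icc (0 : ℝ) T)))) where
  carrier := {u | ∀ᵐ t ∂(volume.restrict (Icc (0 : ℝ) T)),
    ∀ ht : t ∈ Icc (0 : ℝ) T, ι (u.snd t) = u.fst ⟨t, ht⟩}
  zero_mem' := by
    filter_upwards [Lp.coeFn_zero V 2 (volume.restrict (Icc (0 : ℝ) T))] with t h ht
    change ι ((0 : Lp V 2 (volume.restrict (Icc (0 : ℝ) T))) t) = 0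
    rw [h, Pi.zero_apply, map_zero]
  add_mem' := fun {a b} ha hb => by
    filter_upwards [ha, hb, Lp.coeFn_add a.snd b.snd] with t h1 h2 h3 ht
    change ι ((a.snd + b.snd) t) = a.fst ⟨t, ht⟩ + b.fst ⟨t, ht⟩
    rw [h3, Pi.add_apply, map_add, h1 ht, h2 ht]
  smul_mem' := fun r a ha => by
    filter_upwards [ha, Lp.coeFn_smul r a.snd] with t h1 h2 ht
    change ι ((r • a.snd) t) = r • a.fst ⟨t, ht⟩
    rw [h2, Pi.smul_apply, map_smul, h1 ht]

theorem MR.norm_eq (ι : V →L[ℝ] H) {T : ℝ} (u : MR ι T) :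
    ‖u‖ = ‖u.1.fst‖ + ‖u.1.snd‖ :=
  WithLp.prod_norm_eq_of_L1 u.1

/-- The function `t ↦ A(t, u(t)) - B(t, u(t)) ψ(t)` on `[0, T]`, with values in `V*`. -/
def skeletonDrift (ι : V →L[ℝ] H) (c : Coefficients U V H) (ψ : ℝ → U) {T : ℝ} (u : MR ι T)
    (t : ℝ) : StrongDual ℝ V :=
  c.A ι t.toNNReal (u.1.snd t) - dualEmb ι ((c.B ι t.toNNReal (u.1.snd t)).toCLM (ψ t))

/-- `u ∈ MR(0, T)` is a strong solution of the skeleton equation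
`u' = -A(t, u) + B(t, u) ψ` on `[0, T]`, `u(0) = x`: the drift belongs to
`L²(0, T; V*) + L¹(0, T; H)`, and the integrated equation holds in `V*` for all `t ∈ [0, T]`. -/
structure IsStrongSolution (ι : V →L[ℝ] H) (c : Coefficients U V H) (ψ : ℝ → U) {T : ℝ}
    (x : H) (u : MR ι T) : Prop where
  drift_mem : ∃ (h₁ : ℝ → StrongDual ℝ V) (h₂ : ℝ → H),
    MemLp h₁ 2 (volume.restrict (Icc 0 T)) ∧ MemLp h₂ 1 (volume.restrict (Icc 0 T)) ∧
    ∀ᵐ t ∂(volume.restrict (Icc 0 T)), skeletonDrift ι c ψ u t = h₁ t + dualEmb ι (h₂ t)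
  equation : ∀ (t : ℝ) (ht : t ∈ Icc 0 T),
    dualEmb ι (u.1.fst ⟨t, ht⟩) = dualEmb ι x - ∫ s in (0 : ℝ)..t, skeletonDrift ι c ψ u s

end Solutions

end CritVar

end

/-! The equation is quasilinear. Near u₀ the leading operator A₀(t, ·) is frozen at some v₁ ∈ V, the
resulting linear equation is solved by maximal regularity, and everything else is a contraction on a
small ball of MR over a short time. Functionals on V are represented in V by the Riesz isomorphism,
so an equation in V* becomes one in V, in which x ∈ H is represented by ι† x.

Linear theory. For u' = k + m with k ∈ L²(V*) and m ∈ L¹(H), the energy identity (`energy_identity`)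
gives an a priori bound (`IsEvolution.norm_le`) whose constant 2 + 1/θ does not depend on T. Hence
the solvable data form a closed subspace (`exists_isClosed_solvable`). Data (x, k, 0) orthogonal to
the solvable ones of this form satisfy a backward adjoint problem, which coercivity forces to be
trivial (`inner_nonpos_of_forall_primitive`, `exists_isEvolution_linear`). The L¹(H) part is needed
because B(·, u) and ψ are only L² in time.

Nonlinear terms. The inequality ‖v‖_β ≲ ‖v‖_H^(2-2β) ‖v‖_V^(2β-1) (`exists_interpNorm_le`), the
criticality condition and Young's inequality bound the sums controlling increments of F and G on
H-balls by κ‖u-v‖_V + D(1+‖u‖_V+‖v‖_V)‖u-v‖_H with κ as small as desired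
(`exists_interpNorm_increment_le`). The weight is linear in the V-norms, so it is square integrable
in time along MR functions.

Existence. Around the constant path v₁ the perturbation is small through κ, through the radius r, or
through the length of the time interval (`perturbation_le`, `exists_isEvolution_of_contraction`). No
constant depends on the individual initial value, so one time T' and one bound R serve a whole ball
of H (`CriticalVariational.exists_strongSolution`).

Uniqueness and dependence on data. The difference of two solutions satisfies an energy inequality
with the integrable weight (1+‖u‖_V+‖w‖_V)² + ‖ψ‖² (`CriticalVariational.exists_dissipation`), and
Gronwall gives a Lipschitz estimate whose constant depends on the size of both solutions
(`CriticalVariational.exists_norm_sub_le`). Uniqueness follows; it identifies every solution with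
the constructed one, hence bounds it by R, and then the Lipschitz constant becomes uniform. -/

namespace CritVar

open Filter Topology

open ContinuousLinearMap (adjoint)

/-! ### Hilbert-Schmidt operators as bounded operators. -/

section HilbertSchmidtBound

variable {U H : Type*}
  [NormedAddCommGroup U] [InnerProductSpace ℝ U] [CompleteSpace U]
  [NormedAddCommGroup H] [InnerProductSpace ℝ H]

theorem HSOp.sum_norm_sq_le (S : HSOp U H) (s : Finset (basisIndex U)) :
    ∑ i ∈ s, ‖S.toCLM (stdBasis U i)‖ ^ 2 ≤ ‖S‖ ^ 2 := by
  have h := lp.sum_rpow_le_norm_rpow (p := 2) (by norm_num) (HSOp.toLp U H S) s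
  simp only [ENNReal.toReal_ofNat, Real.rpow_ofNat] at h
  exact h

/-- The Hilbert-Schmidt norm dominates the operator norm. -/
theorem HSOp.norm_toCLM_apply_le (S : HSOp U H) (x : U) : ‖S.toCLM x‖ ≤ ‖S‖ * ‖x‖ := by
  have hsum := ((stdBasis U).hasSum_repr x).mapL S.toCLM
  refine le_of_tendsto hsum.norm (Filter.Eventually.of_forall fun s => ?_)
  have h1 : ∑ i ∈ s, |(stdBasis U).repr x i| ^ 2 ≤ ‖x‖ ^ 2 := by
    have := (stdBasis U).orthonormal.sum_inner_products_le x (s := s)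
    simpa [HilbertBasis.repr_apply_apply] using this
  calc ‖∑ i ∈ s, S.toCLM ((stdBasis U).repr x i • stdBasis U i)‖
      ≤ ∑ i ∈ s, ‖S.toCLM (stdBasis U i)‖ * |(stdBasis U).repr x i| := by
        refine (norm_sum_le _ _).trans (Finset.sum_le_sum fun i _ => ?_)
        rw [map_smul, norm_smul, mul_comm, Real.norm_eq_abs]
    _ ≤ ‖S‖ * ‖x‖ := by
        refine abs_le_of_sq_le_sq' ?_ (by positivity) |>.2
        refine (Finset.sum_mul_sq_le_sq_mul_sq s _ _).trans ?_
        rw [mul_pow]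
        exact mul_le_mul (S.sum_norm_sq_le s) h1 (by positivity) (by positivity)

variable (U H) in
/-- The inclusion of the Hilbert-Schmidt operators into the bounded operators. -/
noncomputable def HSOp.inclusion : HSOp U H →L[ℝ] U →L[ℝ] H :=
  LinearMap.mkContinuous
    { toFun := HSOp.toCLM, map_add' := fun _ _ => rfl, map_smul' := fun _ _ => rfl } 1 fun S => by
      rw [one_mul]
      exact S.toCLM.opNorm_le_bound (norm_nonneg _) S.norm_toCLM_apply_le

theorem HSOp.toCLM_sub_apply (S R : HSOp U H) (x : U) :
    (S - R).toCLM x = S.toCLM x - R.toCLM x := by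
  change HSOp.inclusion U H (S - R) x = HSOp.inclusion U H S x - HSOp.inclusion U H R x
  rw [map_sub, sub_apply]

end HilbertSchmidtBound

/-! ### The complex interpolation norm and its multiplicative inequality. -/

section Interpolation

variable {V H : Type*}
  [NormedAddCommGroup V] [InnerProductSpace ℝ V]
  [NormedAddCommGroup H] [InnerProductSpace ℝ H]

theorem interpNorm_nonneg (ι : V →L[ℝ] H) (β : ℝ) (v : V) : 0 ≤ interpNorm ι β v := by
  refine Real.sInf_nonneg ?_
  rintro M ⟨f, g, h, -⟩
  exact (norm_nonneg _).trans (h.norm_boundary_one 0)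

theorem interpNorm_le (ι : V →L[ℝ] H) {β M : ℝ} {v : V} {f : ℂ → V →L[ℝ] ℂ}
    {g : ℝ → WithLp 2 (V × V)} (h : IsStripFunction ι f g M)
    (hf : f β = complexEmb ι (WithLp.toLp 2 (v, 0))) : interpNorm ι β v ≤ M := by
  refine csInf_le ⟨0, ?_⟩ ⟨f, g, h, hf⟩
  rintro M ⟨f, g, h, -⟩
  exact (norm_nonneg _).trans (h.norm_boundary_one 0)

theorem complexDualNorm_sum_le {κ : Type*} (s : Finset κ) (φ : κ → V →L[ℝ] ℂ) :
    complexDualNorm (∑ k ∈ s, φ k) ≤ ∑ k ∈ s, complexDualNorm (φ k) := by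
  classical
  have key : ∀ φ ψ : V →L[ℝ] ℂ,
      complexDualNorm (φ + ψ) ≤ complexDualNorm φ + complexDualNorm ψ := by
    intro φ ψ
    unfold complexDualNorm
    rw [ContinuousLinearMap.comp_add, ContinuousLinearMap.comp_add, ← Prod.mk_add_mk,
      WithLp.toLp_add]
    exact norm_add_le _ _
  induction s using Finset.induction_on with
  | empty =>
    simp only [Finset.sum_empty]
    unfold complexDualNorm
    rw [ContinuousLinearMap.comp_zero, ContinuousLinearMap.comp_zero]
    exact norm_zero.le
  | insert a s ha ih =>
    rw [Finset.sum_insert ha, Finset.sum_insert ha]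
    exact (key _ _).trans (by gcongr)

/-- The strip functions used below are sums of complex scalars times real vectors. In the
complexification, the product c · x is the pair (Re c · x, Im c · x), and the Hilbert norm is
exactly homogeneous on such products; the next two lemmas are the counterparts for V* and for the
embedding. -/
theorem norm_toLp_smul_smul {E : Type*} [NormedAddCommGroup E] [NormedSpace ℝ E] (c : ℂ) (x : E) :
    ‖WithLp.toLp 2 (c.re • x, c.im • x)‖ = ‖c‖ * ‖x‖ := by
  rw [WithLp.prod_norm_eq_of_L2]
  change √(‖c.re • x‖ ^ 2 + ‖c.im • x‖ ^ 2) = _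
  simp only [norm_smul, Real.norm_eq_abs, mul_pow, sq_abs]
  rw [← add_mul, Real.sqrt_mul (by positivity), Real.sqrt_sq (norm_nonneg _), Complex.norm_def,
    Complex.normSq_apply]
  ring_nf

theorem complexDualNorm_smul_ofReal (c : ℂ) (ξ : StrongDual ℝ V) :
    complexDualNorm (c • Complex.ofRealCLM.comp ξ) = ‖c‖ * ‖ξ‖ := by
  rw [← norm_toLp_smul_smul]
  unfold complexDualNorm
  congr 3
  · ext v; simp
  · ext v; simp

theorem complexEmb_smul_smul (ι : V →L[ℝ] H) (c : ℂ) (v : V) :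
    complexEmb ι (WithLp.toLp 2 (c.re • v, c.im • v)) =
      c • Complex.ofRealCLM.comp (dualEmb ι (ι v)) := by
  ext w
  simp only [complexEmb, add_apply, ContinuousLinearMap.comp_apply, smul_apply,
     Complex.ofRealCLM_apply, smul_eq_mul]
  apply Complex.ext <;> simp

/-- The complexified embedding as a real-linear map. -/
theorem complexEmb_sum (ι : V →L[ℝ] H) {κ : Type*} (s : Finset κ) (w : κ → WithLp 2 (V × V)) :
    complexEmb ι (∑ k ∈ s, w k) = ∑ k ∈ s, complexEmb ι (w k) := by
  classical
  have hadd : ∀ x y, complexEmb ι (x + y) = complexEmb ι x + complexEmb ι y := by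
    intro x y
    ext v
    simp [complexEmb]
    ring
  have hzero : complexEmb ι 0 = 0 := by
    ext v; simp [complexEmb]
  exact map_sum (⟨⟨complexEmb ι, hzero⟩, hadd⟩ : WithLp 2 (V × V) →+ (V →L[ℝ] ℂ)) w s

theorem complexEmb_toLp_zero_right (ι : V →L[ℝ] H) (v : V) :
    complexEmb ι (WithLp.toLp 2 (v, 0)) = Complex.ofRealCLM.comp (dualEmb ι (ι v)) := by
  have := complexEmb_smul_smul ι 1 v
  simpa using this

theorem norm_cpow_sub_ofReal {s : ℝ} (hs : 0 < s) (z : ℂ) (β : ℝ) :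
    ‖(s : ℂ) ^ (z - β)‖ = s ^ (z.re - β) := by
  rw [Complex.norm_cpow_eq_rpow_re_of_pos hs]
  simp

/-- The discrete J-method: if `v = ∑ v k` then the strip function `∑ s_k ^ (z - β) v_k` bounds
the interpolation norm of `v`. -/
theorem interpNorm_sum_le (ι : V →L[ℝ] H) (β M : ℝ) {κ : Type*} (I : Finset κ) (s : κ → ℝ)
    (hs : ∀ k, 0 < s k) (v : κ → V)
    (h₀ : ∑ k ∈ I, s k ^ (-β) * ‖dualEmb ι (ι (v k))‖ ≤ M)
    (h₁ : ∑ k ∈ I, s k ^ (1 - β) * ‖v k‖ ≤ M) :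
    interpNorm ι β (∑ k ∈ I, v k) ≤ M := by
  set f : ℂ → V →L[ℝ] ℂ := fun z =>
    ∑ k ∈ I, ((s k : ℂ) ^ (z - β)) • Complex.ofRealCLM.comp (dualEmb ι (ι (v k))) with hf
  set c : κ → ℝ → ℂ := fun k t => (s k : ℂ) ^ (1 + t * Complex.I - β) with hc
  set g : ℝ → WithLp 2 (V × V) := fun t =>
    ∑ k ∈ I, WithLp.toLp 2 ((c k t).re • v k, (c k t).im • v k) with hg
  have hpow : ∀ k, Differentiable ℂ fun z : ℂ => (s k : ℂ) ^ (z - β) := fun k z =>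
    (((differentiableAt_id).sub_const _).const_cpow
      (Or.inl (by exact_mod_cast (hs k).ne')))
  have hdiff : Differentiable ℂ f := by
    intro z
    rw [hf]
    exact DifferentiableAt.fun_sum fun k _ => ((hpow k) z).smul_const _
  refine interpNorm_le ι (f := f) (g := g)
    ⟨hdiff.continuous.continuousOn, ?_, hdiff.differentiableOn, ?_, ?_, ?_, ?_⟩ ?_
  · refine ⟨∑ k ∈ I, ((s k ^ (-β)) * (1 + s k)) * ‖Complex.ofRealCLM.comp (dualEmb ι (ι (v k)))‖,
      fun z hz => (norm_sum_le _ _).trans (Finset.sum_le_sum fun k _ => ?_)⟩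
    rw [norm_smul, norm_cpow_sub_ofReal (hs k), sub_eq_neg_add, Real.rpow_add (hs k)]
    have hz' : 0 ≤ z.re ∧ z.re ≤ 1 := hz
    have : s k ^ z.re ≤ 1 + s k := by
      rcases le_total (s k) 1 with h | h
      · linarith [Real.rpow_le_one (hs k).le h hz'.1, hs k]
      · have := Real.rpow_le_rpow_of_exponent_le h hz'.2
        rw [Real.rpow_one] at this
        linarith
    have h2 : 0 ≤ s k ^ (-β) := Real.rpow_nonneg (hs k).le _
    gcongr
  · intro t
    refine (complexDualNorm_sum_le _ _).trans (le_trans (Finset.sum_le_sum fun k _ => ?_) h₀)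
    rw [complexDualNorm_smul_ofReal, norm_cpow_sub_ofReal (hs k)]
    simp
  · refine continuous_finsetSum _ fun k _ => ?_
    have hck : Continuous (c k) :=
      (hpow k).continuous.comp (by fun_prop : Continuous fun t : ℝ => (1 + t * Complex.I : ℂ))
    refine (WithLp.prod_continuous_toLp 2 V V).comp ?_
    exact ((Complex.continuous_re.comp hck).smul continuous_const).prodMk
      ((Complex.continuous_im.comp hck).smul continuous_const)
  · intro t
    rw [hg, complexEmb_sum]
    exact Finset.sum_congr rfl fun k _ => (complexEmb_smul_smul ι _ _).symm
  · intro t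
    refine (norm_sum_le _ _).trans (le_trans (Finset.sum_le_sum fun k _ => ?_) h₁)
    rw [norm_toLp_smul_smul, hc, norm_cpow_sub_ofReal (hs k)]
    simp
  · rw [complexEmb_toLp_zero_right]
    simp only [hf, sub_self, Complex.cpow_zero, one_smul]
    ext w
    simp [map_sum]

/-- The resolvent of the embedding splits `v ∈ V` into a part `w` that is small in `V` and a part
`v - w` that is small in `V*`. -/
theorem exists_resolvent_split [CompleteSpace V] (ι : V →L[ℝ] H) (v : V) {s : ℝ} (hs : 0 < s) :
    ∃ w : V, ‖ι w‖ ≤ ‖ι v‖ ∧ s * ‖w‖ ^ 2 ≤ ‖ι v‖ ^ 2 ∧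
      ‖dualEmb ι (ι (v - w))‖ ≤ s * ‖w‖ := by
  -- By Lax-Milgram, w solves s w + ι†ι w = ι†ι v. Testing with w itself gives the two bounds by ‖ι
  -- v‖, and reading the equation as ι†ι (v - w) = s w gives the dual bound.
  set B : V →L[ℝ] V →L[ℝ] ℝ := s • dualEmb (ContinuousLinearMap.id ℝ V) + (dualEmb ι).comp ι with hB
  have hBapp : ∀ x y, B x y = s * inner ℝ x y + inner ℝ (ι x) (ι y) := fun x y => by
    simp [hB, dualEmb_apply]
  have hco : IsCoercive B := by
    refine ⟨s, hs, fun u => ?_⟩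
    rw [hBapp, real_inner_self_eq_norm_sq, real_inner_self_eq_norm_sq]
    nlinarith [sq_nonneg ‖ι u‖]
  set e := hco.continuousLinearEquivOfBilin
  obtain ⟨z, hz⟩ : ∃ z : V, ∀ φ, inner ℝ z φ = inner ℝ (ι v) (ι φ) :=
    ⟨(InnerProductSpace.toDual ℝ V).symm (dualEmb ι (ι v)), fun φ => by simp [dualEmb_apply]⟩
  refine ⟨e.symm z, ?_⟩
  set w := e.symm z
  have hw : ∀ φ, s * inner ℝ w φ + inner ℝ (ι w) (ι φ) = inner ℝ (ι v) (ι φ) := by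
    intro φ
    rw [← hBapp, ← hco.continuousLinearEquivOfBilin_apply w φ, ← hz]
    congr 1
    exact e.apply_symm_apply z
  have h1 := hw w
  rw [real_inner_self_eq_norm_sq, real_inner_self_eq_norm_sq] at h1
  have h2 := real_inner_le_norm (ι v) (ι w)
  have h3 : ‖ι w‖ ≤ ‖ι v‖ := by
    by_contra hcon
    push Not at hcon
    nlinarith [norm_nonneg (ι v), norm_nonneg (ι w), mul_nonneg hs.le (sq_nonneg ‖w‖)]
  refine ⟨h3, ?_, ?_⟩
  · nlinarith [norm_nonneg (ι v), norm_nonneg (ι w), sq_nonneg ‖ι w‖]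
  · refine ContinuousLinearMap.opNorm_le_bound _ (by positivity) fun φ => ?_
    have : dualEmb ι (ι (v - w)) φ = s * inner ℝ w φ := by
      rw [dualEmb_apply, map_sub, inner_sub_left]
      linarith [hw φ]
    rw [this, norm_mul, Real.norm_of_nonneg hs.le, mul_assoc]
    gcongr
    exact norm_inner_le_norm _ _

theorem norm_dualEmb_le (ι : V →L[ℝ] H) (x : H) : ‖dualEmb ι x‖ ≤ ‖ι‖ * ‖x‖ := by
  refine ContinuousLinearMap.opNorm_le_bound _ (by positivity) fun φ => ?_
  rw [dualEmb_apply]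
  refine (norm_inner_le_norm _ _).trans ?_
  have := ι.le_opNorm φ
  calc ‖x‖ * ‖ι φ‖ ≤ ‖x‖ * (‖ι‖ * ‖φ‖) := by gcongr
    _ = _ := by ring

/-- Multiplicative interpolation inequality between `H` and `V`. -/
theorem exists_interpNorm_le [CompleteSpace V] (ι : V →L[ℝ] H) (hι : Function.Injective ι) {β : ℝ}
    (hβ : 1 / 2 < β) :
    ∃ C : ℝ, 0 ≤ C ∧ ∀ v : V, interpNorm ι β v ≤ C * (‖ι v‖ ^ (2 - 2 * β) * ‖v‖ ^ (2 * β - 1)) := by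
  -- Ratio of the dyadic series below; it is less than 1 exactly because β > 1/2.
  set q : ℝ := 2 ^ (1 - 2 * β) with hq
  have hq0 : 0 < q := by positivity
  have hq1 : q < 1 := Real.rpow_lt_one_of_one_lt_of_neg (by norm_num) (by linarith)
  refine ⟨3 * (1 - q)⁻¹, by have := sub_pos.2 hq1; positivity, fun v => ?_⟩
  rcases eq_or_ne v 0 with rfl | hv
  · have := interpNorm_sum_le ι β 0 (∅ : Finset ℕ) (fun _ => 1) (fun _ => one_pos) (fun _ => 0)
      (by simp) (by simp)
    rw [Finset.sum_empty] at this
    refine this.trans ?_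
    have := sub_pos.2 hq1
    positivity
  have hp : 0 < ‖v‖ := norm_pos_iff.2 hv
  have hh : 0 < ‖ι v‖ := norm_pos_iff.2 fun h => hv (hι (h.trans (map_zero ι).symm))
  set p := ‖v‖
  set h := ‖ι v‖
  -- At the initial scale σ 0 = ‖ι v‖ / ‖v‖ the bound h / σ 0 on the V-norm is ‖v‖, so v can serve
  -- as its own approximant there.
  set σ : ℕ → ℝ := fun k => h / p * 2 ^ k with hσ
  have hσ0 : ∀ k, 0 < σ k := fun k => by positivity
  have hσs : ∀ k, σ (k + 1) = 2 * σ k := fun k => by simp only [hσ, pow_succ]; ring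
  choose w hw1 hw2 hw3 using fun k => exists_resolvent_split ι v (pow_pos (hσ0 k) 2)
  -- The approximants are shifted by one: W 0 = v and W (k+1) is the resolvent at scale σ k, which
  -- costs only a factor 2.
  set W : ℕ → V := fun k => Nat.casesOn k v w with hW
  have hwn : ∀ k, σ k * ‖w k‖ ≤ h := fun k => by
    refine (abs_le_of_sq_le_sq' ?_ hh.le).2
    rw [mul_pow]
    exact hw2 k
  have hW1 : ∀ k, ‖ι (W k)‖ ≤ h := by
    rintro (_ | k)
    · exact le_rfl
    · exact hw1 k
  have hW2 : ∀ k, σ k * ‖W k‖ ≤ 2 * h := by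
    rintro (_ | k)
    · have : σ 0 * ‖W 0‖ = h := by
        simp only [hσ, hW, pow_zero, mul_one]
        exact div_mul_cancel₀ _ hp.ne'
      linarith
    · rw [hσs]
      have := hwn k
      simp only [hW]
      linarith
  have hW3 : ∀ k, ‖dualEmb ι (ι (v - W k))‖ ≤ σ k * h := by
    rintro (_ | k)
    · have h0 : v - W 0 = 0 := sub_self v
      rw [h0, map_zero, map_zero, norm_zero]
      exact mul_nonneg (hσ0 _).le hh.le
    · refine (hw3 k).trans ?_
      rw [hσs, sq, mul_assoc]
      have := mul_le_mul_of_nonneg_left (hwn k) (hσ0 k).le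
      have := mul_nonneg (hσ0 k).le hh.le
      linarith
  -- Once σ L exceeds ‖ι‖, the whole remainder W L is already small enough in V*, so the telescoping
  -- sum can be cut off and stays finite.
  obtain ⟨L, hL⟩ : ∃ L : ℕ, ‖ι‖ ≤ σ L := by
    obtain ⟨L, hL⟩ := pow_unbounded_of_one_lt (‖ι‖ / (h / p)) (one_lt_two (α := ℝ))
    refine ⟨L, ?_⟩
    rw [div_lt_iff₀ (by positivity)] at hL
    simp only [hσ]
    linarith
  set W' : ℕ → V := fun k => if k ≤ L then W k else 0 with hW'
  set d : ℕ → V := fun k => W' k - W' (k + 1) with hd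
  have hsum : ∑ k ∈ Finset.range (L + 1), d k = v := by
    rw [hd, Finset.sum_range_sub']
    simp [hW', hW]
  have hdV : ∀ k ∈ Finset.range (L + 1), ‖d k‖ ≤ 3 * h * (σ k)⁻¹ := by
    intro k hk
    have hkL : k ≤ L := Nat.lt_succ_iff.1 (Finset.mem_range.1 hk)
    rw [← div_eq_mul_inv, le_div_iff₀ (hσ0 k)]
    have h1 := hW2 k
    by_cases hk1 : k + 1 ≤ L
    · have h2 := hW2 (k + 1)
      rw [hσs] at h2
      simp only [hd, hW', hkL, hk1, if_true]
      have := norm_sub_le (W k) (W (k + 1))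
      nlinarith [hσ0 k]
    · simp only [hd, hW', hkL, hk1, if_true, if_false, sub_zero]
      linarith
  have hdD : ∀ k ∈ Finset.range (L + 1), ‖dualEmb ι (ι (d k))‖ ≤ 3 * h * σ k := by
    intro k hk
    have hkL : k ≤ L := Nat.lt_succ_iff.1 (Finset.mem_range.1 hk)
    have hσh := mul_pos (hσ0 k) hh
    by_cases hk1 : k + 1 ≤ L
    · have h1 := hW3 k
      have h2 := hW3 (k + 1)
      rw [hσs] at h2
      have h3 : d k = (v - W (k + 1)) - (v - W k) := by
        simp only [hd, hW', hkL, hk1, if_true]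
        abel
      rw [h3, map_sub, map_sub]
      refine (norm_sub_le _ _).trans ?_
      linarith
    · have hkL' : k = L := by omega
      simp only [hd, hW', hkL, hk1, if_true, if_false, sub_zero]
      refine (norm_dualEmb_le ι _).trans ?_
      have : ‖ι‖ * ‖ι (W k)‖ ≤ σ k * h := by
        rw [hkL'] at *
        exact mul_le_mul hL (hW1 _) (norm_nonneg _) (hσ0 _).le
      linarith
  have hσq : ∀ k, σ k ^ (1 - 2 * β) = (h / p) ^ (1 - 2 * β) * q ^ k := fun k => by
    simp only [hσ]
    rw [Real.mul_rpow (by positivity) (by positivity), hq, ← Real.rpow_natCast,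
      ← Real.rpow_natCast, ← Real.rpow_mul (by norm_num), ← Real.rpow_mul (by norm_num),
      mul_comm (k : ℝ)]
  have hgeom : ∑ k ∈ Finset.range (L + 1), 3 * h * σ k ^ (1 - 2 * β) ≤
      3 * (1 - q)⁻¹ * (h ^ (2 - 2 * β) * p ^ (2 * β - 1)) := by
    simp only [hσq]
    rw [← Finset.mul_sum, ← Finset.mul_sum]
    have h1 : ∑ k ∈ Finset.range (L + 1), q ^ k ≤ (1 - q)⁻¹ := by
      rw [← tsum_geometric_of_lt_one hq0.le hq1]
      exact (summable_geometric_of_lt_one hq0.le hq1).sum_le_tsum _ fun k _ => by positivity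
    have h2 : h * (h / p) ^ (1 - 2 * β) = h ^ (2 - 2 * β) * p ^ (2 * β - 1) := by
      rw [Real.div_rpow hh.le hp.le, div_eq_mul_inv, ← Real.rpow_neg hp.le, ← mul_assoc]
      nth_rw 1 [← Real.rpow_one h]
      rw [← Real.rpow_add hh]
      ring_nf
    calc 3 * h * ((h / p) ^ (1 - 2 * β) * ∑ k ∈ Finset.range (L + 1), q ^ k)
        = 3 * (h * (h / p) ^ (1 - 2 * β)) * ∑ k ∈ Finset.range (L + 1), q ^ k := by ring
      _ ≤ 3 * (h * (h / p) ^ (1 - 2 * β)) * (1 - q)⁻¹ := by gcongr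
      _ = _ := by rw [h2]; ring
  have hpow : ∀ k (x : ℝ), (σ k ^ 2) ^ x = σ k ^ (2 * x) := fun k x => by
    rw [← Real.rpow_natCast, ← Real.rpow_mul (hσ0 k).le]
    norm_num
  rw [← hsum]
  -- With weights σ², the bounds 3hσ in V* and 3h/σ in V both turn into 3h σ^(1-2β), so one
  -- geometric series controls both boundary lines.
  refine interpNorm_sum_le ι β _ _ (fun k => σ k ^ 2) (fun k => pow_pos (hσ0 k) 2) d
    (le_trans (Finset.sum_le_sum fun k hk => ?_) hgeom)
    (le_trans (Finset.sum_le_sum fun k hk => ?_) hgeom)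
  · rw [hpow]
    have : σ k ^ (1 - 2 * β) = σ k ^ (2 * -β) * σ k := by
      rw [← Real.rpow_add_one (hσ0 k).ne']
      ring_nf
    rw [this]
    calc _ ≤ σ k ^ (2 * -β) * (3 * h * σ k) :=
          mul_le_mul_of_nonneg_left (hdD k hk) (Real.rpow_nonneg (hσ0 k).le _)
      _ = _ := by ring
  · rw [hpow]
    have : σ k ^ (1 - 2 * β) = σ k ^ (2 * (1 - β)) * (σ k)⁻¹ := by
      rw [← Real.rpow_neg_one (σ k), ← Real.rpow_add (hσ0 k)]
      ring_nf
    rw [this]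
    calc _ ≤ σ k ^ (2 * (1 - β)) * (3 * h * (σ k)⁻¹) :=
          mul_le_mul_of_nonneg_left (hdV k hk) (Real.rpow_nonneg (hσ0 k).le _)
      _ = _ := by ring

end Interpolation

/-! ### Continuity of translations on L^p. -/

section Translation

variable {E : Type*} [NormedAddCommGroup E]

/-- Translation by `s` on `L^p(ℝ; E)`. -/
noncomputable def translateLp {p : ℝ≥0∞} (s : ℝ) : Lp E p (volume : Measure ℝ) →+
    Lp E p (volume : Measure ℝ) :=
  Lp.compMeasurePreserving (fun r => r + s) (measurePreserving_add_right volume s)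

theorem coeFn_translateLp {p : ℝ≥0∞} (s : ℝ) (f : Lp E p (volume : Measure ℝ)) :
    translateLp s f =ᵐ[volume] fun r => f (r + s) :=
  Lp.coeFn_compMeasurePreserving f _

/-- The limits in the energy identity and in the backward uniqueness argument both rest on this
strong continuity; neither requires mollification in time. -/
theorem tendsto_translateLp {p : ℝ≥0∞} [Fact (1 ≤ p)] (hp : p ≠ ∞)
    (f : Lp E p (volume : Measure ℝ)) :
    Tendsto (fun s : ℝ => translateLp s f) (𝓝 0) (𝓝 f) := by
  have h0 : translateLp 0 f = f := by
    refine Lp.ext ((coeFn_translateLp 0 f).trans ?_)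
    simp
  let g : C(ℝ, C(ℝ, ℝ)) := ContinuousMap.curry ⟨fun a : ℝ × ℝ => a.2 + a.1, by fun_prop⟩
  have h := Filter.Tendsto.compMeasurePreservingLp (μ := (volume : Measure ℝ))
    (ν := (volume : Measure ℝ)) (tendsto_const_nhds (x := f) (f := 𝓝 (0 : ℝ)))
    (g.continuous.tendsto 0) (fun s => measurePreserving_add_right volume s)
    (measurePreserving_add_right volume 0) hp
  refine h.trans_eq ?_
  congr 1

theorem translateLp_toLp {p : ℝ≥0∞} {f : ℝ → E} (hf : MemLp f p volume) (s : ℝ) :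
    translateLp s hf.toLp =ᵐ[volume] fun r => f (r + s) :=
  (coeFn_translateLp s _).trans
    ((measurePreserving_add_right volume s).quasiMeasurePreserving.ae_eq_comp hf.coeFn_toLp)

theorem tendsto_integral_norm_translate_sub {m : ℝ → E} (hm : Integrable m) :
    Tendsto (fun s : ℝ => ∫ r, ‖m (r + s) - m r‖) (𝓝 0) (𝓝 0) := by
  have hm1 : MemLp m 1 volume := memLp_one_iff_integrable.2 hm
  have h := tendsto_translateLp ENNReal.one_ne_top hm1.toLp
  have h2 := (tendsto_iff_norm_sub_tendsto_zero.1 h)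
  refine h2.congr fun s => ?_
  rw [L1.norm_eq_integral_norm]
  refine integral_congr_ae ?_
  filter_upwards [Lp.coeFn_sub (translateLp s hm1.toLp) hm1.toLp, translateLp_toLp hm1 s,
    hm1.coeFn_toLp] with r h1 h2 h3
  rw [h1, Pi.sub_apply, h2, h3]

end Translation

/-! ### Correlations with translates and Steklov means. -/

section Steklov

variable {E : Type*} [NormedAddCommGroup E] [InnerProductSpace ℝ E]

/-- The shear (r, s) ↦ (r, r + s) preserves Lebesgue measure and turns the integrand into a product
of two integrable functions. This licenses Fubini below. -/
theorem integrable_inner_translate {p Φ : ℝ → E} (hp : Integrable p)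
    (hΦ : Integrable Φ) :
    Integrable (fun z : ℝ × ℝ => (inner ℝ (p (z.1 + z.2)) (Φ z.1) : ℝ))
      ((volume : Measure ℝ).prod volume) := by
  have h := Integrable.op_fst_snd (op := fun x y : E => (inner ℝ y x : ℝ))
    (by exact continuous_snd.inner continuous_fst)
    ⟨1, fun x y => by rw [one_mul, mul_comm]; exact norm_inner_le_norm _ _⟩ hΦ hp
  exact (measurePreserving_prod_add volume volume).integrable_comp_of_integrable h

/-- If the correlations `∫ ⟪p (r + s), Φ r⟫` are close to `c`, then so is their average, which
is the pairing of `Φ` with a Steklov mean of `p`. -/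
theorem abs_integral_inner_steklov_sub_le [CompleteSpace E] {p Φ : ℝ → E} (hp : Integrable p)
    (hΦ : Integrable Φ)
    {a b c ε : ℝ} (hab : a ≤ b)
    (h : ∀ s ∈ Ioc a b, |(∫ r, (inner ℝ (p (r + s)) (Φ r) : ℝ)) - c| ≤ ε) :
    |(∫ r, (inner ℝ (∫ s in a..b, p (r + s)) (Φ r) : ℝ)) - (b - a) * c| ≤ ε * (b - a) := by
  have hint := integrable_inner_translate hp hΦ
  have hint2 : Integrable (Function.uncurry fun s r : ℝ => (inner ℝ (p (r + s)) (Φ r) : ℝ))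
      ((volume.restrict (uIoc a b)).prod volume) := by
    refine Integrable.mono_measure hint.swap ?_
    exact Measure.prod_mono Measure.restrict_le_self le_rfl
  have hswap := intervalIntegral_integral_swap hint2
  have hin : ∀ r, (inner ℝ (∫ s in a..b, p (r + s)) (Φ r) : ℝ) =
      ∫ s in a..b, (inner ℝ (p (r + s)) (Φ r) : ℝ) := fun r => by
    have hi : IntervalIntegrable (fun s => p (r + s)) volume a b :=
      ((hp.comp_add_left r)).intervalIntegrable
    have := ((innerSL ℝ (Φ r)).intervalIntegral_comp_comm hi)
    simp only [innerSL_apply_apply] at this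
    rw [real_inner_comm, ← this]
    simp only [real_inner_comm]
  simp_rw [hin]
  rw [← hswap]
  have hII : IntervalIntegrable (fun s => ∫ r, (inner ℝ (p (r + s)) (Φ r) : ℝ)) volume a b := by
    rw [intervalIntegrable_iff]
    exact hint2.integral_prod_left
  have hc : (b - a) * c = ∫ _ in a..b, c := by simp
  rw [hc, ← intervalIntegral.integral_sub hII intervalIntegrable_const]
  have := intervalIntegral.norm_integral_le_of_norm_le_const (C := ε)
    (f := fun s => (∫ r, (inner ℝ (p (r + s)) (Φ r) : ℝ)) - c) (a := a) (b := b)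
    (by rw [uIoc_of_le hab]; exact h)
  rwa [abs_of_nonneg (sub_nonneg.2 hab)] at this

/-- The limit is joint in both shifts, since in the application the first runs over all of (0, δ]
while the second is δ. It is joint continuity of the L² inner product composed with strong
continuity of translations. -/
theorem tendsto_setIntegral_inner_translate {k u : ℝ → E} (hk : MemLp k 2 volume)
    (hu : MemLp u 2 volume) (S : Set ℝ) :
    Tendsto (fun q : ℝ × ℝ => ∫ r in S, (inner ℝ (k (r + q.1)) (u (r + q.2) + u r) : ℝ))
      (𝓝 0) (𝓝 (∫ r in S, 2 * (inner ℝ (k r) (u r) : ℝ))) := by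
  set R := LpToLpRestrictCLM ℝ E ℝ (volume : Measure ℝ) 2 S with hR
  have hRae : ∀ f : Lp E 2 (volume : Measure ℝ), R f =ᵐ[volume.restrict S] f :=
    fun f => LpToLpRestrictCLM_coeFn ℝ S f
  have hlim : Tendsto (fun q : ℝ × ℝ => (inner ℝ (R (translateLp q.1 hk.toLp))
      (R (translateLp q.2 hu.toLp) + R hu.toLp) : ℝ)) (𝓝 0)
      (𝓝 (inner ℝ (R hk.toLp) (R hu.toLp + R hu.toLp))) := by
    have h1 : Tendsto (fun q : ℝ × ℝ => q.1) (𝓝 0) (𝓝 0) := continuous_fst.tendsto' _ _ rfl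
    have h2 : Tendsto (fun q : ℝ × ℝ => q.2) (𝓝 0) (𝓝 0) := continuous_snd.tendsto' _ _ rfl
    have h3 := (tendsto_translateLp ENNReal.ofNat_ne_top hk.toLp).comp h1
    have h4 := (tendsto_translateLp ENNReal.ofNat_ne_top hu.toLp).comp h2
    exact ((R.continuous.tendsto _).comp h3).inner
      (((R.continuous.tendsto _).comp h4).add tendsto_const_nhds)
  have hk0 := ae_restrict_of_ae (s := S) hk.coeFn_toLp
  have hu0 := ae_restrict_of_ae (s := S) hu.coeFn_toLp
  have e0 : (inner ℝ (R hk.toLp) (R hu.toLp + R hu.toLp) : ℝ) =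
      ∫ r in S, 2 * (inner ℝ (k r) (u r) : ℝ) := by
    rw [L2.inner_def]
    refine integral_congr_ae ?_
    filter_upwards [hRae hk.toLp, hRae hu.toLp, Lp.coeFn_add (R hu.toLp) (R hu.toLp), hk0, hu0]
      with r a1 a2 a3 a4 a5
    rw [a3, Pi.add_apply, a1, a2, a4, a5, inner_add_right, two_mul]
  rw [← e0]
  refine hlim.congr fun q => ?_
  rw [L2.inner_def]
  refine integral_congr_ae ?_
  filter_upwards [hRae (translateLp q.1 hk.toLp), hRae (translateLp q.2 hu.toLp), hRae hu.toLp,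
    Lp.coeFn_add (R (translateLp q.2 hu.toLp)) (R hu.toLp), hu0,
    ae_restrict_of_ae (s := S) (translateLp_toLp hk q.1),
    ae_restrict_of_ae (s := S) (translateLp_toLp hu q.2)] with r a1 a2 a3 a4 a5 a6 a7
  rw [a4, Pi.add_apply, a1, a2, a3, a5, a6, a7]

/-- The L¹-H counterpart: moving the shift off m costs at most 2B times an L¹ modulus of continuity,
and the remaining shift of w is handled by dominated convergence. -/
theorem tendsto_setIntegral_inner_translate_of_bounded {m w : ℝ → E} (hm : Integrable m)
    (hw : Continuous w) {B : ℝ} (hB : ∀ r, ‖w r‖ ≤ B) (S : Set ℝ) :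
    Tendsto (fun q : ℝ × ℝ => ∫ r in S, (inner ℝ (m (r + q.1)) (w (r + q.2) + w r) : ℝ))
      (𝓝 0) (𝓝 (∫ r in S, 2 * (inner ℝ (m r) (w r) : ℝ))) := by
  have hint : ∀ (f : ℝ → E) (δ : ℝ), Integrable f →
      Integrable (fun r => (inner ℝ (f r) (w (r + δ) + w r) : ℝ)) := by
    intro f δ hf
    have hmeas : AEStronglyMeasurable (fun r => w (r + δ) + w r) volume :=
      (by fun_prop : Continuous fun r => w (r + δ) + w r).aestronglyMeasurable
    refine (hf.norm.mul_const (2 * B)).mono' (hf.1.inner hmeas) (Eventually.of_forall fun r => ?_)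
    refine (norm_inner_le_norm _ _).trans ?_
    gcongr
    linarith [norm_add_le (w (r + δ)) (w r), hB r, hB (r + δ)]
  have h1 : Tendsto (fun q : ℝ × ℝ => q.1) (𝓝 0) (𝓝 0) := continuous_fst.tendsto' _ _ rfl
  have h2 : Tendsto (fun q : ℝ × ℝ => q.2) (𝓝 0) (𝓝 0) := continuous_snd.tendsto' _ _ rfl
  have hA : Tendsto (fun q : ℝ × ℝ => ∫ r in S,
      (inner ℝ (m (r + q.1) - m r) (w (r + q.2) + w r) : ℝ)) (𝓝 0) (𝓝 0) := by
    have hb := ((tendsto_integral_norm_translate_sub hm).comp h1).mul_const (2 * B)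
    rw [zero_mul] at hb
    refine squeeze_zero_norm (fun q => ?_) hb
    have hi : Integrable fun r => m (r + q.1) - m r := (hm.comp_add_right q.1).sub hm
    refine (norm_integral_le_integral_norm _).trans ?_
    refine (setIntegral_le_integral (hint _ q.2 hi).norm
      (Eventually.of_forall fun r => norm_nonneg _)).trans ?_
    simp only [Function.comp_apply]
    rw [← integral_mul_const]
    refine integral_mono (hint _ q.2 hi).norm (hi.norm.mul_const _) fun r => ?_
    refine (norm_inner_le_norm _ _).trans ?_
    gcongr
    linarith [norm_add_le (w (r + q.2)) (w r), hB r, hB (r + q.2)]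
  have hC : Tendsto (fun δ : ℝ => ∫ r in S, (inner ℝ (m r) (w (r + δ) + w r) : ℝ)) (𝓝 0)
      (𝓝 (∫ r in S, 2 * (inner ℝ (m r) (w r) : ℝ))) := by
    refine tendsto_integral_filter_of_dominated_convergence (fun r => ‖m r‖ * (2 * B))
      (Eventually.of_forall fun δ => (hint m δ hm).1.restrict)
      (Eventually.of_forall fun δ => Eventually.of_forall fun r => ?_)
      (hm.norm.mul_const _).restrict (Eventually.of_forall fun r => ?_)
    · refine (norm_inner_le_norm _ _).trans ?_
      gcongr
      linarith [norm_add_le (w (r + δ)) (w r), hB r, hB (r + δ)]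
    · refine Continuous.tendsto' (by fun_prop) _ _ ?_
      rw [add_zero, inner_add_right, two_mul]
  have := hA.add (hC.comp h2)
  rw [zero_add] at this
  refine this.congr fun q => ?_
  simp only [Function.comp_apply]
  rw [← integral_add (hint (fun r => m (r + q.1) - m r) q.2
    ((hm.comp_add_right q.1).sub hm)).restrict
    (hint m q.2 hm).restrict]
  refine integral_congr_ae (Eventually.of_forall fun r => ?_)
  simp only [inner_sub_left, sub_add_cancel]

end Steklov

/-! ### The energy identity. -/

theorem integrable_inner_of_memLp {α E : Type*} [MeasurableSpace α] {μ : Measure α}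
    [NormedAddCommGroup E] [InnerProductSpace ℝ E] {f g : α → E} (hf : MemLp f 2 μ)
    (hg : MemLp g 2 μ) : Integrable (fun x => (inner ℝ (f x) (g x) : ℝ)) μ :=
  (hf.norm.integrable_mul hg.norm).mono' (hf.1.inner hg.1)
    (Eventually.of_forall fun _ => norm_inner_le_norm _ _)

theorem norm_sq_sub_norm_sq_eq_inner {H : Type*} [NormedAddCommGroup H]
    [InnerProductSpace ℝ H] (x y : H) : ‖x‖ ^ 2 - ‖y‖ ^ 2 = inner ℝ (x - y) (x + y) := by
  rw [inner_sub_left, inner_add_right, inner_add_right, real_inner_self_eq_norm_sq,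
    real_inner_self_eq_norm_sq, real_inner_comm x y]
  ring

section Energy

variable {V H : Type*}
  [NormedAddCommGroup V] [InnerProductSpace ℝ V] [CompleteSpace V]
  [NormedAddCommGroup H] [InnerProductSpace ℝ H] [CompleteSpace H]

/-- For δ > 0 the increment ‖w(r+δ)‖² - ‖w(r)‖² is the inner product of w(r+δ) - w(r) with w(r+δ) +
w(r), that is, the pairing of ∫₀^δ p(r+s) ds with u(r+δ) + u(r). Integrate over r ∈ (0, t] and
divide by δ: one side is an average of correlations with translates and converges to the right-hand
side, the other converges to the left-hand side by continuity of w. The room t < T keeps r + δ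
inside [0, T]. -/
theorem norm_sq_sub_eq_of_translate (ι : V →L[ℝ] H) {T t : ℝ} (ht0 : 0 ≤ t) (htT : t < T)
    {u k : ℝ → V} {w m : ℝ → H} (hu : MemLp u 2 volume) (hu1 : Integrable u)
    (hk : MemLp k 2 volume) (hk1 : Integrable k) (hm : Integrable m) (hw : Continuous w) {B : ℝ}
    (hB : ∀ r, ‖w r‖ ≤ B) (hae : ∀ᵐ r, r ∈ Icc 0 T → ι (u r) = w r)
    (heq : ∀ r ∈ Icc 0 T, ∀ r' ∈ Icc 0 T,
      adjoint ι (w r' - w r) = ∫ s in r..r', (k s + adjoint ι (m s))) :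
    ‖w t‖ ^ 2 - ‖w 0‖ ^ 2 = (∫ r in Ioc 0 t, 2 * (inner ℝ (k r) (u r) : ℝ)) +
      ∫ r in Ioc 0 t, 2 * (inner ℝ (m r) (w r) : ℝ) := by
  have hSm : MeasurableSet (Ioc 0 t) := measurableSet_Ioc
  set S : Set ℝ := Ioc 0 t with hS
  set c : ℝ := (∫ r in S, 2 * (inner ℝ (k r) (u r) : ℝ)) + ∫ r in S, 2 * (inner ℝ (m r) (w r) : ℝ)
    with hc
  have hG := (tendsto_setIntegral_inner_translate hk hu S).add
    (tendsto_setIntegral_inner_translate_of_bounded hm hw hB S)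
  rw [← hc] at hG
  set p : ℝ → V := fun s => k s + adjoint ι (m s) with hp
  have hp1 : Integrable p := hk1.add ((adjoint ι).integrable_comp hm)
  set L : ℝ → ℝ := fun δ => ∫ r in S, (‖w (r + δ)‖ ^ 2 - ‖w r‖ ^ 2) with hL
  set Φ : ℝ → ℝ → V := fun δ => S.indicator fun r => u (r + δ) + u r with hΦ
  have hΦ1 : ∀ δ, Integrable (Φ δ) := fun δ =>
    ((hu1.comp_add_right δ).add hu1).indicator hSm
  have haeδ : ∀ δ : ℝ, ∀ᵐ r, r + δ ∈ Icc 0 T → ι (u (r + δ)) = w (r + δ) := fun δ =>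
    (measurePreserving_add_right volume δ).quasiMeasurePreserving.ae hae
  have hLΦ : ∀ δ, 0 < δ → δ < T - t →
      L δ = ∫ r, (inner ℝ (∫ s in (0 : ℝ)..δ, p (r + s)) (Φ δ r) : ℝ) := by
    intro δ hδ0 hδT
    rw [hL]
    dsimp only
    rw [← integral_indicator hSm]
    refine integral_congr_ae ?_
    filter_upwards [hae, haeδ δ] with r h1 h2
    by_cases hr : r ∈ S
    · have hr1 : r ∈ Icc 0 T := ⟨hr.1.le, hr.2.trans htT.le⟩
      have hr2 : r + δ ∈ Icc 0 T := ⟨by linarith [hr.1], by linarith [hr.2]⟩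
      simp only [hΦ, indicator_of_mem hr]
      have h3 : ∫ s in (0 : ℝ)..δ, p (r + s) = adjoint ι (w (r + δ) - w r) := by
        rw [heq r hr1 (r + δ) hr2, intervalIntegral.integral_comp_add_left, add_zero]
      rw [h3, ContinuousLinearMap.adjoint_inner_left, map_add, h1 hr1, h2 hr2,
        norm_sq_sub_norm_sq_eq_inner]
    · simp only [hΦ, indicator_of_notMem hr, inner_zero_right]
  have hsplit : ∀ s δ, 0 < δ → δ < T - t →
      ∫ r, (inner ℝ (p (r + s)) (Φ δ r) : ℝ) =
        (∫ r in S, (inner ℝ (k (r + s)) (u (r + δ) + u r) : ℝ)) +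
          ∫ r in S, (inner ℝ (m (r + s)) (w (r + δ) + w r) : ℝ) := by
    intro s δ hδ0 hδT
    have i1 : Integrable (fun r => (inner ℝ (k (r + s)) (u (r + δ) + u r) : ℝ)) :=
      integrable_inner_of_memLp
        (hk.comp_measurePreserving (measurePreserving_add_right volume s))
        ((hu.comp_measurePreserving (measurePreserving_add_right volume δ)).add hu)
    have i2 : Integrable (fun r => (inner ℝ (m (r + s)) (w (r + δ) + w r) : ℝ)) := by
      have hmeas : AEStronglyMeasurable (fun r => w (r + δ) + w r) volume :=
        (by fun_prop : Continuous fun r => w (r + δ) + w r).aestronglyMeasurable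
      have hms := hm.comp_add_right s
      refine (hms.norm.mul_const (2 * B)).mono' (hms.1.inner hmeas)
        (Eventually.of_forall fun r => ?_)
      refine (norm_inner_le_norm _ _).trans ?_
      gcongr
      linarith [norm_add_le (w (r + δ)) (w r), hB r, hB (r + δ)]
    rw [← integral_add i1.restrict i2.restrict, ← integral_indicator hSm]
    refine integral_congr_ae ?_
    filter_upwards [hae, haeδ δ] with r h1 h2
    by_cases hr : r ∈ S
    · have hr1 : r ∈ Icc 0 T := ⟨hr.1.le, hr.2.trans htT.le⟩
      have hr2 : r + δ ∈ Icc 0 T := ⟨by linarith [hr.1], by linarith [hr.2]⟩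
      simp only [hΦ, indicator_of_mem hr, hp]
      rw [inner_add_left]
      rw [ContinuousLinearMap.adjoint_inner_left, map_add, h1 hr1, h2 hr2]
    · simp only [hΦ, indicator_of_notMem hr, inner_zero_right]
  have hlim1 : Tendsto (fun δ => δ⁻¹ * L δ) (𝓝[>] 0) (𝓝 c) := by
    rw [Metric.tendsto_nhds]
    intro ε hε
    obtain ⟨η, hη, hηG⟩ := Metric.eventually_nhds_iff.1
      (Metric.tendsto_nhds.1 hG (ε / 2) (half_pos hε))
    have hmem : Ioo (0 : ℝ) (min η (T - t)) ∈ 𝓝[>] (0 : ℝ) :=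
      Ioo_mem_nhdsGT (lt_min hη (sub_pos.2 htT))
    filter_upwards [hmem] with δ hδ
    have hδη : δ < η := hδ.2.trans_le (min_le_left _ _)
    have hδT : δ < T - t := hδ.2.trans_le (min_le_right _ _)
    have h1 := abs_integral_inner_steklov_sub_le hp1 (hΦ1 δ) (c := c) (ε := ε / 2) hδ.1.le
      (fun s hs => by
        rw [hsplit s δ hδ.1 hδT]
        have : dist ((s, δ) : ℝ × ℝ) 0 < η := by
          rw [Prod.dist_eq]
          simp only [Prod.fst_zero, Prod.snd_zero, Real.dist_eq, sub_zero]
          rw [abs_of_pos hs.1, abs_of_pos hδ.1]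
          exact max_lt (hs.2.trans_lt hδη) hδη
        exact (hηG this).le)
    rw [← hLΦ δ hδ.1 hδT, sub_zero] at h1
    rw [Real.dist_eq]
    have h2 : δ⁻¹ * L δ - c = δ⁻¹ * (L δ - δ * c) := by
      field_simp [hδ.1.ne']
    rw [h2, abs_mul, abs_of_pos (inv_pos.2 hδ.1)]
    calc δ⁻¹ * |L δ - δ * c| ≤ δ⁻¹ * (ε / 2 * δ) := by
          have := inv_pos.2 hδ.1
          gcongr
      _ = ε / 2 := by field_simp [hδ.1.ne']
      _ < ε := half_lt_self hε
  set f : ℝ → ℝ := fun r => ‖w r‖ ^ 2 with hf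
  have hfc : Continuous f := by fun_prop
  have hfi : ∀ a b, IntervalIntegrable f volume a b := fun a b => hfc.intervalIntegrable a b
  -- After cancellation, L δ is the integral of ‖w‖² over a window of length δ at t minus the one at
  -- 0.
  have hlim2 : Tendsto (fun δ => δ⁻¹ * L δ) (𝓝[>] 0) (𝓝 (f t - f 0)) := by
    have hd : ∀ x, HasDerivAt (fun y => ∫ r in (0 : ℝ)..y, f r) (f x) x := fun x =>
      intervalIntegral.integral_hasDerivAt_right (hfi _ _)
        hfc.stronglyMeasurable.stronglyMeasurableAtFilter hfc.continuousAt
    have h := (hd t).tendsto_slope_zero_right.sub (hd 0).tendsto_slope_zero_right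
    refine h.congr fun δ => ?_
    have hLδ : L δ = (∫ r in (0 : ℝ)..t + δ, f r) - (∫ r in (0 : ℝ)..δ, f r)
        - ∫ r in (0 : ℝ)..t, f r := by
      have h1 : L δ = ∫ r in (0 : ℝ)..t, (f (r + δ) - f r) := by
        rw [intervalIntegral.integral_of_le ht0]
      rw [h1, intervalIntegral.integral_sub
        ((show Continuous fun r => f (r + δ) by fun_prop).intervalIntegrable _ _) (hfi _ _),
        intervalIntegral.integral_comp_add_right, zero_add,
        ← intervalIntegral.integral_add_adjacent_intervals (hfi 0 δ) (hfi δ (t + δ))]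
      ring
    rw [hLδ]
    simp only [smul_eq_mul, intervalIntegral.integral_same, zero_add]
    ring
  exact tendsto_nhds_unique hlim2 hlim1

/-- The energy identity for `u' = k + m` in `V*` with `k ∈ L²(V*)` and `m ∈ L¹(H)`; functionals on
`V` are represented by elements of `V`. -/
theorem energy_identity (ι : V →L[ℝ] H) {T : ℝ} (hT : 0 < T) {u k : ℝ → V} {w m : ℝ → H}
    (hu : MemLp u 2 (volume.restrict (Icc 0 T))) (hk : MemLp k 2 (volume.restrict (Icc 0 T)))
    (hm : IntegrableOn m (Icc 0 T)) (hw : ContinuousOn w (Icc 0 T))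
    (hae : ∀ᵐ r ∂(volume.restrict (Icc 0 T)), ι (u r) = w r)
    (heq : ∀ t ∈ Icc 0 T,
      adjoint ι (w t) = adjoint ι (w 0) + ∫ s in (0 : ℝ)..t, (k s + adjoint ι (m s))) :
    ∀ t ∈ Icc 0 T, ‖w t‖ ^ 2 = ‖w 0‖ ^ 2 +
      2 * ∫ s in (0 : ℝ)..t, ((inner ℝ (k s) (u s) : ℝ) + inner ℝ (m s) (w s)) := by
  have hmeasI : MeasurableSet (Icc (0 : ℝ) T) := measurableSet_Icc
  set I : Set ℝ := Icc 0 T with hI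
  -- The path is extended by constants, to stay continuous and bounded; u, k and m are extended by
  -- zero. The relations between them are only used inside [0, T].
  set w' : ℝ → H := fun r => w (projIcc 0 T hT.le r) with hw'
  have hw'c : Continuous w' :=
    (continuousOn_iff_continuous_domRestrict.1 hw).comp continuous_projIcc
  have hw'eq : ∀ r ∈ I, w' r = w r := fun r hr => by
    simp only [hw', projIcc_of_mem hT.le hr]
  obtain ⟨B, hB⟩ := (isCompact_Icc (a := (0 : ℝ)) (b := T)).exists_bound_of_continuousOn hw
  have hu' : MemLp (I.indicator u) 2 volume := (memLp_indicator_iff_restrict hmeasI).2 hu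
  have hk' : MemLp (I.indicator k) 2 volume := (memLp_indicator_iff_restrict hmeasI).2 hk
  have hm' : Integrable (I.indicator m) := (integrable_indicator_iff hmeasI).2 hm
  have hui : IntegrableOn u I := hu.integrable one_le_two
  have hki : IntegrableOn k I := hk.integrable one_le_two
  have h0I : (0 : ℝ) ∈ I := ⟨le_rfl, hT.le⟩
  have hpI : IntegrableOn (fun s => k s + adjoint ι (m s)) I :=
    hki.add ((adjoint ι).integrable_comp hm)
  have hsub : ∀ {a b : ℝ}, a ∈ I → b ∈ I → uIcc a b ⊆ I := fun ha hb =>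
    (convex_Icc 0 T).ordConnected.uIcc_subset ha hb
  have hpII : ∀ {a b : ℝ}, a ∈ I → b ∈ I →
      IntervalIntegrable (fun s => k s + adjoint ι (m s)) volume a b := fun ha hb =>
    (hpI.mono_set (hsub ha hb)).intervalIntegrable
  have hiku : IntegrableOn (fun s => (inner ℝ (k s) (u s) : ℝ)) I :=
    integrable_inner_of_memLp hk hu
  have himw : IntegrableOn (fun s => (inner ℝ (m s) (w s) : ℝ)) I := by
    refine (hm.norm.mul_const B).mono' (hm.1.inner (hw.aestronglyMeasurable hmeasI)) ?_
    filter_upwards [ae_restrict_mem hmeasI] with r hr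
    refine (norm_inner_le_norm _ _).trans ?_
    gcongr
    exact hB r hr
  have key : ∀ t ∈ Ico 0 T, ‖w t‖ ^ 2 = ‖w 0‖ ^ 2 +
      2 * ∫ s in (0 : ℝ)..t, ((inner ℝ (k s) (u s) : ℝ) + inner ℝ (m s) (w s)) := by
    intro t ht
    have htI : t ∈ I := ⟨ht.1, ht.2.le⟩
    have h := norm_sq_sub_eq_of_translate ι (u := I.indicator u) (k := I.indicator k) (w := w')
      (m := I.indicator m) (T := T) ht.1 ht.2 hu'
      ((integrable_indicator_iff hmeasI).2 hui) hk' ((integrable_indicator_iff hmeasI).2 hki) hm'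
      hw'c (fun r => hB _ (projIcc 0 T hT.le r).2) ?_ ?_
    · rw [hw'eq t htI, hw'eq 0 h0I] at h
      have hsI : Ioc 0 t ⊆ I := fun r hr => ⟨hr.1.le, hr.2.trans htI.2⟩
      have e1 : ∫ r in Ioc 0 t, 2 * (inner ℝ (I.indicator k r) (I.indicator u r) : ℝ) =
          2 * ∫ r in Ioc 0 t, (inner ℝ (k r) (u r) : ℝ) := by
        rw [← integral_const_mul]
        refine setIntegral_congr_fun measurableSet_Ioc fun r hr => ?_
        simp only [indicator_of_mem (hsI hr)]
      have e2 : ∫ r in Ioc 0 t, 2 * (inner ℝ (I.indicator m r) (w' r) : ℝ) =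
          2 * ∫ r in Ioc 0 t, (inner ℝ (m r) (w r) : ℝ) := by
        rw [← integral_const_mul]
        refine setIntegral_congr_fun measurableSet_Ioc fun r hr => ?_
        simp only [indicator_of_mem (hsI hr), hw'eq r (hsI hr)]
      rw [e1, e2] at h
      rw [intervalIntegral.integral_of_le ht.1,
        integral_add (hiku.mono_set hsI) (himw.mono_set hsI)]
      linarith
    · have := (ae_restrict_iff' hmeasI).1 hae
      filter_upwards [this] with r hr hrI
      rw [indicator_of_mem hrI, hr hrI, hw'eq r hrI]
    · intro r hr r' hr'
      have h1 : ∫ s in r..r', (I.indicator k s + adjoint ι (I.indicator m s)) =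
          ∫ s in r..r', (k s + adjoint ι (m s)) := by
        refine intervalIntegral.integral_congr fun s hs => ?_
        simp only [indicator_of_mem (hsub hr hr' hs)]
      rw [h1, hw'eq r hr, hw'eq r' hr', map_sub, heq r' hr', heq r hr, add_sub_add_left_eq_sub,
        intervalIntegral.integral_interval_sub_left (hpII h0I hr') (hpII h0I hr)]
  have hprim : ContinuousOn
      (fun t => ∫ s in (0 : ℝ)..t, ((inner ℝ (k s) (u s) : ℝ) + inner ℝ (m s) (w s))) I := by
    have := intervalIntegral.continuousOn_primitive_interval (μ := volume) (a := 0) (b := T)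
      (f := fun s => (inner ℝ (k s) (u s) : ℝ) + inner ℝ (m s) (w s))
      (by rw [uIcc_of_le hT.le]; exact hiku.add himw)
    rwa [uIcc_of_le hT.le] at this
  -- The translation argument leaves out t = T; both sides are continuous, so the endpoint follows.
  exact EqOn.of_subset_closure key (hw.norm.pow 2)
    (continuousOn_const.add (continuousOn_const.mul hprim)) Ico_subset_Icc_self
    (by rw [closure_Ico hT.ne])

end Energy

/-! ### The L² norm in time for plain functions. -/

section L2Norm

variable {E : Type*} [NormedAddCommGroup E]

/-- The norm of `L²(0, T; E)`. -/
noncomputable def l2Norm (T : ℝ) (f : ℝ → E) : ℝ :=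
  (eLpNorm f 2 (volume.restrict (Icc 0 T))).toReal

theorem l2Norm_nonneg (T : ℝ) (f : ℝ → E) : 0 ≤ l2Norm T f := ENNReal.toReal_nonneg

theorem l2Norm_congr {F : Type*} [NormedAddCommGroup F] {T : ℝ} {f : ℝ → E} {g : ℝ → F}
    (h : ∀ᵐ t ∂(volume.restrict (Icc 0 T)), ‖f t‖ = ‖g t‖) : l2Norm T f = l2Norm T g := by
  unfold l2Norm
  rw [eLpNorm_congr_norm_ae h]

theorem l2Norm_coe {T : ℝ} (f : Lp E 2 (volume.restrict (Icc (0 : ℝ) T))) : l2Norm T f = ‖f‖ :=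
  (Lp.norm_def f).symm

theorem l2Norm_mono {F : Type*} [NormedAddCommGroup F] {T : ℝ} {f : ℝ → E} {g : ℝ → F}
    (hg : MemLp g 2 (volume.restrict (Icc 0 T)))
    (h : ∀ᵐ t ∂(volume.restrict (Icc 0 T)), ‖f t‖ ≤ ‖g t‖) : l2Norm T f ≤ l2Norm T g :=
  ENNReal.toReal_mono hg.2.ne (eLpNorm_mono_ae h)

theorem l2Norm_add_le {T : ℝ} {f g : ℝ → E} (hf : MemLp f 2 (volume.restrict (Icc 0 T)))
    (hg : MemLp g 2 (volume.restrict (Icc 0 T))) :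
    l2Norm T (fun t => f t + g t) ≤ l2Norm T f + l2Norm T g := by
  unfold l2Norm
  rw [← ENNReal.toReal_add hf.2.ne hg.2.ne]
  exact ENNReal.toReal_mono (ENNReal.add_ne_top.2 ⟨hf.2.ne, hg.2.ne⟩)
    (eLpNorm_add_le hf.1 hg.1 one_le_two)

theorem l2Norm_norm (T : ℝ) (f : ℝ → E) : l2Norm T (fun t => ‖f t‖) = l2Norm T f := by
  unfold l2Norm
  rw [eLpNorm_norm]

theorem l2Norm_const_mul (T c : ℝ) (hc : 0 ≤ c) (f : ℝ → ℝ) :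
    l2Norm T (fun t => c * f t) = c * l2Norm T f := by
  unfold l2Norm
  have : (fun t => c * f t) = c • f := rfl
  rw [this, eLpNorm_const_smul, ENNReal.toReal_mul]
  simp [abs_of_nonneg hc]

theorem l2Norm_const {T : ℝ} (hT : 0 ≤ T) (x : E) : l2Norm T (fun _ => x) = √T * ‖x‖ := by
  unfold l2Norm
  rw [eLpNorm_const' x two_ne_zero ENNReal.ofNat_ne_top]
  simp only [MeasurableSet.univ, Measure.restrict_apply, univ_inter, Real.volume_Icc, sub_zero,
    ENNReal.toReal_mul, toReal_enorm, ENNReal.toReal_ofNat, one_div]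
  rw [← ENNReal.toReal_rpow, ENNReal.toReal_ofReal hT, Real.sqrt_eq_rpow, one_div, mul_comm]

theorem integral_norm_mul_norm_le {F : Type*} [NormedAddCommGroup F] {T : ℝ} {f : ℝ → E}
    {g : ℝ → F} (hf : MemLp f 2 (volume.restrict (Icc 0 T)))
    (hg : MemLp g 2 (volume.restrict (Icc 0 T))) :
    ∫ t in Icc 0 T, ‖f t‖ * ‖g t‖ ≤ l2Norm T f * l2Norm T g := by
  have h := real_inner_le_norm hf.norm.toLp hg.norm.toLp
  rw [Lp.norm_toLp, Lp.norm_toLp, eLpNorm_norm, eLpNorm_norm, L2.inner_def] at h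
  refine le_trans (le_of_eq (integral_congr_ae ?_)) h
  filter_upwards [hf.norm.coeFn_toLp, hg.norm.coeFn_toLp] with t h1 h2
  rw [h1, h2]
  simp [mul_comm]

theorem integral_norm_sq_eq {T : ℝ} {f : ℝ → E} (hf : MemLp f 2 (volume.restrict (Icc 0 T))) :
    ∫ t in Icc 0 T, ‖f t‖ ^ 2 = l2Norm T f ^ 2 := by
  have h := real_inner_self_eq_norm_sq hf.norm.toLp
  rw [Lp.norm_toLp, eLpNorm_norm, L2.inner_def] at h
  refine Eq.trans (integral_congr_ae ?_) h
  filter_upwards [hf.norm.coeFn_toLp] with t h1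
  rw [h1]
  simp [sq]

end L2Norm

/-! ### The space MR is complete. -/

section MaximalRegularity

variable {V H : Type*}
  [NormedAddCommGroup V] [InnerProductSpace ℝ V]
  [NormedAddCommGroup H] [InnerProductSpace ℝ H]

/-- The continuous path `[0, T] → H` of an element of `MR(0, T)`, extended to `ℝ` by constants. -/
noncomputable def MR.path {ι : V →L[ℝ] H} {T : ℝ} (hT : 0 ≤ T) (u : MR ι T) (t : ℝ) : H :=
  u.1.fst (projIcc 0 T hT t)

theorem MR.path_apply {ι : V →L[ℝ] H} {T : ℝ} (hT : 0 ≤ T) (u : MR ι T) {t : ℝ}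
    (ht : t ∈ Icc 0 T) : MR.path hT u t = u.1.fst ⟨t, ht⟩ := by
  rw [MR.path, projIcc_of_mem hT ht]

theorem MR.continuous_path {ι : V →L[ℝ] H} {T : ℝ} (hT : 0 ≤ T) (u : MR ι T) :
    Continuous (MR.path hT u) :=
  u.1.fst.continuous.comp continuous_projIcc

theorem MR.norm_path_le {ι : V →L[ℝ] H} {T : ℝ} (hT : 0 ≤ T) (u : MR ι T) (t : ℝ) :
    ‖MR.path hT u t‖ ≤ ‖u.1.fst‖ :=
  u.1.fst.norm_coe_le_norm _

theorem MR.ae_eq_path {ι : V →L[ℝ] H} {T : ℝ} (hT : 0 ≤ T) (u : MR ι T) :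
    ∀ᵐ t ∂(volume.restrict (Icc (0 : ℝ) T)), ι (u.1.snd t) = MR.path hT u t := by
  filter_upwards [u.2, ae_restrict_mem measurableSet_Icc] with t h ht
  rw [h ht, MR.path_apply hT u ht]

theorem MR.memLp_snd {ι : V →L[ℝ] H} {T : ℝ} (u : MR ι T) :
    MemLp u.1.snd 2 (volume.restrict (Icc (0 : ℝ) T)) :=
  Lp.memLp _

theorem MR.norm_fst_le {ι : V →L[ℝ] H} {T : ℝ} (u : MR ι T) : ‖u.1.fst‖ ≤ ‖u‖ := by
  rw [MR.norm_eq]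
  linarith [norm_nonneg u.1.snd]

theorem MR.norm_snd_le {ι : V →L[ℝ] H} {T : ℝ} (u : MR ι T) : ‖u.1.snd‖ ≤ ‖u‖ := by
  rw [MR.norm_eq]
  linarith [norm_nonneg u.1.fst]

theorem MR.exists_of_continuousOn (ι : V →L[ℝ] H) {T : ℝ} {u : ℝ → V} {w : ℝ → H}
    (hu : MemLp u 2 (volume.restrict (Icc (0 : ℝ) T))) (hw : ContinuousOn w (Icc 0 T))
    (h : ∀ᵐ t ∂(volume.restrict (Icc (0 : ℝ) T)), ι (u t) = w t) :
    ∃ U : MR ι T, (∀ t (ht : t ∈ Icc 0 T), U.1.fst ⟨t, ht⟩ = w t) ∧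
      U.1.snd =ᵐ[volume.restrict (Icc (0 : ℝ) T)] u := by
  refine ⟨⟨WithLp.toLp 1 (⟨_, continuousOn_iff_continuous_domRestrict.1 hw⟩, hu.toLp), ?_⟩,
    fun t ht => rfl, hu.coeFn_toLp⟩
  filter_upwards [h, hu.coeFn_toLp] with t h1 h2 ht
  change ι (hu.toLp u t) = w t
  rw [h2, h1]

theorem MR.fst_sub {ι : V →L[ℝ] H} {T : ℝ} (u v : MR ι T) (t : Icc (0 : ℝ) T) :
    (u - v).1.fst t = u.1.fst t - v.1.fst t := rfl

theorem MR.snd_sub {ι : V →L[ℝ] H} {T : ℝ} (u v : MR ι T) :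
    (u - v).1.snd =ᵐ[volume.restrict (Icc (0 : ℝ) T)] fun t => u.1.snd t - v.1.snd t :=
  Lp.coeFn_sub u.1.snd v.1.snd

/-- Convergence in L²(V) yields an a.e. convergent subsequence, while the continuous components
converge at every time, so the compatibility survives in the limit. -/
theorem MR.isClosed (ι : V →L[ℝ] H) (T : ℝ) : IsClosed (MR ι T : Set (WithLp 1
    (C(Icc (0 : ℝ) T, H) × Lp V 2 (volume.restrict (Icc (0 : ℝ) T))))) := by
  refine IsSeqClosed.isClosed fun U u hU hu => ?_
  have h1 : Tendsto (fun n => (U n).fst) atTop (𝓝 u.fst) :=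
    ((WithLp.prod_continuous_ofLp 1 _ _).fst.tendsto u).comp hu
  have h2 : Tendsto (fun n => (U n).snd) atTop (𝓝 u.snd) :=
    ((WithLp.prod_continuous_ofLp 1 _ _).snd.tendsto u).comp hu
  obtain ⟨ns, hns, hae⟩ := (tendstoInMeasure_of_tendsto_Lp h2).exists_seq_tendsto_ae
  have hUn : ∀ᵐ t ∂(volume.restrict (Icc (0 : ℝ) T)), ∀ n, ∀ ht : t ∈ Icc (0 : ℝ) T,
      ι ((U n).snd t) = (U n).fst ⟨t, ht⟩ := ae_all_iff.2 fun n => hU n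
  change ∀ᵐ t ∂(volume.restrict (Icc (0 : ℝ) T)), ∀ ht : t ∈ Icc (0 : ℝ) T,
      ι (u.snd t) = u.fst ⟨t, ht⟩
  filter_upwards [hae, hUn] with t ht hUt htI
  have h3 : Tendsto (fun n => ι ((U (ns n)).snd t)) atTop (𝓝 (ι (u.snd t))) :=
    (ι.continuous.tendsto _).comp ht
  have h4 : Tendsto (fun n => (U (ns n)).fst ⟨t, htI⟩) atTop (𝓝 (u.fst ⟨t, htI⟩)) :=
    ((continuous_eval_const (⟨t, htI⟩ : Icc (0 : ℝ) T)).tendsto _).comp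
      (h1.comp hns.tendsto_atTop)
  refine tendsto_nhds_unique h3 (h4.congr fun n => ?_)
  exact (hUt (ns n) htI).symm

instance MR.completeSpace [CompleteSpace V] [CompleteSpace H] (ι : V →L[ℝ] H) (T : ℝ) :
    CompleteSpace (MR ι T) :=
  (MR.isClosed ι T).completeSpace_coe

end MaximalRegularity

/-! ### Linear evolution equations and the a priori estimate. -/

section Evolution

variable {V H : Type*}
  [NormedAddCommGroup V] [InnerProductSpace ℝ V] [CompleteSpace V]
  [NormedAddCommGroup H] [InnerProductSpace ℝ H] [CompleteSpace H]

/-- `u` solves `u' = k + m`, `u(0) = x` in `V*`. The functionals `k t` on `V` are represented by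
elements of `V`, and then `m t ∈ H` is represented by `ι† (m t)`. -/
def IsEvolution (ι : V →L[ℝ] H) {T : ℝ} (x : H) (k : ℝ → V) (m : ℝ → H) (u : MR ι T) : Prop :=
  ∀ (t : ℝ) (ht : t ∈ Icc 0 T), adjoint ι (u.1.fst ⟨t, ht⟩) =
    adjoint ι x + ∫ s in (0 : ℝ)..t, (k s + adjoint ι (m s))

/-- This is the embedding of H into V*; its injectivity lets the initial value be recovered in H
from the equation. -/
theorem adjoint_injective {ι : V →L[ℝ] H} (hd : DenseRange ι) :
    Function.Injective (adjoint ι) := by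
  intro x y h
  refine hd.eq_of_inner_left ℝ fun v => ?_
  rw [← ContinuousLinearMap.adjoint_inner_left, h, ContinuousLinearMap.adjoint_inner_left]

theorem IsEvolution.path_zero {ι : V →L[ℝ] H} (hd : DenseRange ι) {T : ℝ} (hT : 0 < T) {x : H}
    {k : ℝ → V} {m : ℝ → H} {u : MR ι T} (h : IsEvolution ι x k m u) : MR.path hT.le u 0 = x := by
  have h0 : (0 : ℝ) ∈ Icc 0 T := ⟨le_rfl, hT.le⟩
  have := h 0 h0
  rw [intervalIntegral.integral_same, add_zero] at this
  rw [MR.path_apply hT.le u h0]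
  exact adjoint_injective hd this

theorem IsEvolution.energy {ι : V →L[ℝ] H} (hd : DenseRange ι) {T : ℝ} (hT : 0 < T) {x : H}
    {k : ℝ → V} {m : ℝ → H} {u : MR ι T} (h : IsEvolution ι x k m u)
    (hk : MemLp k 2 (volume.restrict (Icc 0 T))) (hm : IntegrableOn m (Icc 0 T)) {t : ℝ}
    (ht : t ∈ Icc 0 T) :
    ‖MR.path hT.le u t‖ ^ 2 = ‖x‖ ^ 2 + 2 * ∫ s in (0 : ℝ)..t,
      ((inner ℝ (k s) (u.1.snd s) : ℝ) + inner ℝ (m s) (MR.path hT.le u s)) := by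
  have h0 := h.path_zero hd hT
  have := energy_identity ι hT (MR.memLp_snd u) hk hm (MR.continuous_path hT.le u).continuousOn
    (MR.ae_eq_path hT.le u) (fun t ht => by rw [h0, MR.path_apply hT.le u ht]; exact h t ht) t ht
  rwa [h0] at this

theorem IsEvolution.congr {ι : V →L[ℝ] H} {T : ℝ} {x : H} {k k' : ℝ → V} {m m' : ℝ → H}
    {u : MR ι T} (h : IsEvolution ι x k m u)
    (hk : ∀ᵐ t ∂(volume.restrict (Icc 0 T)),
      k t + adjoint ι (m t) = k' t + adjoint ι (m' t)) : IsEvolution ι x k' m' u := by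
  intro t ht
  rw [h t ht]
  congr 1
  refine intervalIntegral.integral_congr_ae ?_
  have := (ae_restrict_iff' measurableSet_Icc).1 hk
  filter_upwards [this] with s hs hst
  rw [uIoc_of_le ht.1] at hst
  exact hs ⟨hst.1.le, hst.2.trans ht.2⟩

theorem intervalIntegrable_evolution (ι : V →L[ℝ] H) {T : ℝ} {k : ℝ → V} {m : ℝ → H}
    (hk : MemLp k 2 (volume.restrict (Icc 0 T))) (hm : IntegrableOn m (Icc 0 T)) {t : ℝ}
    (ht : t ∈ Icc 0 T) :
    IntervalIntegrable (fun s => k s + adjoint ι (m s)) volume 0 t := by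
  have hi : IntegrableOn (fun s => k s + adjoint ι (m s)) (Icc 0 T) :=
    (hk.integrable one_le_two).add ((adjoint ι).integrable_comp hm)
  refine (hi.mono_set ?_).intervalIntegrable
  rw [uIcc_of_le ht.1]
  exact Icc_subset_Icc_right ht.2

theorem IsEvolution.sub {ι : V →L[ℝ] H} {T : ℝ} {x x' : H} {k k' : ℝ → V} {m m' : ℝ → H}
    {u u' : MR ι T} (h : IsEvolution ι x k m u) (h' : IsEvolution ι x' k' m' u')
    (hk : MemLp k 2 (volume.restrict (Icc 0 T))) (hm : IntegrableOn m (Icc 0 T))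
    (hk' : MemLp k' 2 (volume.restrict (Icc 0 T))) (hm' : IntegrableOn m' (Icc 0 T)) :
    IsEvolution ι (x - x') (fun s => k s - k' s) (fun s => m s - m' s) (u - u') := by
  intro t ht
  rw [MR.fst_sub, map_sub, map_sub, h t ht, h' t ht, add_sub_add_comm,
    ← intervalIntegral.integral_sub (intervalIntegrable_evolution ι hk hm ht)
      (intervalIntegrable_evolution ι hk' hm' ht)]
  congr 1
  refine intervalIntegral.integral_congr fun s _ => ?_
  simp only [map_sub]
  abel

/-- The a priori estimate for dissipative evolutions. -/
theorem IsEvolution.norm_le {ι : V →L[ℝ] H} (hd : DenseRange ι) {T : ℝ} (hT : 0 < T) {x : H}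
    {k k₀ : ℝ → V} {m : ℝ → H} {u : MR ι T} (h : IsEvolution ι x k m u)
    (hk : MemLp k 2 (volume.restrict (Icc 0 T))) (hm : IntegrableOn m (Icc 0 T))
    (hk₀ : MemLp k₀ 2 (volume.restrict (Icc 0 T))) {θ : ℝ} (hθ : 0 < θ)
    (hdiss : ∀ᵐ t ∂(volume.restrict (Icc 0 T)),
      (inner ℝ (k t) (u.1.snd t) : ℝ) ≤ inner ℝ (k₀ t) (u.1.snd t) - θ * ‖u.1.snd t‖ ^ 2) :
    ‖u‖ ≤ (2 + 1 / θ) * (‖x‖ + 2 * l2Norm T k₀ + 2 * ∫ t in Icc 0 T, ‖m t‖) := by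
  set w := MR.path hT.le u with hw
  set W := ‖u.1.fst‖ with hW
  set Q := ‖u.1.snd‖ with hQ
  set K := l2Norm T k₀
  set m1 := ∫ t in Icc 0 T, ‖m t‖
  have hK0 : 0 ≤ K := l2Norm_nonneg _ _
  have hm0 : 0 ≤ m1 := integral_nonneg fun _ => norm_nonneg _
  have hW0 : 0 ≤ W := norm_nonneg _
  have hQ0 : 0 ≤ Q := norm_nonneg _
  have hQ' : l2Norm T u.1.snd = Q := l2Norm_coe _
  have iu : IntegrableOn (fun s => ‖u.1.snd s‖ ^ 2) (Icc 0 T) := (MR.memLp_snd u).norm.integrable_sq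
  have iθu : IntegrableOn (fun s => θ * ‖u.1.snd s‖ ^ 2) (Icc 0 T) := iu.const_mul θ
  have iku : IntegrableOn (fun s => ‖k₀ s‖ * ‖u.1.snd s‖) (Icc 0 T) :=
    hk₀.norm.integrable_mul (MR.memLp_snd u).norm
  have imw : IntegrableOn (fun s => ‖m s‖ * W) (Icc 0 T) := hm.norm.mul_const W
  have ik : IntegrableOn (fun s => (inner ℝ (k s) (u.1.snd s) : ℝ)) (Icc 0 T) :=
    integrable_inner_of_memLp hk (MR.memLp_snd u)
  have im : IntegrableOn (fun s => (inner ℝ (m s) (w s) : ℝ)) (Icc 0 T) := by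
    refine imw.mono' (hm.1.inner (MR.continuous_path hT.le u).aestronglyMeasurable) ?_
    refine Eventually.of_forall fun s => (norm_inner_le_norm _ _).trans ?_
    gcongr
    exact MR.norm_path_le hT.le u s
  have hkey : ∀ t ∈ Icc 0 T, ‖w t‖ ^ 2 + 2 * θ * (∫ s in Ioc 0 t, ‖u.1.snd s‖ ^ 2) ≤
      ‖x‖ ^ 2 + 2 * (K * Q) + 2 * (m1 * W) := by
    intro t ht
    have hsub : Ioc 0 t ⊆ Icc 0 T := fun s hs => ⟨hs.1.le, hs.2.trans ht.2⟩
    rw [h.energy hd hT hk hm ht, intervalIntegral.integral_of_le ht.1]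
    have h1 : ∫ s in Ioc 0 t, ((inner ℝ (k s) (u.1.snd s) : ℝ) + inner ℝ (m s) (w s)) ≤
        ∫ s in Ioc 0 t, (‖k₀ s‖ * ‖u.1.snd s‖ + ‖m s‖ * W - θ * ‖u.1.snd s‖ ^ 2) := by
      refine integral_mono_ae ((ik.add im).mono_set hsub)
        (((iku.add imw).sub iθu).mono_set hsub) ?_
      filter_upwards [ae_restrict_of_ae_restrict_of_subset hsub hdiss] with s hs
      have h2 := real_inner_le_norm (k₀ s) (u.1.snd s)
      have h3 := real_inner_le_norm (m s) (w s)
      have h4 : ‖m s‖ * ‖w s‖ ≤ ‖m s‖ * W := by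
        gcongr
        exact MR.norm_path_le hT.le u s
      linarith
    have ikm : IntegrableOn (fun s => ‖k₀ s‖ * ‖u.1.snd s‖ + ‖m s‖ * W) (Ioc 0 t) :=
      (iku.add imw).mono_set hsub
    rw [integral_sub ikm (iθu.mono_set hsub),
      integral_add (iku.mono_set hsub) (imw.mono_set hsub), integral_const_mul,
      integral_mul_const] at h1
    have h5 : ∫ s in Ioc 0 t, ‖k₀ s‖ * ‖u.1.snd s‖ ≤ K * Q := by
      rw [← hQ']
      refine le_trans ?_ (integral_norm_mul_norm_le hk₀ (MR.memLp_snd u))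
      exact setIntegral_mono_set iku (Eventually.of_forall fun s => by positivity)
        (LE.le.eventuallyLE hsub)
    have h6 : ∫ s in Ioc 0 t, ‖m s‖ ≤ m1 :=
      setIntegral_mono_set hm.norm (Eventually.of_forall fun s => norm_nonneg _)
        (LE.le.eventuallyLE hsub)
    have h7 := mul_le_mul_of_nonneg_right h6 hW0
    linarith
  set R := ‖x‖ ^ 2 + 2 * (K * Q) + 2 * (m1 * W) with hR
  -- Since u(0) = x, one factor of ‖x‖² can be replaced by W, so that R becomes a multiple of W + Q.
  have hxW : ‖x‖ ≤ W := by
    rw [← h.path_zero hd hT]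
    exact MR.norm_path_le hT.le u 0
  have hR0 : 0 ≤ R := by positivity
  have hWR : W ^ 2 ≤ R := by
    have : W ≤ √R := by
      refine (ContinuousMap.norm_le _ (Real.sqrt_nonneg _)).2 fun t => ?_
      have h1 := hkey t t.2
      rw [hw, MR.path_apply hT.le u t.2] at h1
      have h2 : 0 ≤ ∫ s in Ioc 0 (t : ℝ), ‖u.1.snd s‖ ^ 2 := integral_nonneg fun _ => by positivity
      refine Real.le_sqrt_of_sq_le ?_
      have h3 := mul_nonneg hθ.le h2
      change ‖u.1.fst t‖ ^ 2 ≤ R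
      have h4 : (⟨(t : ℝ), t.2⟩ : Icc (0 : ℝ) T) = t := rfl
      rw [h4] at h1
      linarith
    calc W ^ 2 ≤ √R ^ 2 := by gcongr
      _ = R := Real.sq_sqrt hR0
  have hQR : 2 * θ * Q ^ 2 ≤ R := by
    have h1 := hkey T ⟨hT.le, le_rfl⟩
    rw [← integral_Icc_eq_integral_Ioc, integral_norm_sq_eq (MR.memLp_snd u), hQ'] at h1
    linarith [sq_nonneg ‖w T‖]
  have hQR' : 2 * Q ^ 2 ≤ 1 / θ * R := by
    rw [one_div, ← div_eq_inv_mul, le_div_iff₀ hθ]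
    linarith
  rw [MR.norm_eq]
  change W + Q ≤ _
  have hx0 := norm_nonneg x
  rcases (add_nonneg hW0 hQ0).eq_or_lt with h0 | hpos
  · rw [← h0]
    positivity
  -- Both W² and 2θQ² are at most R, and R is at most (data) · (W + Q); dividing by W + Q turns the
  -- quadratic estimate into the linear one.
  · have h1 : (W + Q) ^ 2 ≤ (2 + 1 / θ) * R := by nlinarith [sq_nonneg (W - Q)]
    have h2 : R ≤ (‖x‖ + 2 * K + 2 * m1) * (W + Q) := by
      rw [hR]
      nlinarith [mul_nonneg hK0 hW0, mul_nonneg hm0 hQ0, mul_nonneg hx0 hQ0,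
        mul_le_mul_of_nonneg_left hxW hx0]
    have h3 : (W + Q) * (W + Q) ≤ (2 + 1 / θ) * (‖x‖ + 2 * K + 2 * m1) * (W + Q) := by
      have : 0 ≤ 2 + 1 / θ := by positivity
      nlinarith [mul_le_mul_of_nonneg_left h2 this]
    exact le_of_mul_le_mul_right h3 hpos

end Evolution

/-! ### Primitives as bounded operators. -/

theorem intervalIntegrable_Lp {E : Type*} [NormedAddCommGroup E] {p : ℝ≥0∞} [Fact (1 ≤ p)]
    {T t : ℝ} (ht : t ∈ Icc 0 T)
    (f : Lp E p (volume.restrict (Icc (0 : ℝ) T))) : IntervalIntegrable f volume 0 t := by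
  have hf : IntegrableOn f (Icc 0 T) := (Lp.memLp f).integrable Fact.out
  refine (hf.mono_set ?_).intervalIntegrable
  rw [uIcc_of_le ht.1]
  exact Icc_subset_Icc_right ht.2

section Primitive

variable {E : Type*} [NormedAddCommGroup E] [NormedSpace ℝ E]

theorem norm_intervalIntegral_le {T t : ℝ} (ht : t ∈ Icc 0 T) {f : ℝ → E}
    (hf : IntegrableOn f (Icc 0 T)) : ‖∫ s in (0 : ℝ)..t, f s‖ ≤ ∫ s in Icc 0 T, ‖f s‖ := by
  refine (intervalIntegral.norm_integral_le_integral_norm ht.1).trans ?_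
  rw [intervalIntegral.integral_of_le ht.1]
  exact setIntegral_mono_set hf.norm (Eventually.of_forall fun s => norm_nonneg _)
    (LE.le.eventuallyLE fun s hs => ⟨hs.1.le, hs.2.trans ht.2⟩)

/-- Hölder on a finite interval. It makes the integrated equation at a fixed time a closed linear
condition; p is free because it is needed both for L²(V) and for L¹(H). -/
theorem exists_primitive_clm (p : ℝ≥0∞) [Fact (1 ≤ p)] {T t : ℝ} (ht : t ∈ Icc 0 T) :
    ∃ I : Lp E p (volume.restrict (Icc (0 : ℝ) T)) →L[ℝ] E, ∀ f, I f = ∫ s in (0 : ℝ)..t, f s := by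
  set μ := volume.restrict (Icc (0 : ℝ) T) with hμ
  have hIoc : ∀ {f g : ℝ → E}, f =ᵐ[μ] g → ∫ s in (0 : ℝ)..t, f s = ∫ s in (0 : ℝ)..t, g s := by
    intro f g h
    refine intervalIntegral.integral_congr_ae ?_
    filter_upwards [(ae_restrict_iff' measurableSet_Icc).1 h] with s hs hst
    rw [uIoc_of_le ht.1] at hst
    exact hs ⟨hst.1.le, hst.2.trans ht.2⟩
  refine ⟨LinearMap.mkContinuous
    { toFun := fun f : Lp E p μ => ∫ s in (0 : ℝ)..t, f s
      map_add' := fun f g => ?_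
      map_smul' := fun c f => ?_ }
    (μ univ ^ (1 / (1 : ℝ≥0∞).toReal - 1 / p.toReal)).toReal fun f => ?_, fun f => rfl⟩
  · rw [hIoc (Lp.coeFn_add f g)]
    exact intervalIntegral.integral_add (intervalIntegrable_Lp ht f) (intervalIntegrable_Lp ht g)
  · rw [hIoc (Lp.coeFn_smul c f)]
    exact intervalIntegral.integral_smul c f
  · refine (norm_intervalIntegral_le ht ((Lp.memLp f).integrable Fact.out)).trans ?_
    rw [integral_norm_eq_lintegral_enorm (Lp.aestronglyMeasurable f),
      ← eLpNorm_one_eq_lintegral_enorm,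
      Lp.norm_def, mul_comm, ← ENNReal.toReal_mul]
    have hfin : μ univ ^ (1 / (1 : ℝ≥0∞).toReal - 1 / p.toReal) ≠ ∞ := by
      refine ENNReal.rpow_ne_top_of_nonneg ?_ (measure_ne_top _ _)
      have hp1 : (1 : ℝ≥0∞) ≤ p := Fact.out
      rcases eq_or_ne p ∞ with rfl | hp
      · simp
      · have : 1 ≤ p.toReal := by
          rw [← ENNReal.toReal_one]
          exact ENNReal.toReal_mono hp hp1
        simp only [ENNReal.toReal_one, div_one, sub_nonneg]
        rw [div_le_one (by linarith)]
        exact this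
    exact ENNReal.toReal_mono (ENNReal.mul_ne_top (Lp.memLp f).2.ne hfin)
      (eLpNorm_le_eLpNorm_mul_rpow_measure_univ Fact.out (Lp.aestronglyMeasurable f))

end Primitive

/-! ### Coercive operator families and backward uniqueness. -/

variable {V H : Type*}
  [NormedAddCommGroup V] [InnerProductSpace ℝ V]
  [NormedAddCommGroup H] [InnerProductSpace ℝ H]

/-- A measurable, bounded and uniformly coercive family of operators `V → V* ≃ V`. -/
structure IsCoerciveFamily (T θ K : ℝ) (a : ℝ → V →L[ℝ] V) : Prop where
  pos : 0 < θ
  meas : ∀ v, StronglyMeasurable fun t => a t v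
  bound : ∀ t ∈ Icc 0 T, ∀ v, ‖a t v‖ ≤ K * ‖v‖
  coercive : ∀ t ∈ Icc 0 T, ∀ v, θ * ‖v‖ ^ 2 ≤ inner ℝ (a t v) v

/-- A Carathéodory argument: measurability in t for each v and continuity in v, with V separable,
give joint measurability, hence measurability along u. -/
theorem IsCoerciveFamily.memLp [TopologicalSpace.SeparableSpace V] {T θ K : ℝ}
    {a : ℝ → V →L[ℝ] V} (ha : IsCoerciveFamily T θ K a) {u : ℝ → V}
    (hu : MemLp u 2 (volume.restrict (Icc 0 T))) :
    MemLp (fun t => a t (u t)) 2 (volume.restrict (Icc 0 T)) := by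
  borelize V
  have : SecondCountableTopology V := UniformSpace.secondCountable_of_separable V
  have hmeas : AEStronglyMeasurable (fun t => a t (u t)) (volume.restrict (Icc 0 T)) := by
    have h := stronglyMeasurable_uncurry_of_continuous_of_stronglyMeasurable
      (u := fun (v : V) (t : ℝ) => a t v) (fun t => (a t).continuous) ha.meas
    refine ⟨fun t => a t (hu.1.mk u t),
      h.comp_measurable (hu.1.stronglyMeasurable_mk.measurable.prodMk measurable_id), ?_⟩
    filter_upwards [hu.1.ae_eq_mk] with t ht
    rw [ht]
  refine MemLp.of_le_mul (c := K) hu hmeas ?_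
  filter_upwards [ae_restrict_mem measurableSet_Icc] with t ht
  exact ha.bound t ht _

theorem IsCoerciveFamily.exists_clm [TopologicalSpace.SeparableSpace V] {T θ K : ℝ}
    {a : ℝ → V →L[ℝ] V} (ha : IsCoerciveFamily T θ K a) :
    ∃ 𝒜 : Lp V 2 (volume.restrict (Icc (0 : ℝ) T)) →L[ℝ] Lp V 2 (volume.restrict (Icc (0 : ℝ) T)),
      ∀ f, 𝒜 f =ᵐ[volume.restrict (Icc (0 : ℝ) T)] fun t => a t (f t) := by
  set μ := volume.restrict (Icc (0 : ℝ) T)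
  have hco : ∀ f : Lp V 2 μ, (ha.memLp (Lp.memLp f)).toLp =ᵐ[μ] fun t => a t (f t) :=
    fun f => MemLp.coeFn_toLp _
  refine ⟨LinearMap.mkContinuous
    { toFun := fun f : Lp V 2 μ => (ha.memLp (Lp.memLp f)).toLp
      map_add' := fun f g => ?_
      map_smul' := fun c f => ?_ } K fun f => ?_, hco⟩
  · refine Lp.ext ?_
    filter_upwards [hco (f + g), hco f, hco g, Lp.coeFn_add f g, Lp.coeFn_add
      (ha.memLp (Lp.memLp f)).toLp (ha.memLp (Lp.memLp g)).toLp] with t h1 h2 h3 h4 h5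
    rw [h1, h4, h5, Pi.add_apply, Pi.add_apply, h2, h3, map_add]
  · refine Lp.ext ?_
    filter_upwards [hco (c • f), hco f, Lp.coeFn_smul c f, Lp.coeFn_smul c
      (ha.memLp (Lp.memLp f)).toLp] with t h1 h2 h4 h5
    rw [h1, h4]
    simp only [RingHom.id_apply]
    rw [h5, Pi.smul_apply, Pi.smul_apply, h2, map_smul]
  · refine Lp.norm_le_mul_norm_of_ae_le_mul ?_
    filter_upwards [hco f, ae_restrict_mem measurableSet_Icc] with t h1 ht
    change ‖(ha.memLp (Lp.memLp f)).toLp _ t‖ ≤ _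
    rw [h1]
    exact ha.bound t ht _

/-- If `ι φ` correlates to the right with its translates and `p` is dual to primitives, then
`⟪φ, p⟫ ≤ 0`: this is the uniqueness argument for the backward adjoint problem. -/
theorem inner_nonpos_of_forall_primitive [CompleteSpace V] (ι : V →L[ℝ] H) {T : ℝ}
    (φ p : Lp V 2 (volume.restrict (Icc (0 : ℝ) T)))
    (h : ∀ w : ℝ → V, MemLp w 2 (volume.restrict (Icc (0 : ℝ) T)) →
      (∫ t in Icc 0 T, (inner ℝ (ι (w t)) (ι (φ t)) : ℝ)) +
        ∫ t in Icc 0 T, (inner ℝ (∫ s in (0 : ℝ)..t, w s) (p t) : ℝ) = 0) :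
    ∫ t in Icc 0 T, (inner ℝ (φ t) (p t) : ℝ) ≤ 0 := by
  have hmeasI : MeasurableSet (Icc (0 : ℝ) T) := measurableSet_Icc
  set φ0 : ℝ → V := (Icc (0 : ℝ) T).indicator φ with hφ0
  set p0 : ℝ → V := (Icc (0 : ℝ) T).indicator p with hp0
  have hφ2 : MemLp φ0 2 volume := (memLp_indicator_iff_restrict hmeasI).2 (Lp.memLp φ)
  have hp2 : MemLp p0 2 volume := (memLp_indicator_iff_restrict hmeasI).2 (Lp.memLp p)
  have hφ1 : Integrable φ0 :=
    (integrable_indicator_iff hmeasI).2 ((Lp.memLp φ).integrable one_le_two)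
  have hp1 : Integrable p0 :=
    (integrable_indicator_iff hmeasI).2 ((Lp.memLp p).integrable one_le_two)
  have hφi : ∀ a b, IntervalIntegrable φ0 volume a b := fun a b => hφ1.intervalIntegrable
  set c : ℝ := ∫ t, (inner ℝ (φ0 t) (p0 t) : ℝ) with hc
  have hcI : ∫ t in Icc 0 T, (inner ℝ (φ t) (p t) : ℝ) = c := by
    rw [hc, ← integral_indicator hmeasI]
    refine integral_congr_ae (Eventually.of_forall fun t => ?_)
    by_cases ht : t ∈ Icc 0 T
    · simp only [hφ0, hp0, indicator_of_mem ht]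
    · simp only [hφ0, hp0, indicator_of_notMem ht, inner_zero_left]
  rw [hcI]
  -- Formally the hypothesis says (ι†ι φ)' = p with φ(T) = 0, whence ∫⟪φ, p⟫ = -½‖ι φ(0)‖². As φ has
  -- no known time regularity, the sign is first proved with φ replaced by a Steklov mean.
  have hX : ∀ δ : ℝ, 0 < δ →
      ∫ t, (inner ℝ (∫ s in (-δ)..0, φ0 (t + s)) (p0 t) : ℝ) ≤ 0 := by
    intro δ hδ
    -- A backward difference of φ as test function: its primitive from 0 is the integral of φ over a
    -- backward window of length δ, since φ0 vanishes on negative times.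
    set w : ℝ → V := fun t => φ0 t - φ0 (t + -δ) with hw
    have hshift : MemLp (fun t => φ0 (t + -δ)) 2 volume :=
      hφ2.comp_measurePreserving (measurePreserving_add_right volume (-δ))
    have hw2 : MemLp w 2 volume := hφ2.sub hshift
    have hprim : ∀ t, ∫ s in (0 : ℝ)..t, w s = ∫ s in (-δ)..0, φ0 (t + s) := by
      intro t
      have hz : ∫ s in (-δ)..0, φ0 s = 0 := by
        refine intervalIntegral.integral_zero_ae ?_
        have h0 : ∀ᵐ s : ℝ, s ≠ 0 := by simp [ae_iff, measure_singleton]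
        filter_upwards [h0] with s hs0 hs
        rw [uIoc_of_le (by linarith)] at hs
        refine indicator_of_notMem (fun hsI => hs0 ?_) _
        exact le_antisymm hs.2 hsI.1
      rw [hw, intervalIntegral.integral_sub (hφi _ _) (hφ1.comp_add_right _).intervalIntegrable,
        intervalIntegral.integral_comp_add_right, intervalIntegral.integral_comp_add_left]
      have e1 := intervalIntegral.integral_add_adjacent_intervals (hφi (-δ) 0) (hφi 0 t)
      have e2 := intervalIntegral.integral_add_adjacent_intervals (hφi (-δ) (t + -δ))
        (hφi (t + -δ) t)
      rw [hz, zero_add] at e1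
      rw [e1, ← e2, zero_add, add_zero]
      abel
    have hsum := h w (hw2.restrict _)
    have h1 : ∫ t in Icc 0 T, (inner ℝ (∫ s in (0 : ℝ)..t, w s) (p t) : ℝ) =
        ∫ t, (inner ℝ (∫ s in (-δ)..0, φ0 (t + s)) (p0 t) : ℝ) := by
      rw [← integral_indicator hmeasI]
      refine integral_congr_ae (Eventually.of_forall fun t => ?_)
      by_cases ht : t ∈ Icc 0 T
      · simp only [hp0, indicator_of_mem ht, hprim]
      · simp only [hp0, indicator_of_notMem ht, inner_zero_right]
    -- Translation is an isometry of L², so ⟪g, g⟫ dominates ⟪translate of g, g⟫ by Cauchy-Schwarz.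
    have h2 : 0 ≤ ∫ t in Icc 0 T, (inner ℝ (ι (w t)) (ι (φ t)) : ℝ) := by
      set g : ℝ → H := fun t => ι (φ0 t) with hg
      have hg2 : MemLp g 2 volume := ι.comp_memLp' hφ2
      have e3 : ∫ t in Icc 0 T, (inner ℝ (ι (w t)) (ι (φ t)) : ℝ) =
          inner ℝ (hg2.toLp - translateLp (-δ) hg2.toLp) hg2.toLp := by
        rw [L2.inner_def, ← integral_indicator hmeasI]
        refine integral_congr_ae ?_
        filter_upwards [hg2.coeFn_toLp, translateLp_toLp hg2 (-δ),
          Lp.coeFn_sub hg2.toLp (translateLp (-δ) hg2.toLp)] with t e4 e5 e6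
        rw [e6, Pi.sub_apply, e4, e5]
        by_cases ht : t ∈ Icc 0 T
        · simp only [hg, hw, indicator_of_mem ht, map_sub, hφ0]
        · simp only [hg, hφ0, indicator_of_notMem ht, map_zero, inner_zero_right]
      have hn : ‖translateLp (-δ) hg2.toLp‖ = ‖hg2.toLp‖ := Lp.norm_compMeasurePreserving _ _
      rw [e3, inner_sub_left, real_inner_self_eq_norm_sq]
      have := real_inner_le_norm (translateLp (-δ) hg2.toLp) hg2.toLp
      rw [hn] at this
      nlinarith
    linarith [hsum, h1]
  refine le_of_forall_pos_le_add fun ε hε => ?_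
  have hlim : Tendsto (fun s => (inner ℝ (translateLp s hφ2.toLp) hp2.toLp : ℝ)) (𝓝 0)
      (𝓝 (inner ℝ hφ2.toLp hp2.toLp)) :=
    (tendsto_translateLp ENNReal.ofNat_ne_top hφ2.toLp).inner tendsto_const_nhds
  have e0 : (inner ℝ hφ2.toLp hp2.toLp : ℝ) = c := by
    rw [L2.inner_def]
    refine integral_congr_ae ?_
    filter_upwards [hφ2.coeFn_toLp, hp2.coeFn_toLp] with t e1 e2
    rw [e1, e2]
  have es : ∀ s, (inner ℝ (translateLp s hφ2.toLp) hp2.toLp : ℝ) =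
      ∫ t, (inner ℝ (φ0 (t + s)) (p0 t) : ℝ) := fun s => by
    rw [L2.inner_def]
    refine integral_congr_ae ?_
    filter_upwards [translateLp_toLp hφ2 s, hp2.coeFn_toLp] with t e1 e2
    rw [e1, e2]
  rw [e0] at hlim
  obtain ⟨η, hη, hηG⟩ := Metric.eventually_nhds_iff.1 (Metric.tendsto_nhds.1 hlim ε hε)
  have hδ : 0 < η / 2 := half_pos hη
  have h1 := abs_integral_inner_steklov_sub_le hφ1 hp1 (c := c) (ε := ε) (a := -(η / 2)) (b := 0)
    (by linarith) (fun s hs => by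
      have : dist s 0 < η := by
        rw [Real.dist_eq, sub_zero, abs_of_nonpos hs.2]
        linarith [hs.1]
      have := hηG this
      rw [es, Real.dist_eq] at this
      exact this.le)
  have h2 := (abs_le.1 h1).1
  have h3 := hX (η / 2) hδ
  nlinarith

/-! ### Solvability of the linear problem. -/

section LinearProblem

variable {V H : Type*}
  [NormedAddCommGroup V] [InnerProductSpace ℝ V] [CompleteSpace V]
  [TopologicalSpace.SeparableSpace V]
  [NormedAddCommGroup H] [InnerProductSpace ℝ H] [CompleteSpace H]

/-- The a priori estimate for `u' + a u = k₀ + m`, `u(0) = x`. -/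
theorem IsEvolution.norm_le_of_linear {ι : V →L[ℝ] H} (hd : DenseRange ι) {T θ K : ℝ} (hT : 0 < T)
    {a : ℝ → V →L[ℝ] V} (ha : IsCoerciveFamily T θ K a) {x : H} {k₀ : ℝ → V} {m : ℝ → H}
    {u : MR ι T} (h : IsEvolution ι x (fun t => k₀ t - a t (u.1.snd t)) m u)
    (hk₀ : MemLp k₀ 2 (volume.restrict (Icc 0 T))) (hm : IntegrableOn m (Icc 0 T)) :
    ‖u‖ ≤ (2 + 1 / θ) * (‖x‖ + 2 * l2Norm T k₀ + 2 * ∫ t in Icc 0 T, ‖m t‖) := by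
  refine h.norm_le hd hT (hk₀.sub (ha.memLp (MR.memLp_snd u))) hm hk₀ ha.pos ?_
  filter_upwards [ae_restrict_mem measurableSet_Icc] with t ht
  rw [inner_sub_left]
  linarith [ha.coercive t ht (u.1.snd t)]

/-- Paths with a derivative in L²(V) solve an equation by construction. They provide enough solvable
data for the orthogonality argument, and the constant path for the fixed point. -/
theorem exists_isEvolution_primitive (ι : V →L[ℝ] H) {T : ℝ} (v₀ : V)
    {w : ℝ → V} (hw : MemLp w 2 (volume.restrict (Icc (0 : ℝ) T))) :
    ∃ U : MR ι T, IsEvolution ι (ι v₀) (fun t => adjoint ι (ι (w t))) 0 U ∧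
      U.1.snd =ᵐ[volume.restrict (Icc (0 : ℝ) T)] fun t => v₀ + ∫ s in (0 : ℝ)..t, w s := by
  have hwi : IntegrableOn w (Icc 0 T) := hw.integrable one_le_two
  set u : ℝ → V := fun t => v₀ + ∫ s in (0 : ℝ)..t, w s with hu
  have huc : ContinuousOn u (Icc 0 T) := by
    rcases le_or_gt 0 T with hT | hT
    · have := intervalIntegral.continuousOn_primitive_interval (μ := volume) (a := 0) (b := T)
        (f := w) (by rwa [uIcc_of_le hT])
      rw [uIcc_of_le hT] at this
      exact continuousOn_const.add this
    · simp [Icc_eq_empty hT.not_ge]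
  have hu2 : MemLp u 2 (volume.restrict (Icc (0 : ℝ) T)) := by
    obtain ⟨B, hB⟩ := (isCompact_Icc (a := (0 : ℝ)) (b := T)).exists_bound_of_continuousOn huc
    refine MemLp.of_bound (huc.aestronglyMeasurable measurableSet_Icc) B ?_
    filter_upwards [ae_restrict_mem measurableSet_Icc] with t ht
    exact hB t ht
  obtain ⟨U, hU1, hU2⟩ := MR.exists_of_continuousOn ι (w := fun t => ι (u t)) hu2
    (ι.continuous.comp_continuousOn huc) (Eventually.of_forall fun t => rfl)
  refine ⟨U, fun t ht => ?_, hU2⟩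
  have hi : IntervalIntegrable w volume 0 t := by
    refine (hwi.mono_set ?_).intervalIntegrable
    rw [uIcc_of_le ht.1]
    exact Icc_subset_Icc_right ht.2
  rw [hU1 t ht, hu]
  simp only [map_add, Pi.zero_apply, map_zero, add_zero]
  congr 1
  have := ((adjoint ι).comp ι).intervalIntegral_comp_comm hi
  simpa using this.symm

/-- The data of the linear problems that are solvable form a closed subspace. -/
theorem exists_isClosed_solvable (ι : V →L[ℝ] H) (hd : DenseRange ι) {T θ K : ℝ} (hT : 0 < T)
    {a : ℝ → V →L[ℝ] V} (ha : IsCoerciveFamily T θ K a) :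
    ∃ R : Submodule ℝ (H × Lp V 2 (volume.restrict (Icc (0 : ℝ) T)) ×
      Lp H 1 (volume.restrict (Icc (0 : ℝ) T))), IsClosed (R : Set (H ×
        Lp V 2 (volume.restrict (Icc (0 : ℝ) T)) × Lp H 1 (volume.restrict (Icc (0 : ℝ) T)))) ∧
      ∀ x k m, (x, k, m) ∈ R ↔
        ∃ u : MR ι T, IsEvolution ι x (fun t => k t - a t (u.1.snd t)) m u := by
  set μ := volume.restrict (Icc (0 : ℝ) T) with hμ
  obtain ⟨𝒜, h𝒜⟩ := ha.exists_clm
  choose I hI using fun t : Icc (0 : ℝ) T => exists_primitive_clm (E := V) 2 t.2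
  choose I' hI' using fun t : Icc (0 : ℝ) T => exists_primitive_clm (E := H) 1 t.2
  let e := WithLp.prodContinuousLinearEquiv 1 ℝ C(Icc (0 : ℝ) T, H) (Lp V 2 μ)
  let pf : MR ι T →L[ℝ] C(Icc (0 : ℝ) T, H) :=
    (ContinuousLinearMap.fst ℝ _ _).comp (e.toContinuousLinearMap.comp (MR ι T).subtypeL)
  let ps : MR ι T →L[ℝ] Lp V 2 μ :=
    (ContinuousLinearMap.snd ℝ _ _).comp (e.toContinuousLinearMap.comp (MR ι T).subtypeL)
  let D := H × Lp V 2 μ × Lp H 1 μ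
  let qU : (MR ι T × D) →L[ℝ] MR ι T := ContinuousLinearMap.fst ℝ _ _
  let qD : (MR ι T × D) →L[ℝ] D := ContinuousLinearMap.snd ℝ _ _
  let qx : (MR ι T × D) →L[ℝ] H := (ContinuousLinearMap.fst ℝ _ _).comp qD
  let qk : (MR ι T × D) →L[ℝ] Lp V 2 μ :=
    (ContinuousLinearMap.fst ℝ _ _).comp ((ContinuousLinearMap.snd ℝ _ _).comp qD)
  let qm : (MR ι T × D) →L[ℝ] Lp H 1 μ :=
    (ContinuousLinearMap.snd ℝ _ _).comp ((ContinuousLinearMap.snd ℝ _ _).comp qD)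
  -- Residual of the integrated equation at time t, as a bounded operator in (u, x, k, m); solutions
  -- with their data are the common kernel.
  let Λ : Icc (0 : ℝ) T → (MR ι T × D) →L[ℝ] V := fun t =>
    (adjoint ι).comp ((ContinuousMap.evalCLM ℝ t).comp (pf.comp qU)) - (adjoint ι).comp qx -
      (I t).comp (qk - 𝒜.comp (ps.comp qU)) - (adjoint ι).comp ((I' t).comp qm)
  let Z : Submodule ℝ (MR ι T × D) := ⨅ t, (Λ t).ker
  have hZmem : ∀ u x k m, ((u, (x, k, m)) : MR ι T × D) ∈ Z ↔
      IsEvolution ι x (fun t => k t - a t (u.1.snd t)) m u := by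
    intro u x k m
    have hint : ∀ t ∈ Icc 0 T, ∫ s in (0 : ℝ)..t, (k s - a s (u.1.snd s) + adjoint ι (m s)) =
        (∫ s in (0 : ℝ)..t, (k - 𝒜 u.1.snd) s) + adjoint ι (∫ s in (0 : ℝ)..t, m s) := by
      intro t ht
      have i2 : IntervalIntegrable m volume 0 t := intervalIntegrable_Lp ht m
      have i1 : IntervalIntegrable (k - 𝒜 u.1.snd : Lp V 2 μ) volume 0 t :=
        intervalIntegrable_Lp ht _
      rw [← (adjoint ι).intervalIntegral_comp_comm i2, ← intervalIntegral.integral_add i1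
        ⟨(adjoint ι).integrable_comp i2.1, (adjoint ι).integrable_comp i2.2⟩]
      refine intervalIntegral.integral_congr_ae ?_
      filter_upwards [(ae_restrict_iff' measurableSet_Icc).1 (h𝒜 u.1.snd),
        (ae_restrict_iff' measurableSet_Icc).1 (Lp.coeFn_sub k (𝒜 u.1.snd))] with s h1 h2 hs
      rw [uIoc_of_le ht.1] at hs
      have hsI : s ∈ Icc 0 T := ⟨hs.1.le, hs.2.trans ht.2⟩
      rw [h2 hsI, Pi.sub_apply, h1 hsI]
    have hΛ : ∀ t : Icc (0 : ℝ) T, Λ t (u, (x, k, m)) = adjoint ι (u.1.fst t) - adjoint ι x -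
        (∫ s in (0 : ℝ)..t, (k - 𝒜 u.1.snd) s) - adjoint ι (∫ s in (0 : ℝ)..t, m s) := by
      intro t
      rw [← hI t, ← hI' t]
      rfl
    simp only [Z, Submodule.mem_iInf, LinearMap.mem_ker, ContinuousLinearMap.coe_coe, hΛ]
    constructor
    · intro h t ht
      rw [hint t ht]
      have := h ⟨t, ht⟩
      rw [sub_sub, sub_sub, sub_eq_zero] at this
      rw [this]
    · intro h t
      have := h t t.2
      rw [hint t t.2] at this
      rw [sub_sub, sub_sub, sub_eq_zero]
      exact this
  have hZc : IsClosed (Z : Set (MR ι T × D)) := by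
    simp only [Z, Submodule.coe_iInf]
    exact isClosed_iInter fun t => (Λ t).isClosed_ker
  have hZC : CompleteSpace Z := hZc.completeSpace_coe
  let P : Z →L[ℝ] D := qD.comp Z.subtypeL
  -- The a priori estimate bounds u by its data (5 = 1 + 2 + 2 from the three terms, plus 1 for the
  -- data itself). A map bounded below on a complete space has closed range.
  have hP : AntilipschitzWith (1 + 5 * (2 + 1 / θ)).toNNReal P := by
    have hθ := ha.pos
    refine AddMonoidHomClass.antilipschitz_of_bound P fun z => ?_
    rw [Real.coe_toNNReal _ (by positivity)]
    obtain ⟨⟨u, x, k, m⟩, hz⟩ := z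
    have h1 := ((hZmem u x k m).1 hz).norm_le_of_linear hd hT ha (Lp.memLp k)
      ((Lp.memLp m).integrable le_rfl)
    rw [l2Norm_coe, ← L1.norm_eq_integral_norm] at h1
    change max ‖u‖ ‖(x, k, m)‖ ≤ _ * ‖(x, k, m)‖
    have hx : ‖x‖ ≤ ‖(x, k, m)‖ := norm_fst_le (x, k, m)
    have hkm : ‖(k, m)‖ ≤ ‖(x, k, m)‖ := norm_snd_le (x, k, m)
    have hk : ‖k‖ ≤ ‖(k, m)‖ := norm_fst_le (k, m)
    have hm : ‖m‖ ≤ ‖(k, m)‖ := norm_snd_le (k, m)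
    have hc : 0 ≤ 2 + 1 / θ := by positivity
    have h2 : ‖x‖ + 2 * ‖k‖ + 2 * ‖m‖ ≤ 5 * ‖(x, k, m)‖ := by linarith
    have h3 := mul_le_mul_of_nonneg_left h2 hc
    have h4 := mul_nonneg hc (norm_nonneg (x, k, m))
    refine max_le ?_ ?_
    · linarith [norm_nonneg (x, k, m)]
    · linarith
  refine ⟨P.range, ?_, fun x k m => ?_⟩
  · have := hP.isClosed_range P.uniformContinuous
    exact this
  · constructor
    · rintro ⟨⟨⟨u, x', k', m'⟩, hz⟩, hzz⟩
      have : (x', k', m') = (x, k, m) := hzz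
      obtain ⟨rfl, h⟩ := Prod.mk.inj this
      obtain ⟨rfl, rfl⟩ := Prod.mk.inj h
      exact ⟨u, (hZmem _ _ _ _).1 hz⟩
    · rintro ⟨u, hu⟩
      exact ⟨⟨(u, x, k, m), (hZmem _ _ _ _).2 hu⟩, rfl⟩

/-- Maximal regularity: `u' + a u = k₀ + m`, `u(0) = x` is solvable in `MR(0, T)`. -/
theorem exists_isEvolution_linear (ι : V →L[ℝ] H) (hd : DenseRange ι) {T θ K : ℝ} (hT : 0 < T)
    {a : ℝ → V →L[ℝ] V} (ha : IsCoerciveFamily T θ K a) (x : H) {k₀ : ℝ → V} {m : ℝ → H}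
    (hk₀ : MemLp k₀ 2 (volume.restrict (Icc 0 T))) (hm : IntegrableOn m (Icc 0 T)) :
    ∃ u : MR ι T, IsEvolution ι x (fun t => k₀ t - a t (u.1.snd t)) m u := by
  set μ := volume.restrict (Icc (0 : ℝ) T) with hμ
  obtain ⟨R, hRc, hR⟩ := exists_isClosed_solvable ι hd hT ha
  have hdual : ∀ (x : H) (k : Lp V 2 μ), (x, k, (0 : Lp H 1 μ)) ∈ R := by
    -- The Hilbert product norm makes the data with m = 0 a Hilbert space, so that solvability of
    -- all of it becomes triviality of an orthogonal complement.
    let X := WithLp 2 (H × Lp V 2 μ)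
    let Ψ : X →L[ℝ] H × Lp V 2 μ × Lp H 1 μ :=
      (WithLp.fstL 2 ℝ H (Lp V 2 μ)).prod ((WithLp.sndL 2 ℝ H (Lp V 2 μ)).prod 0)
    let R' : Submodule ℝ X := R.comap Ψ.toLinearMap
    have hR'c : IsClosed (R' : Set X) := hRc.preimage Ψ.continuous
    have : CompleteSpace R' := hR'c.completeSpace_coe
    suffices h : R' = ⊤ by
      intro x k
      have : (WithLp.toLp 2 (x, k) : X) ∈ R' := h ▸ Submodule.mem_top
      exact this
    rw [← Submodule.orthogonal_eq_bot_iff, Submodule.eq_bot_iff]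
    intro z hz
    obtain ⟨𝒜, h𝒜⟩ := ha.exists_clm
    set y : H := z.fst
    set φ : Lp V 2 μ := z.snd
    set p : Lp V 2 μ := adjoint 𝒜 φ with hp
    -- Orthogonality to the data generated by the path v₀ + ∫ w, with the operator moved onto φ;
    -- this is the weak form of the backward adjoint problem.
    have key : ∀ (v₀ : V) (w : ℝ → V), MemLp w 2 μ → (inner ℝ (ι v₀) y : ℝ) +
        ((∫ t in Icc 0 T, (inner ℝ (ι (w t)) (ι (φ t)) : ℝ)) +
          ∫ t in Icc 0 T, (inner ℝ (v₀ + ∫ s in (0 : ℝ)..t, w s) (p t) : ℝ)) = 0 := by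
      intro v₀ w hw
      obtain ⟨U, hU, hU2⟩ := exists_isEvolution_primitive ι v₀ hw
      have hNw : MemLp (fun t => adjoint ι (ι (w t))) 2 μ :=
        ((adjoint ι).comp ι).comp_memLp' hw
      set k : Lp V 2 μ := hNw.toLp + 𝒜 U.1.snd with hk
      have hkR : (WithLp.toLp 2 (ι v₀, k) : X) ∈ R' := by
        change (ι v₀, k, (0 : Lp H 1 μ)) ∈ R
        refine (hR _ _ _).2 ⟨U, hU.congr ?_⟩
        filter_upwards [Lp.coeFn_add hNw.toLp (𝒜 U.1.snd), hNw.coeFn_toLp, h𝒜 U.1.snd,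
          Lp.coeFn_zero H 1 μ] with t h1 h2 h3 h4
        rw [h1, Pi.add_apply, h2, h3, h4]
        simp
      have h0 := (Submodule.mem_orthogonal _ _).1 hz _ hkR
      rw [WithLp.prod_inner_apply] at h0
      change (inner ℝ (ι v₀) y : ℝ) + inner ℝ k φ = 0 at h0
      rw [hk, inner_add_left, ← ContinuousLinearMap.adjoint_inner_right 𝒜, ← hp, L2.inner_def,
        L2.inner_def] at h0
      convert h0 using 3
      · refine integral_congr_ae ?_
        filter_upwards [hNw.coeFn_toLp] with t h1
        rw [h1, ContinuousLinearMap.adjoint_inner_left]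
      · refine integral_congr_ae ?_
        filter_upwards [hU2] with t h1
        rw [h1]
    -- With v₀ = 0 the pairing of φ with 𝒜†φ is nonpositive, while coercivity bounds it below by
    -- θ‖φ‖²; hence φ = 0, and then y is orthogonal to the dense range of ι.
    have hφp := inner_nonpos_of_forall_primitive ι φ p fun w hw => by simpa using key 0 w hw
    have hφ0 : φ = 0 := by
      have e1 : ∫ t in Icc 0 T, (inner ℝ (φ t) (p t) : ℝ) = inner ℝ (𝒜 φ) φ := by
        rw [← ContinuousLinearMap.adjoint_inner_right, ← hp, L2.inner_def]
      have e2 : θ * ‖φ‖ ^ 2 ≤ inner ℝ (𝒜 φ) φ := by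
        rw [← real_inner_self_eq_norm_sq, L2.inner_def, L2.inner_def, ← integral_const_mul]
        refine integral_mono_ae ((L2.integrable_inner φ φ).const_mul θ)
          (L2.integrable_inner (𝒜 φ) φ) ?_
        filter_upwards [h𝒜 φ, ae_restrict_mem measurableSet_Icc] with t h1 ht
        rw [h1, real_inner_self_eq_norm_sq]
        exact ha.coercive t ht _
      rw [e1] at hφp
      have h3 : ‖φ‖ ^ 2 ≤ 0 := by
        by_contra hcon
        nlinarith [ha.pos]
      exact norm_eq_zero.1 (pow_eq_zero_iff two_ne_zero |>.1 (le_antisymm h3 (sq_nonneg _)))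
    have hp0 : p = 0 := by rw [hp, hφ0, map_zero]
    have hy0 : y = 0 := by
      refine hd.eq_zero_of_inner_left ℝ fun v => ?_
      have h1 := key v 0 MemLp.zero'
      have h2 : ∫ t in Icc 0 T, (inner ℝ (v + ∫ s in (0 : ℝ)..t, (0 : ℝ → V) s) (p t) : ℝ) = 0 := by
        refine integral_eq_zero_of_ae ?_
        filter_upwards [Lp.coeFn_zero V 2 μ] with t ht
        rw [hp0, ht]
        simp
      rw [h2] at h1
      rw [real_inner_comm]
      simpa using h1
    exact (WithLp.ofLp_injective 2) (Prod.ext hy0 hφ0)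
  -- For m = 1_s c the force ι† m already lies in L²(V), so the previous case applies; sums and L¹
  -- limits follow because the solvable data are a closed subspace.
  have hL1 : ∀ m : Lp H 1 μ, ((0 : H), (0 : Lp V 2 μ), m) ∈ R := by
    refine Lp.induction ENNReal.one_ne_top _ ?_ ?_ ?_
    · intro c s hs hμs
      set m := (Lp.simpleFunc.indicatorConst 1 hs hμs.ne c : Lp H 1 μ) with hmdef
      have hmae : m =ᵐ[μ] s.indicator fun _ => c := by
        rw [hmdef, Lp.simpleFunc.coe_indicatorConst]
        exact indicatorConstLp_coeFn
      have hm2 : MemLp (s.indicator fun _ => adjoint ι c) 2 μ :=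
        memLp_indicator_const 2 hs _ (Or.inr hμs.ne)
      obtain ⟨U, hU⟩ := (hR _ _ _).1 (hdual 0 hm2.toLp)
      refine (hR _ _ _).2 ⟨U, hU.congr ?_⟩
      filter_upwards [hmae, hm2.coeFn_toLp, Lp.coeFn_zero V 2 μ, Lp.coeFn_zero H 1 μ]
        with t h1 h2 h3 h4
      rw [h1, h2, h3, h4]
      by_cases ht : t ∈ s
      · simp only [indicator_of_mem ht, Pi.zero_apply, map_zero]
        abel
      · simp only [indicator_of_notMem ht, Pi.zero_apply, map_zero]
    · intro f g hf hg _ h1 h2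
      simpa using R.add_mem h1 h2
    · exact hRc.preimage (continuous_const.prodMk (continuous_const.prodMk continuous_id))
  have hm1 : MemLp m 1 μ := memLp_one_iff_integrable.2 hm
  have hsum := R.add_mem (hdual x hk₀.toLp) (hL1 hm1.toLp)
  rw [Prod.mk_add_mk, Prod.mk_add_mk, add_zero, add_zero, zero_add] at hsum
  obtain ⟨U, hU⟩ := (hR _ _ _).1 hsum
  refine ⟨U, hU.congr ?_⟩
  filter_upwards [hk₀.coeFn_toLp, hm1.coeFn_toLp] with t h1 h2
  rw [h1, h2]

end LinearProblem

/-! ### Increments of the critical nonlinearities. -/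

section Nonlinearity

/-- Young's inequality with a small constant in front of one factor. -/
theorem exists_mul_rpow_mul_rpow_le {C l κ : ℝ} (hC : 0 ≤ C) (hl0 : 0 < l) (hl1 : l < 1)
    (hκ : 0 < κ) :
    ∃ D : ℝ, 0 ≤ D ∧ ∀ X Y : ℝ, 0 ≤ X → 0 ≤ Y → C * (X ^ (1 - l) * Y ^ l) ≤ κ * Y + D * X := by
  have h1l : 0 < 1 - l := sub_pos.2 hl1
  have hq : 0 ≤ C / κ ^ l := by positivity
  set D := (C / κ ^ l) ^ (1 - l)⁻¹ with hD
  have hD0 : 0 ≤ D := Real.rpow_nonneg hq _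
  refine ⟨D, hD0, fun X Y hX hY => ?_⟩
  have h := Real.geom_mean_le_arith_mean2_weighted h1l.le hl0.le (mul_nonneg hD0 hX)
    (mul_nonneg hκ.le hY) (by ring)
  rw [Real.mul_rpow hD0 hX, Real.mul_rpow hκ.le hY, hD, Real.rpow_inv_rpow hq h1l.ne', ← hD] at h
  have h2 : C / κ ^ l * X ^ (1 - l) * (κ ^ l * Y ^ l) = C * (X ^ (1 - l) * Y ^ l) := by
    have : κ ^ l ≠ 0 := (Real.rpow_pos_of_pos hκ _).ne'
    field_simp
  rw [h2] at h
  have h3 := mul_nonneg hD0 hX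
  have h4 := mul_nonneg hκ.le hY
  nlinarith

variable {V H : Type*}
  [NormedAddCommGroup V] [InnerProductSpace ℝ V] [CompleteSpace V]
  [NormedAddCommGroup H] [InnerProductSpace ℝ H]

/-- The critical nonlinear increments are small in `V` up to a multiple of the `H`-norm. -/
theorem exists_interpNorm_increment_le (ι : V →L[ℝ] H) (hι : Function.Injective ι) {ρ β n κ : ℝ}
    (hρ : 0 ≤ ρ) (hβ : 1 / 2 < β) (hβ1 : β < 1) (hβρ : 2 * β ≤ 1 + 1 / (1 + ρ)) (hn : 0 ≤ n)
    (hκ : 0 < κ) :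
    ∃ D : ℝ, 0 ≤ D ∧ ∀ u v : V, ‖ι u‖ ≤ n → ‖ι v‖ ≤ n →
      (1 + interpNorm ι β u ^ ρ + interpNorm ι β v ^ ρ) * interpNorm ι β (u - v) ≤
        κ * ‖u - v‖ + D * ((1 + ‖u‖ + ‖v‖) * ‖ι u - ι v‖) := by
  obtain ⟨C, hC, hCb⟩ := exists_interpNorm_le ι hι hβ
  set l := 2 * β - 1 with hl
  have hl0 : 0 < l := by rw [hl]; linarith
  have hl1 : l < 1 := by rw [hl]; linarith
  -- The criticality condition on β and ρ, rewritten: it is exactly what lets the power ρ of a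
  -- β-norm be absorbed by a V-norm to the power 1 - l.
  have hlρ : l * ρ ≤ 1 - l := by
    have : l * (1 + ρ) ≤ 1 := by
      rw [← le_div_iff₀ (by linarith)]
      rw [hl]
      linarith
    linarith
  have h2β : 2 - 2 * β = 1 - l := by rw [hl]; ring
  rw [h2β] at hCb
  set c := C * n ^ (1 - l) with hc
  have hc0 : 0 ≤ c := by positivity
  obtain ⟨D, hD, hDb⟩ := exists_mul_rpow_mul_rpow_le (C := (1 + 2 * c ^ ρ) * C) (by positivity)
    hl0 hl1 hκ
  refine ⟨D, hD, fun u v hu hv => ?_⟩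
  set P := 1 + ‖u‖ + ‖v‖ with hP
  have hP1 : 1 ≤ P := by rw [hP]; linarith [norm_nonneg u, norm_nonneg v]
  have hP0 : 0 ≤ P := by linarith
  -- On the H-ball the β-norm is at most c P^l. Raising the exponent from lρ to 1 - l is allowed
  -- since P ≥ 1, and leaves P with the same exponent as the H-increment, ready for Young's
  -- inequality.
  have hpow : ∀ z : V, ‖ι z‖ ≤ n → ‖z‖ ≤ P → interpNorm ι β z ^ ρ ≤ c ^ ρ * P ^ (1 - l) := by
    intro z hz hzP
    have h1 : interpNorm ι β z ≤ c * P ^ l := by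
      refine (hCb z).trans ?_
      rw [hc, mul_assoc]
      have := sub_pos.2 hl1
      gcongr
    calc interpNorm ι β z ^ ρ ≤ (c * P ^ l) ^ ρ :=
          Real.rpow_le_rpow (interpNorm_nonneg _ _ _) h1 hρ
      _ = c ^ ρ * P ^ (l * ρ) := by
          rw [Real.mul_rpow hc0 (by positivity), ← Real.rpow_mul hP0]
      _ ≤ c ^ ρ * P ^ (1 - l) := by
          have := Real.rpow_le_rpow_of_exponent_le hP1 hlρ
          gcongr
  have hu' := hpow u hu (by rw [hP]; linarith [norm_nonneg v])
  have hv' := hpow v hv (by rw [hP]; linarith [norm_nonneg u])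
  have h1P : 1 ≤ P ^ (1 - l) := Real.one_le_rpow hP1 (by linarith)
  have hsum : 1 + interpNorm ι β u ^ ρ + interpNorm ι β v ^ ρ ≤
      (1 + 2 * c ^ ρ) * P ^ (1 - l) := by linarith
  calc (1 + interpNorm ι β u ^ ρ + interpNorm ι β v ^ ρ) * interpNorm ι β (u - v)
      ≤ ((1 + 2 * c ^ ρ) * P ^ (1 - l)) * (C * (‖ι (u - v)‖ ^ (1 - l) * ‖u - v‖ ^ l)) :=
        mul_le_mul hsum (hCb _) (interpNorm_nonneg _ _ _) (by positivity)
    _ = (1 + 2 * c ^ ρ) * C * ((P * ‖ι (u - v)‖) ^ (1 - l) * ‖u - v‖ ^ l) := by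
        rw [Real.mul_rpow hP0 (norm_nonneg _)]
        ring
    _ ≤ κ * ‖u - v‖ + D * (P * ‖ι (u - v)‖) := hDb _ _ (by positivity) (norm_nonneg _)
    _ = _ := by rw [map_sub]

theorem exists_sum_interpNorm_increment_le (ι : V →L[ℝ] H) (hι : Function.Injective ι)
    (s : Finset ℕ) {ρ β : ℕ → ℝ}
    (h : ∀ j ∈ s, 0 ≤ ρ j ∧ 1 / 2 < β j ∧ β j < 1 ∧ 2 * β j ≤ 1 + 1 / (1 + ρ j)) {n : ℝ}
    (hn : 0 ≤ n) {κ : ℝ} (hκ : 0 < κ) :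
    ∃ D : ℝ, 0 ≤ D ∧ ∀ u v : V, ‖ι u‖ ≤ n → ‖ι v‖ ≤ n →
      ∑ j ∈ s, (1 + interpNorm ι (β j) u ^ ρ j + interpNorm ι (β j) v ^ ρ j) *
        interpNorm ι (β j) (u - v) ≤
          κ * ‖u - v‖ + D * ((1 + ‖u‖ + ‖v‖) * ‖ι u - ι v‖) := by
  induction s using Finset.induction_on generalizing κ with
  | empty =>
    refine ⟨0, le_rfl, fun u v _ _ => ?_⟩
    simp only [Finset.sum_empty, zero_mul, add_zero]
    positivity
  | insert a s ha ih =>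
    obtain ⟨D₁, hD₁, hb₁⟩ := ih (fun j hj => h j (Finset.mem_insert_of_mem hj)) (half_pos hκ)
    obtain ⟨h1, h2, h3, h4⟩ := h a (Finset.mem_insert_self a s)
    obtain ⟨D₂, hD₂, hb₂⟩ := exists_interpNorm_increment_le ι hι h1 h2 h3 h4 hn (half_pos hκ)
    refine ⟨D₁ + D₂, add_nonneg hD₁ hD₂, fun u v hu hv => ?_⟩
    rw [Finset.sum_insert ha]
    linarith [hb₁ u v hu hv, hb₂ u v hu hv]

end Nonlinearity

/-! ### Growth and increments of the coefficients. -/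

/-- On bounded subsets of `H`, the leading part `A₀` is bounded, and `F` and `G` are bounded at
each `v ∈ V`. -/
theorem CriticalVariational.exists_bounds {U V H : Type*}
    [NormedAddCommGroup U] [InnerProductSpace ℝ U] [CompleteSpace U]
    [NormedAddCommGroup V] [InnerProductSpace ℝ V] [MeasurableSpace V]
    [NormedAddCommGroup H] [InnerProductSpace ℝ H] [MeasurableSpace H]
    {ι : V →L[ℝ] H} {c : Coefficients U V H} (hc : CriticalVariational ι c) {T n : ℝ} (hT : 0 < T)
    (hn : 0 ≤ n) :
    ∃ K : ℝ, 0 ≤ K ∧ ∀ v : V, ‖ι v‖ ≤ n → (∀ t : ℝ≥0, (t : ℝ) ≤ T → ∀ w : V,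
      ‖c.A₀ t (ι v) w‖ ≤ K * ‖w‖ ∧ ‖c.B₀ t (ι v) w‖ ≤ K * ‖w‖) ∧
      ∃ L : ℝ, ∀ t : ℝ≥0, (t : ℝ) ≤ T → ‖c.F t v‖ ≤ L ∧ ‖c.G t v‖ ≤ L := by
  obtain ⟨mF, mG, ρ, β, -, hb⟩ := hc.bounds
  obtain ⟨C, hC⟩ := hb T hT n hn
  have hK : C * (1 + n) ≤ |C| * (1 + n) := by
    have := le_abs_self C
    gcongr
  refine ⟨|C| * (1 + n), by positivity, fun v hv => ⟨fun t ht w => ?_, ?_⟩⟩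
  · obtain ⟨h1, -, h3, -⟩ := hC t ht v v w hv hv
    have h4 : C * (1 + ‖ι v‖) * ‖w‖ ≤ |C| * (1 + n) * ‖w‖ := by
      have := le_abs_self C
      gcongr
    exact ⟨h1.trans h4, h3.trans h4⟩
  · refine ⟨max (C * ∑ j ∈ Finset.Icc 1 mF, (1 + interpNorm ι (β j) v ^ (ρ j + 1)))
      (C * ∑ j ∈ Finset.Icc (mF + 1) (mF + mG), (1 + interpNorm ι (β j) v ^ (ρ j + 1))),
      fun t ht => ?_⟩
    obtain ⟨-, -, -, -, h5, -, h7, -⟩ := hC t ht v v v hv hv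
    exact ⟨h5.trans (le_max_left _ _), h7.trans (le_max_right _ _)⟩

section CoefficientEstimates

variable {U V H : Type*}
  [NormedAddCommGroup U] [InnerProductSpace ℝ U] [CompleteSpace U]
  [NormedAddCommGroup V] [InnerProductSpace ℝ V] [CompleteSpace V] [MeasurableSpace V]
  [NormedAddCommGroup H] [InnerProductSpace ℝ H] [MeasurableSpace H]
  {ι : V →L[ℝ] H} {c : Coefficients U V H}

/-- The local Lipschitz estimate for `A` and `B`: up to the leading linear part, increments of `A`
have a small constant in front of the `V`-norm. -/
theorem CriticalVariational.exists_increment_le (hι : Function.Injective ι)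
    (hc : CriticalVariational ι c) {T n κ : ℝ} (hT : 0 < T) (hn : 0 ≤ n) (hκ : 0 < κ) :
    ∃ D : ℝ, 0 ≤ D ∧ ∀ t : ℝ≥0, (t : ℝ) ≤ T → ∀ u u' v : V, ‖ι u‖ ≤ n → ‖ι u'‖ ≤ n → ‖ι v‖ ≤ n →
      ‖c.A ι t u - c.A ι t u' - c.A₀ t (ι v) (u - u')‖ ≤
        (κ + D * ‖ι u - ι v‖) * ‖u - u'‖ + D * ((1 + ‖u‖ + ‖u'‖) * ‖ι u - ι u'‖) ∧
      ‖c.B ι t u - c.B ι t u'‖ ≤ D * (‖u - u'‖ + (1 + ‖u‖ + ‖u'‖) * ‖ι u - ι u'‖) := by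
  obtain ⟨K, hK, hKb⟩ := hc.exists_bounds hT hn
  obtain ⟨mF, mG, ρ, β, hj, hb⟩ := hc.bounds
  obtain ⟨C, hC⟩ := hb T hT n hn
  have hC1 : 0 < |C| + 1 := by positivity
  -- The Lipschitz constant multiplies the sum, so the target κ is divided by |C| + 1 in advance.
  -- For G no smallness is needed, since B is paired with ψ, hence κ = 1 there.
  obtain ⟨D₁, hD₁, hF⟩ := exists_sum_interpNorm_increment_le ι hι (Finset.Icc 1 mF)
    (fun j h => hj j (by simp only [Finset.mem_Icc] at h ⊢; omega)) hn
    (κ := κ / (|C| + 1)) (by positivity)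
  obtain ⟨D₂, hD₂, hG⟩ := exists_sum_interpNorm_increment_le ι hι
    (Finset.Icc (mF + 1) (mF + mG)) (fun j h => hj j (by simp only [Finset.mem_Icc] at h ⊢; omega))
    hn (κ := 1) one_pos
  refine ⟨|C| + |C| * D₁ + (K + |C| + |C| * D₂), by positivity, fun t ht u u' v hu hu' hv => ?_⟩
  have hCabs := le_abs_self C
  have nonneg_sum : ∀ s : Finset ℕ, 0 ≤ ∑ j ∈ s,
      (1 + interpNorm ι (β j) u ^ ρ j + interpNorm ι (β j) u' ^ ρ j) *
        interpNorm ι (β j) (u - u') := fun s =>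
    Finset.sum_nonneg fun j _ => by
      have h1 := Real.rpow_nonneg (interpNorm_nonneg ι (β j) u) (ρ j)
      have h2 := Real.rpow_nonneg (interpNorm_nonneg ι (β j) u') (ρ j)
      have h3 := interpNorm_nonneg ι (β j) (u - u')
      positivity
  obtain ⟨-, hAuv, -, -, -, -, -, -⟩ := hC t ht u v (u - u') hu hv
  obtain ⟨-, hAuu, -, hBuu, -, hFuu, -, hGuu⟩ := hC t ht u u' u' hu hu'
  set d := ‖u - u'‖ with hd
  set q := ‖ι u - ι u'‖ with hq
  set P := 1 + ‖u‖ + ‖u'‖ with hP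
  have hd0 : 0 ≤ d := norm_nonneg _
  have hq0 : 0 ≤ q := norm_nonneg _
  have hPq : ‖u'‖ * q ≤ P * q := by
    have : ‖u'‖ ≤ P := by rw [hP]; linarith [norm_nonneg u]
    gcongr
  have hPq0 : 0 ≤ P * q := le_trans (by positivity) hPq
  have hF' : ‖c.F t u - c.F t u'‖ ≤ κ * d + |C| * D₁ * (P * q) := by
    refine hFuu.trans ?_
    have h1 := mul_le_mul_of_nonneg_right hCabs (nonneg_sum (Finset.Icc 1 mF))
    have h2 := mul_le_mul_of_nonneg_left (hF u u' hu hu') (abs_nonneg C)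
    have h3 : |C| * (κ / (|C| + 1)) ≤ κ := by
      rw [← mul_div_assoc, div_le_iff₀ hC1]
      nlinarith [abs_nonneg C]
    have h4 := mul_le_mul_of_nonneg_right h3 hd0
    linarith
  have hG' : ‖c.G t u - c.G t u'‖ ≤ |C| * d + |C| * D₂ * (P * q) := by
    refine hGuu.trans ?_
    have h1 := mul_le_mul_of_nonneg_right hCabs (nonneg_sum (Finset.Icc (mF + 1) (mF + mG)))
    have h2 := mul_le_mul_of_nonneg_left (hG u u' hu hu') (abs_nonneg C)
    linarith
  have hA1 : ‖c.A₀ t (ι u) (u - u') - c.A₀ t (ι v) (u - u')‖ ≤ |C| * ‖ι u - ι v‖ * d := by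
    refine hAuv.trans ?_
    gcongr
  have hA2 : ‖c.A₀ t (ι u) u' - c.A₀ t (ι u') u'‖ ≤ |C| * (P * q) := by
    refine hAuu.trans ?_
    calc C * q * ‖u'‖ ≤ |C| * q * ‖u'‖ := by gcongr
      _ = |C| * (‖u'‖ * q) := by ring
      _ ≤ _ := by gcongr
  have hB2 : ‖c.B₀ t (ι u) u' - c.B₀ t (ι u') u'‖ ≤ |C| * (P * q) := by
    refine hBuu.trans ?_
    calc C * q * ‖u'‖ ≤ |C| * q * ‖u'‖ := by gcongr
      _ = |C| * (‖u'‖ * q) := by ring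
      _ ≤ _ := by gcongr
  have hB1 := ((hKb u hu).1 t ht (u - u')).2
  have n1 := mul_nonneg (abs_nonneg C) hd0
  have n2 := mul_nonneg (mul_nonneg (abs_nonneg C) hD₁) hd0
  have n3 := mul_nonneg (mul_nonneg (abs_nonneg C) hD₂) hd0
  have n4 := mul_nonneg hK hd0
  have n5 := mul_nonneg (abs_nonneg C) hPq0
  have n6 := mul_nonneg (mul_nonneg (abs_nonneg C) hD₁) hPq0
  have n7 := mul_nonneg (mul_nonneg (abs_nonneg C) hD₂) hPq0
  have n8 := mul_nonneg hK hPq0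
  constructor
  -- The quasilinear increment splits into a change of coefficients against the increment (small if
  -- u is H-close to v), a change of coefficients against u', and the increment of F.
  · have e : c.A ι t u - c.A ι t u' - c.A₀ t (ι v) (u - u') =
        (c.A₀ t (ι u) (u - u') - c.A₀ t (ι v) (u - u')) +
          (c.A₀ t (ι u) u' - c.A₀ t (ι u') u') - (c.F t u - c.F t u') := by
      simp only [Coefficients.A, map_sub]
      abel
    rw [e]
    refine (norm_sub_le _ _).trans ((add_le_add_left (norm_add_le _ _) _).trans ?_)
    have n9 := mul_nonneg (norm_nonneg (ι u - ι v)) n1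
    have n10 := mul_nonneg (norm_nonneg (ι u - ι v)) n2
    have n11 := mul_nonneg (norm_nonneg (ι u - ι v)) n3
    have n12 := mul_nonneg (norm_nonneg (ι u - ι v)) n4
    linarith
  · have e : c.B ι t u - c.B ι t u' = c.B₀ t (ι u) (u - u') +
        (c.B₀ t (ι u) u' - c.B₀ t (ι u') u') + (c.G t u - c.G t u') := by
      simp only [Coefficients.B, map_sub]
      abel
    rw [e]
    refine (norm_add_le _ _).trans ((add_le_add_left (norm_add_le _ _) _).trans ?_)
    linarith

end CoefficientEstimates

/-! ### Gronwall's inequality. -/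

/-- Gronwall's inequality with an integrable kernel. -/
theorem le_two_pow_mul_of_le_add_integral {T a : ℝ} (ha : 0 ≤ a) {k y : ℝ → ℝ}
    (hk : IntegrableOn k (Icc 0 T)) (hk0 : ∀ t, 0 ≤ k t)
    (hky : IntegrableOn (fun t => k t * y t) (Icc 0 T)) (hy0 : ∀ t, 0 ≤ y t)
    (h : ∀ t ∈ Icc 0 T, y t ≤ a + ∫ s in (0 : ℝ)..t, k s * y s) (N : ℕ) :
    ∀ t ∈ Icc 0 T, ∫ s in (0 : ℝ)..t, k s ≤ N / 2 →
      a + ∫ s in (0 : ℝ)..t, k s * y s ≤ 2 ^ N * a := by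
  set Y : ℝ → ℝ := fun t => a + ∫ s in (0 : ℝ)..t, k s * y s with hY
  have hII : ∀ {f : ℝ → ℝ}, IntegrableOn f (Icc 0 T) → ∀ {s t : ℝ}, 0 ≤ s → s ≤ t → t ≤ T →
      IntervalIntegrable f volume s t := fun hf s t hs hst ht => by
    refine (hf.mono_set ?_).intervalIntegrable
    rw [uIcc_of_le hst]
    exact Icc_subset_Icc hs ht
  have hmono : ∀ s t, 0 ≤ s → s ≤ t → t ≤ T → Y s ≤ Y t := fun s t hs hst ht => by
    have h1 := intervalIntegral.integral_add_adjacent_intervals (hII hky le_rfl hs (hst.trans ht))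
      (hII hky hs hst ht)
    have h2 : 0 ≤ ∫ r in s..t, k r * y r :=
      intervalIntegral.integral_nonneg hst fun r _ => mul_nonneg (hk0 r) (hy0 r)
    simp only [hY]
    linarith
  have hYa : ∀ t ∈ Icc 0 T, 0 ≤ Y t := fun t ht => by
    have := hmono 0 t le_rfl ht.1 ht.2
    simp only [hY, intervalIntegral.integral_same, add_zero] at this ⊢
    linarith
  have hstep : ∀ s t, 0 ≤ s → s ≤ t → t ≤ T → Y t ≤ Y s +
      ((∫ r in (0 : ℝ)..t, k r) - ∫ r in (0 : ℝ)..s, k r) * Y t := fun s t hs hst ht => by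
    have h1 := intervalIntegral.integral_add_adjacent_intervals (hII hky le_rfl hs (hst.trans ht))
      (hII hky hs hst ht)
    have h3 := intervalIntegral.integral_add_adjacent_intervals (hII hk le_rfl hs (hst.trans ht))
      (hII hk hs hst ht)
    have h2 : ∫ r in s..t, k r * y r ≤ ∫ r in s..t, k r * Y t := by
      refine intervalIntegral.integral_mono_on hst (hII hky hs hst ht)
        ((hII hk hs hst ht).mul_const _) fun r hr => ?_
      refine mul_le_mul_of_nonneg_left ?_ (hk0 r)
      exact (h r ⟨hs.trans hr.1, hr.2.trans ht⟩).trans (hmono r t (hs.trans hr.1) hr.2 ht)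
    rw [intervalIntegral.integral_mul_const] at h2
    rw [← h3]
    simp only [hY] at h2 ⊢
    linarith
  -- Whenever the integral of k grows by at most 1/2, Y at most doubles: Y t ≤ Y s + ½ Y t. The
  -- intermediate value theorem finds the point s where the integral equals N/2.
  induction N with
  | zero =>
    intro t ht hKt
    have h1 := hstep 0 t le_rfl ht.1 ht.2
    have h2 : Y 0 = a := by simp [hY]
    rw [h2, intervalIntegral.integral_same, sub_zero] at h1
    change Y t ≤ _
    have h3 := mul_le_mul_of_nonneg_right hKt (hYa t ht)
    simp only [Nat.cast_zero, zero_div, zero_mul] at h3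
    linarith
  | succ N ih =>
    intro t ht hKt
    change Y t ≤ _
    have hpow : (0 : ℝ) < 2 ^ N := by positivity
    rcases le_or_gt (∫ s in (0 : ℝ)..t, k s) (N / 2) with hle | hlt
    · have h1 : Y t ≤ 2 ^ N * a := ih t ht hle
      rw [pow_succ]
      nlinarith
    · have hcont : ContinuousOn (fun t => ∫ s in (0 : ℝ)..t, k s) (Icc 0 t) := by
        have := intervalIntegral.continuousOn_primitive_interval (μ := volume) (a := 0) (b := t)
          (f := k) (by rw [uIcc_of_le ht.1]; exact hk.mono_set (Icc_subset_Icc_right ht.2))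
        rwa [uIcc_of_le ht.1] at this
      obtain ⟨s, hs, hKs⟩ := intermediate_value_Icc ht.1 hcont
        (show (N / 2 : ℝ) ∈ _ from ⟨by simp only [intervalIntegral.integral_same]; positivity,
          hlt.le⟩)
      have h1 : Y s ≤ 2 ^ N * a := ih s ⟨hs.1, hs.2.trans ht.2⟩ hKs.le
      have h2 := hstep s t hs.1 hs.2 ht.2
      have h3 : (∫ r in (0 : ℝ)..t, k r) - ∫ r in (0 : ℝ)..s, k r ≤ 1 / 2 := by
        push_cast at hKt
        simp only at hKs
        linarith
      have h4 := mul_le_mul_of_nonneg_right h3 (hYa t ht)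
      rw [pow_succ]
      linarith

/-! ### Riesz representation and integrability of B ψ. -/

section Riesz

variable {V H : Type*}
  [NormedAddCommGroup V] [InnerProductSpace ℝ V] [CompleteSpace V]
  [NormedAddCommGroup H] [InnerProductSpace ℝ H] [CompleteSpace H]

variable (V) in
/-- The Riesz isomorphism `V* → V`. -/
noncomputable def riesz : StrongDual ℝ V →ₗᵢ[ℝ] V where
  toFun := (InnerProductSpace.toDual ℝ V).symm
  map_add' := map_add _
  map_smul' c ξ := by simp
  norm_map' ξ := (InnerProductSpace.toDual ℝ V).symm.norm_map ξ

theorem inner_riesz (ξ : StrongDual ℝ V) (v : V) : (inner ℝ (riesz V ξ) v : ℝ) = ξ v :=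
  InnerProductSpace.toDual_symm_apply

theorem riesz_dualEmb (ι : V →L[ℝ] H) (x : H) : riesz V (dualEmb ι x) = adjoint ι x := by
  refine ext_inner_right ℝ fun v => ?_
  rw [inner_riesz, dualEmb_apply, ContinuousLinearMap.adjoint_inner_left]

end Riesz

/-- The Hilbert-Schmidt norm dominates the operator norm, so this is Hölder for L² · L². It is why
the forcing by ψ lands in L¹(H). -/
theorem integrableOn_toCLM_apply {U H : Type*}
    [NormedAddCommGroup U] [InnerProductSpace ℝ U] [CompleteSpace U]
    [NormedAddCommGroup H] [InnerProductSpace ℝ H] {T : ℝ} {S : ℝ → HSOp U H} {ψ : ℝ → U}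
    (hS : MemLp S 2 (volume.restrict (Icc 0 T))) (hψ : MemLp ψ 2 (volume.restrict (Icc 0 T))) :
    IntegrableOn (fun t => (S t).toCLM (ψ t)) (Icc 0 T) := by
  refine (hS.norm.integrable_mul hψ.norm).mono' ?_
    (Eventually.of_forall fun t => (S t).norm_toCLM_apply_le (ψ t))
  have h1 := (HSOp.inclusion U H).continuous.comp_aestronglyMeasurable hS.1
  exact (isBoundedBilinearMap_apply (𝕜 := ℝ) (E := U) (F := H)).continuous.comp_aestronglyMeasurable
    (h1.prodMk hψ.1)

/-! ### The coefficients along a path. -/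

section Drift

variable {U V H : Type*}
  [NormedAddCommGroup U] [InnerProductSpace ℝ U] [CompleteSpace U]
  [NormedAddCommGroup V] [InnerProductSpace ℝ V]
  [TopologicalSpace.SeparableSpace V] [MeasurableSpace V] [BorelSpace V]
  [NormedAddCommGroup H] [InnerProductSpace ℝ H] [MeasurableSpace H] [BorelSpace H]
  {ι : V →L[ℝ] H} {c : Coefficients U V H}

theorem CriticalVariational.aestronglyMeasurable (hc : CriticalVariational ι c) {μ : Measure ℝ}
    {u : ℝ → V} (hu : AEStronglyMeasurable u μ) :
    AEStronglyMeasurable (fun t => c.A ι t.toNNReal (u t)) μ ∧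
      AEStronglyMeasurable (fun t => c.B ι t.toNNReal (u t)) μ := by
  have : SecondCountableTopology V := UniformSpace.secondCountable_of_separable V
  have hA := stronglyMeasurable_uncurry_of_continuous_of_stronglyMeasurable
    (u := fun (v : V) (p : ℝ≥0 × H) => c.A₀ p.1 p.2 v) (fun p => (c.A₀ p.1 p.2).continuous)
    hc.meas_A₀
  have hB := stronglyMeasurable_uncurry_of_continuous_of_stronglyMeasurable
    (u := fun (v : V) (p : ℝ≥0 × H) => c.B₀ p.1 p.2 v) (fun p => (c.B₀ p.1 p.2).continuous)
    hc.meas_B₀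
  have hv := hu.stronglyMeasurable_mk.measurable
  have ht : Measurable fun t : ℝ => t.toNNReal := measurable_real_toNNReal
  have hp : Measurable fun t : ℝ => (hu.mk u t, (t.toNNReal, ι (hu.mk u t))) :=
    hv.prodMk (ht.prodMk (ι.continuous.measurable.comp hv))
  constructor
  · refine ⟨fun t => c.A ι t.toNNReal (hu.mk u t), ?_, ?_⟩
    · exact ((hA.comp_measurable hp).sub (hc.meas_F.comp_measurable (ht.prodMk hv))).sub
        (hc.meas_f.comp_measurable ht)
    · filter_upwards [hu.ae_eq_mk] with t h
      rw [h]
  · refine ⟨fun t => c.B ι t.toNNReal (hu.mk u t), ?_, ?_⟩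
    · exact ((hB.comp_measurable hp).add (hc.meas_G.comp_measurable (ht.prodMk hv))).add
        (hc.meas_g.comp_measurable ht)
    · filter_upwards [hu.ae_eq_mk] with t h
      rw [h]

variable [CompleteSpace V]

/-- Comparing with the state 0 through the increment estimate gives linear growth in the V-norm on
H-balls; the powers of β-norms never have to be integrated. -/
theorem CriticalVariational.memLp (hι : Function.Injective ι) (hc : CriticalVariational ι c)
    {T n : ℝ} (hT : 0 < T) (hn : 0 ≤ n) {u : ℝ → V} (hu : MemLp u 2 (volume.restrict (Icc 0 T)))
    (hun : ∀ᵐ t ∂(volume.restrict (Icc 0 T)), ‖ι (u t)‖ ≤ n) :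
    MemLp (fun t => c.A ι t.toNNReal (u t)) 2 (volume.restrict (Icc 0 T)) ∧
      MemLp (fun t => c.B ι t.toNNReal (u t)) 2 (volume.restrict (Icc 0 T)) := by
  obtain ⟨K, hK, hKb⟩ := hc.exists_bounds hT hn
  obtain ⟨D, hD, hDb⟩ := hc.exists_increment_le hι hT hn one_pos
  have h0 : ‖ι (0 : V)‖ ≤ n := by simpa using hn
  obtain ⟨hK0, L, hL⟩ := hKb 0 h0
  have hmeas := hc.aestronglyMeasurable hu.1
  have hpt : ∀ᵐ t ∂(volume.restrict (Icc 0 T)), ((t.toNNReal : ℝ≥0) : ℝ) ≤ T := by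
    filter_upwards [ae_restrict_mem measurableSet_Icc] with t ht
    rw [Real.coe_toNNReal _ ht.1]
    exact ht.2
  constructor
  · refine (((memLp_const (L + D * n)).add
      (hu.norm.const_mul (1 + D * n + D * n + K))).add (hc.memLp_f T hT).norm).mono' hmeas.1 ?_
    filter_upwards [hpt, hun] with t ht hut
    have h1 := (hDb t.toNNReal ht (u t) 0 0 hut h0 h0).1
    have h2 := (hK0 t.toNNReal ht (u t)).1
    have h3 := (hL t.toNNReal ht).1
    rw [map_zero, sub_zero, sub_zero, norm_zero] at h1
    rw [map_zero] at h2
    have e : c.A ι t.toNNReal (u t) = (c.A ι t.toNNReal (u t) - c.A ι t.toNNReal 0 -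
        c.A₀ t.toNNReal 0 (u t)) + c.A₀ t.toNNReal 0 (u t) - c.F t.toNNReal 0 - c.f t.toNNReal := by
      simp only [Coefficients.A, map_zero]
      abel
    have h4 : ‖c.A ι t.toNNReal (u t)‖ ≤ ‖c.A ι t.toNNReal (u t) - c.A ι t.toNNReal 0 -
        c.A₀ t.toNNReal 0 (u t)‖ + ‖c.A₀ t.toNNReal 0 (u t)‖ + ‖c.F t.toNNReal 0‖ +
          ‖c.f t.toNNReal‖ := by
      nth_rw 1 [e]
      refine (norm_sub_le _ _).trans (add_le_add_left ?_ _)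
      refine (norm_sub_le _ _).trans (add_le_add_left ?_ _)
      exact norm_add_le _ _
    have h5 : D * ‖ι (u t)‖ * ‖u t‖ ≤ D * n * ‖u t‖ := by gcongr
    have h6 : D * ((1 + ‖u t‖ + 0) * ‖ι (u t)‖) ≤ D * ((1 + ‖u t‖ + 0) * n) := by gcongr
    simp only [Pi.add_apply]
    linarith
  · refine (((memLp_const (L + D * n)).add
      (hu.norm.const_mul (D + D * n))).add (hc.memLp_g T hT).norm).mono' hmeas.2 ?_
    filter_upwards [hpt, hun] with t ht hut
    have h1 := (hDb t.toNNReal ht (u t) 0 0 hut h0 h0).2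
    have h3 := (hL t.toNNReal ht).2
    rw [map_zero, sub_zero, sub_zero, norm_zero] at h1
    have e : c.B ι t.toNNReal (u t) = (c.B ι t.toNNReal (u t) - c.B ι t.toNNReal 0) +
        c.G t.toNNReal 0 + c.g t.toNNReal := by
      simp only [Coefficients.B, map_zero]
      abel
    have h4 : ‖c.B ι t.toNNReal (u t)‖ ≤ ‖c.B ι t.toNNReal (u t) - c.B ι t.toNNReal 0‖ +
        ‖c.G t.toNNReal 0‖ + ‖c.g t.toNNReal‖ := by
      nth_rw 1 [e]
      refine (norm_add_le _ _).trans (add_le_add_left ?_ _)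
      exact norm_add_le _ _
    have h6 : D * ((1 + ‖u t‖ + 0) * ‖ι (u t)‖) ≤ D * ((1 + ‖u t‖ + 0) * n) := by gcongr
    simp only [Pi.add_apply]
    linarith

end Drift

/-! ### Dissipation for the difference of two states. -/

theorem MR.ae_norm_le {V H : Type*}
    [NormedAddCommGroup V] [InnerProductSpace ℝ V] [NormedAddCommGroup H] [InnerProductSpace ℝ H]
    {ι : V →L[ℝ] H} {T : ℝ} (u : MR ι T) :
    ∀ᵐ t ∂(volume.restrict (Icc (0 : ℝ) T)), ‖ι (u.1.snd t)‖ ≤ ‖u.1.fst‖ := by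
  filter_upwards [u.2, ae_restrict_mem measurableSet_Icc] with t h ht
  rw [h ht]
  exact u.1.fst.norm_coe_le_norm _

/-- The energy inequality for the difference of two solutions, pointwise in time. -/
theorem CriticalVariational.exists_dissipation {U V H : Type*}
    [NormedAddCommGroup U] [InnerProductSpace ℝ U] [CompleteSpace U]
    [NormedAddCommGroup V] [InnerProductSpace ℝ V] [CompleteSpace V] [MeasurableSpace V]
    [NormedAddCommGroup H] [InnerProductSpace ℝ H] [MeasurableSpace H]
    {ι : V →L[ℝ] H} {c : Coefficients U V H} (hι : Function.Injective ι)
    (hc : CriticalVariational ι c) {T n : ℝ} (hT : 0 < T) (hn : 0 ≤ n) :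
    ∃ θ L : ℝ, 0 < θ ∧ 0 ≤ L ∧ ∀ t : ℝ≥0, (t : ℝ) ≤ T → ∀ (u w : V) (z : U), ‖ι u‖ ≤ n →
      ‖ι w‖ ≤ n →
      2 * (-(c.A ι t u - c.A ι t w) (u - w) +
        inner ℝ ((c.B ι t u - c.B ι t w).toCLM z) (ι (u - w))) ≤
      L * ((1 + ‖u‖ + ‖w‖) ^ 2 + ‖z‖ ^ 2) * ‖ι (u - w)‖ ^ 2 - θ * ‖u - w‖ ^ 2 := by
  obtain ⟨θ, M, hθ, hM, hco⟩ := hc.coercive T hT n hn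
  obtain ⟨D, hD, hDb⟩ := hc.exists_increment_le hι hT hn (κ := θ / 4) (by positivity)
  refine ⟨θ, 4 * D ^ 2 / θ + D + 2 * M, hθ, by positivity, fun t ht u w z hu hw => ?_⟩
  -- The leading operator is frozen at u itself, so the term carrying the H-distance to the frozen
  -- state vanishes.
  obtain ⟨hA, hB⟩ := hDb t ht u w u hu hw hu
  have hA0 := hco t ht (ι u) (u - w) hu
  rw [sub_self, norm_zero, mul_zero, add_zero] at hA
  rw [← map_sub] at hA hB
  set q := ‖u - w‖ with hq
  set h := ‖ι (u - w)‖ with hh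
  set P := 1 + ‖u‖ + ‖w‖ with hP
  set s := ‖z‖ with hs
  have hq0 : 0 ≤ q := norm_nonneg _
  have hh0 : 0 ≤ h := norm_nonneg _
  have hs0 : 0 ≤ s := norm_nonneg _
  have hP1 : 1 ≤ P := by rw [hP]; linarith [norm_nonneg u, norm_nonneg w]
  have h1 : -(c.A ι t u - c.A ι t w) (u - w) ≤
      (θ / 4 * q + D * (P * h)) * q - θ * q ^ 2 + M * h ^ 2 := by
    have e := (c.A ι t u - c.A ι t w - c.A₀ t (ι u) (u - w)).le_opNorm (u - w)
    rw [sub_apply, Real.norm_eq_abs] at e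
    have e2 := (neg_le_abs _).trans (e.trans (mul_le_mul_of_nonneg_right hA hq0))
    have e3 : 0 ≤ 1 / 2 * ‖c.B₀ t (ι u) (u - w)‖ ^ 2 := by positivity
    linarith
  have h2 : (inner ℝ ((c.B ι t u - c.B ι t w).toCLM z) (ι (u - w)) : ℝ) ≤
      D * (q + P * h) * s * h := by
    refine (real_inner_le_norm _ _).trans ?_
    refine mul_le_mul_of_nonneg_right ?_ hh0
    exact ((c.B ι t u - c.B ι t w).norm_toCLM_apply_le z).trans
      (mul_le_mul_of_nonneg_right hB hs0)
  -- Of the 2θq² provided by coercivity, twice κ = θ/4 uses θ/2 and two Young inequalities use θ/4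
  -- each, which leaves θq².
  have y1 : 2 * (D * (P * h) * q) ≤ θ / 4 * q ^ 2 + 4 * D ^ 2 / θ * (P ^ 2 * h ^ 2) := by
    have : 0 ≤ (θ / 2 * q - 2 * (D * (P * h))) ^ 2 / θ := by positivity
    have e : (θ / 2 * q - 2 * (D * (P * h))) ^ 2 / θ = θ / 4 * q ^ 2 +
        4 * D ^ 2 / θ * (P ^ 2 * h ^ 2) - 2 * (D * (P * h) * q) := by
      field_simp
      ring
    linarith
  have y2 : 2 * (D * q * s * h) ≤ θ / 4 * q ^ 2 + 4 * D ^ 2 / θ * (s ^ 2 * h ^ 2) := by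
    have : 0 ≤ (θ / 2 * q - 2 * (D * (s * h))) ^ 2 / θ := by positivity
    have e : (θ / 2 * q - 2 * (D * (s * h))) ^ 2 / θ = θ / 4 * q ^ 2 +
        4 * D ^ 2 / θ * (s ^ 2 * h ^ 2) - 2 * (D * q * s * h) := by
      field_simp
      ring
    linarith
  have y3 : 2 * (D * (P * h) * s * h) ≤ D * ((P ^ 2 + s ^ 2) * h ^ 2) := by
    have : 0 ≤ D * h ^ 2 * (P - s) ^ 2 := by positivity
    linarith
  have y4 : 2 * M * h ^ 2 ≤ 2 * M * ((P ^ 2 + s ^ 2) * h ^ 2) := by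
    have : 1 ≤ P ^ 2 + s ^ 2 := by nlinarith [sq_nonneg s]
    have h5 : h ^ 2 ≤ (P ^ 2 + s ^ 2) * h ^ 2 := by nlinarith [sq_nonneg h]
    have := mul_le_mul_of_nonneg_left h5 hM.le
    linarith
  linarith

/-! ### Strong solutions and continuous dependence. -/

section StrongSolutions

variable {U V H : Type*}
  [NormedAddCommGroup U] [InnerProductSpace ℝ U] [CompleteSpace U]
  [NormedAddCommGroup V] [InnerProductSpace ℝ V] [CompleteSpace V]
  [NormedAddCommGroup H] [InnerProductSpace ℝ H]

/-- The Riesz representative of `-A(t, u(t))`. -/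
noncomputable def driftA (ι : V →L[ℝ] H) (c : Coefficients U V H) {T : ℝ} (u : MR ι T)
    (t : ℝ) : V :=
  -riesz V (c.A ι t.toNNReal (u.1.snd t))

/-- The function `B(t, u(t)) ψ(t)`. -/
noncomputable def driftB (ι : V →L[ℝ] H) (c : Coefficients U V H) (ψ : ℝ → U) {T : ℝ} (u : MR ι T)
    (t : ℝ) : H :=
  (c.B ι t.toNNReal (u.1.snd t)).toCLM (ψ t)

variable [TopologicalSpace.SeparableSpace V] [MeasurableSpace V] [BorelSpace V]
  [MeasurableSpace H] [BorelSpace H]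
  {ι : V →L[ℝ] H} {c : Coefficients U V H}

theorem memLp_driftA (hι : Function.Injective ι) (hc : CriticalVariational ι c) {T : ℝ}
    (hT : 0 < T) (u : MR ι T) : MemLp (driftA ι c u) 2 (volume.restrict (Icc 0 T)) :=
  ((riesz V).toContinuousLinearMap.comp_memLp'
    (hc.memLp hι hT (norm_nonneg _) (MR.memLp_snd u) (MR.ae_norm_le u)).1).neg

theorem integrableOn_driftB (hι : Function.Injective ι) (hc : CriticalVariational ι c) {T : ℝ}
    (hT : 0 < T) {ψ : ℝ → U} (hψ : MemLp ψ 2 (volume.restrict (Icc 0 T))) (u : MR ι T) :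
    IntegrableOn (driftB ι c ψ u) (Icc 0 T) :=
  integrableOn_toCLM_apply
    (hc.memLp hι hT (norm_nonneg _) (MR.memLp_snd u) (MR.ae_norm_le u)).2 hψ

variable [CompleteSpace H]

/-- Apply the Riesz isometry to the integrated equation. Membership of the drift in L²(V*) + L¹(H)
is automatic, with A(·, u) and -B(·, u)ψ as the two parts. -/
theorem isStrongSolution_iff_isEvolution (hι : Function.Injective ι)
    (hc : CriticalVariational ι c) {T : ℝ} (hT : 0 < T) {ψ : ℝ → U}
    (hψ : MemLp ψ 2 (volume.restrict (Icc 0 T))) {x : H} {u : MR ι T} :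
    IsStrongSolution ι c ψ x u ↔ IsEvolution ι x (driftA ι c u) (driftB ι c ψ u) u := by
  have hA := (hc.memLp hι hT (norm_nonneg _) (MR.memLp_snd u) (MR.ae_norm_le u)).1
  have hB := integrableOn_driftB hι hc hT hψ u
  have hdrift : ∀ t, riesz V (skeletonDrift ι c ψ u t) =
      -(driftA ι c u t + adjoint ι (driftB ι c ψ u t)) := fun t => by
    rw [skeletonDrift, map_sub, riesz_dualEmb, driftA, driftB]
    abel
  have hint : IntegrableOn (skeletonDrift ι c ψ u) (Icc 0 T) :=
    (hA.integrable one_le_two).sub ((dualEmb ι).integrable_comp hB)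
  have hriesz : ∀ t ∈ Icc 0 T, riesz V (∫ s in (0 : ℝ)..t, skeletonDrift ι c ψ u s) =
      -∫ s in (0 : ℝ)..t, (driftA ι c u s + adjoint ι (driftB ι c ψ u s)) := by
    intro t ht
    have hi : IntervalIntegrable (skeletonDrift ι c ψ u) volume 0 t := by
      refine (hint.mono_set ?_).intervalIntegrable
      rw [uIcc_of_le ht.1]
      exact Icc_subset_Icc_right ht.2
    have := (riesz V).toContinuousLinearMap.intervalIntegral_comp_comm hi
    simp only [LinearIsometry.coe_toContinuousLinearMap, hdrift] at this
    rw [← this, intervalIntegral.integral_neg]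
  have heq : ∀ (t : ℝ) (ht : t ∈ Icc 0 T),
      (dualEmb ι (u.1.fst ⟨t, ht⟩) = dualEmb ι x - ∫ s in (0 : ℝ)..t, skeletonDrift ι c ψ u s) ↔
        adjoint ι (u.1.fst ⟨t, ht⟩) = adjoint ι x +
          ∫ s in (0 : ℝ)..t, (driftA ι c u s + adjoint ι (driftB ι c ψ u s)) := by
    intro t ht
    rw [← (riesz V).injective.eq_iff, map_sub, hriesz t ht, riesz_dualEmb, riesz_dualEmb,
      sub_neg_eq_add]
  constructor
  · intro h t ht
    exact (heq t ht).1 (h.equation t ht)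
  · intro h
    refine ⟨⟨fun t => c.A ι t.toNNReal (u.1.snd t), fun t => -driftB ι c ψ u t, hA,
      memLp_one_iff_integrable.2 hB.neg, Eventually.of_forall fun t => ?_⟩,
      fun t ht => (heq t ht).2 (h t ht)⟩
    simp only [skeletonDrift, driftB, map_neg, sub_eq_add_neg]

/-- Continuous dependence on the initial value. -/
theorem CriticalVariational.exists_norm_sub_le (hι : Function.Injective ι) (hd : DenseRange ι)
    (hc : CriticalVariational ι c) {T n G₀ : ℝ} (hT : 0 < T) (hn : 0 ≤ n) :
    ∃ C : ℝ, 0 ≤ C ∧ ∀ T' : ℝ, 0 < T' → T' ≤ T → ∀ ψ : ℝ → U,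
      MemLp ψ 2 (volume.restrict (Icc 0 T')) → ∀ (v₀ w₀ : H) (u w : MR ι T'),
      IsStrongSolution ι c ψ v₀ u → IsStrongSolution ι c ψ w₀ w → ‖u.1.fst‖ ≤ n → ‖w.1.fst‖ ≤ n →
      ∫ t in Icc 0 T', ((1 + ‖u.1.snd t‖ + ‖w.1.snd t‖) ^ 2 + ‖ψ t‖ ^ 2) ≤ G₀ →
      ‖u - w‖ ≤ C * ‖v₀ - w₀‖ := by
  obtain ⟨θ, L, hθ, hL, hdiss⟩ := hc.exists_dissipation hι hT hn
  -- N counts the doublings in Gronwall: the kernel has integral at most L G₀ ≤ N/2. The two square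
  -- roots below come from the sup bound in H and from the dissipation term.
  obtain ⟨N, hN⟩ := exists_nat_ge (2 * (L * G₀))
  refine ⟨√(2 ^ N) + √(2 ^ N / θ), by positivity, fun T' hT' hT'T ψ hψ v₀ w₀ u w hu hw hun hwn hG =>
    ?_⟩
  rw [isStrongSolution_iff_isEvolution hι hc hT' hψ] at hu hw
  have hkA : MemLp (fun t => driftA ι c u t - driftA ι c w t) 2 (volume.restrict (Icc 0 T')) :=
    (memLp_driftA hι hc hT' u).sub (memLp_driftA hι hc hT' w)
  have hmB : IntegrableOn (fun t => driftB ι c ψ u t - driftB ι c ψ w t) (Icc 0 T') :=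
    (integrableOn_driftB hι hc hT' hψ u).sub (integrableOn_driftB hι hc hT' hψ w)
  have hd' := hu.sub hw (memLp_driftA hι hc hT' u) (integrableOn_driftB hι hc hT' hψ u)
    (memLp_driftA hι hc hT' w) (integrableOn_driftB hι hc hT' hψ w)
  set d : MR ι T' := u - w with hdd
  set y : ℝ → ℝ := fun t => ‖MR.path hT'.le d t‖ ^ 2 with hy
  set k : ℝ → ℝ := fun t => L * ((1 + ‖u.1.snd t‖ + ‖w.1.snd t‖) ^ 2 + ‖ψ t‖ ^ 2) with hk
  have hk0 : ∀ t, 0 ≤ k t := fun t => by positivity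
  have hki : IntegrableOn k (Icc 0 T') := by
    have h1 : MemLp (fun t => 1 + ‖u.1.snd t‖ + ‖w.1.snd t‖) 2 (volume.restrict (Icc 0 T')) :=
      ((memLp_const (1 : ℝ)).add (MR.memLp_snd u).norm).add (MR.memLp_snd w).norm
    exact (h1.integrable_sq.add hψ.norm.integrable_sq).const_mul L
  have hyc : Continuous y := (MR.continuous_path hT'.le d).norm.pow 2
  have hky : IntegrableOn (fun t => k t * y t) (Icc 0 T') := by
    refine (hki.mul_const (‖d.1.fst‖ ^ 2)).mono' (hki.1.mul hyc.aestronglyMeasurable)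
      (Eventually.of_forall fun t => ?_)
    rw [Real.norm_of_nonneg (mul_nonneg (hk0 t) (by positivity))]
    exact mul_le_mul_of_nonneg_left
      (pow_le_pow_left₀ (norm_nonneg _) (MR.norm_path_le hT'.le d t) 2) (hk0 t)
  have hdi : IntegrableOn (fun t => θ * ‖d.1.snd t‖ ^ 2) (Icc 0 T') :=
    (MR.memLp_snd d).norm.integrable_sq.const_mul θ
  set f : ℝ → ℝ := fun s => (inner ℝ (driftA ι c u s - driftA ι c w s) (d.1.snd s) : ℝ) +
    inner ℝ (driftB ι c ψ u s - driftB ι c ψ w s) (MR.path hT'.le d s) with hf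
  have hfi : IntegrableOn f (Icc 0 T') := by
    refine (integrable_inner_of_memLp hkA (MR.memLp_snd d)).add ?_
    refine (hmB.norm.mul_const ‖d.1.fst‖).mono'
      (hmB.1.inner (MR.continuous_path hT'.le d).aestronglyMeasurable) ?_
    refine Eventually.of_forall fun s => (norm_inner_le_norm _ _).trans ?_
    gcongr
    exact MR.norm_path_le hT'.le d s
  have hpt : ∀ᵐ t ∂(volume.restrict (Icc 0 T')), 2 * f t ≤ k t * y t - θ * ‖d.1.snd t‖ ^ 2 := by
    filter_upwards [MR.snd_sub u w, MR.ae_eq_path hT'.le d, MR.ae_norm_le u, MR.ae_norm_le w,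
      ae_restrict_mem measurableSet_Icc] with t h1 h2 h3 h4 ht
    have htT : ((t.toNNReal : ℝ≥0) : ℝ) ≤ T := by
      rw [Real.coe_toNNReal _ ht.1]
      exact ht.2.trans hT'T
    have h5 := hdiss t.toNNReal htT (u.1.snd t) (w.1.snd t) (ψ t) (h3.trans hun) (h4.trans hwn)
    rw [← h1] at h5
    have e1 : (inner ℝ (driftA ι c u t - driftA ι c w t) (d.1.snd t) : ℝ) =
        -(c.A ι t.toNNReal (u.1.snd t) - c.A ι t.toNNReal (w.1.snd t)) (d.1.snd t) := by
      have : driftA ι c u t - driftA ι c w t = -riesz V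
          (c.A ι t.toNNReal (u.1.snd t) - c.A ι t.toNNReal (w.1.snd t)) := by
        rw [driftA, driftA, map_sub]
        abel
      rw [this, inner_neg_left, inner_riesz]
    have e2 : driftB ι c ψ u t - driftB ι c ψ w t =
        (c.B ι t.toNNReal (u.1.snd t) - c.B ι t.toNNReal (w.1.snd t)).toCLM (ψ t) := by
      rw [HSOp.toCLM_sub_apply, driftB, driftB]
    simp only [hf, hy, hk]
    rw [e1, e2, ← h2]
    exact h5
  have hmain : ∀ t ∈ Icc 0 T', y t + (∫ s in (0 : ℝ)..t, θ * ‖d.1.snd s‖ ^ 2) ≤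
      ‖v₀ - w₀‖ ^ 2 + ∫ s in (0 : ℝ)..t, k s * y s := by
    intro t ht
    have hsub : Ioc 0 t ⊆ Icc 0 T' := fun s hs => ⟨hs.1.le, hs.2.trans ht.2⟩
    have h1 := hd'.energy hd hT' hkA hmB ht
    simp only [intervalIntegral.integral_of_le ht.1] at h1 ⊢
    have h2 : ∫ s in Ioc 0 t, 2 * f s ≤ ∫ s in Ioc 0 t, (k s * y s - θ * ‖d.1.snd s‖ ^ 2) := by
      have i1 : IntegrableOn (fun s => 2 * f s) (Icc 0 T') := hfi.const_mul 2
      exact integral_mono_ae (i1.mono_set hsub) ((hky.sub hdi).mono_set hsub)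
        (ae_restrict_of_ae_restrict_of_subset hsub hpt)
    rw [integral_sub (hky.mono_set hsub) (hdi.mono_set hsub), integral_const_mul] at h2
    simp only [hy]
    rw [h1]
    linarith
  set a := ‖v₀ - w₀‖ ^ 2 with ha
  have ha0 : 0 ≤ a := by positivity
  have hdn : ∀ t ∈ Icc 0 T', 0 ≤ ∫ s in (0 : ℝ)..t, θ * ‖d.1.snd s‖ ^ 2 := fun t ht =>
    intervalIntegral.integral_nonneg ht.1 fun s _ => by positivity
  have hK : ∀ t ∈ Icc 0 T', ∫ s in (0 : ℝ)..t, k s ≤ N / 2 := by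
    intro t ht
    rw [intervalIntegral.integral_of_le ht.1]
    have h1 : ∫ s in Ioc 0 t, k s ≤ ∫ s in Icc 0 T', k s :=
      setIntegral_mono_set hki (Eventually.of_forall hk0)
        (LE.le.eventuallyLE fun s hs => ⟨hs.1.le, hs.2.trans ht.2⟩)
    have h2 : ∫ s in Icc 0 T', k s ≤ L * G₀ := by
      simp only [hk]
      rw [integral_const_mul]
      gcongr
    linarith
  have hgr : ∀ t ∈ Icc 0 T', a + ∫ s in (0 : ℝ)..t, k s * y s ≤ 2 ^ N * a := fun t ht =>
    le_two_pow_mul_of_le_add_integral ha0 hki hk0 hky (fun t => by positivity)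
      (fun t ht => by linarith [hmain t ht, hdn t ht]) N t ht (hK t ht)
  have hsq : √a = ‖v₀ - w₀‖ := Real.sqrt_sq (norm_nonneg _)
  rw [MR.norm_eq, add_mul]
  refine add_le_add ?_ ?_
  · refine (ContinuousMap.norm_le _ (by positivity)).2 fun t => ?_
    have h1 : y t ≤ 2 ^ N * a := by linarith [hmain t t.2, hdn t t.2, hgr t t.2]
    have h2 : y t = ‖d.1.fst t‖ ^ 2 := by
      simp only [hy]
      rw [MR.path_apply hT'.le d t.2]
    rw [h2] at h1
    have h3 := Real.le_sqrt_of_sq_le h1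
    rwa [Real.sqrt_mul (by positivity), hsq] at h3
  · have hTI : T' ∈ Icc 0 T' := ⟨hT'.le, le_rfl⟩
    have h1 := hmain T' hTI
    have h2 := hgr T' hTI
    have h3 : ∫ s in (0 : ℝ)..T', θ * ‖d.1.snd s‖ ^ 2 = θ * ‖d.1.snd‖ ^ 2 := by
      rw [intervalIntegral.integral_const_mul, intervalIntegral.integral_of_le hT'.le,
        ← integral_Icc_eq_integral_Ioc, integral_norm_sq_eq (MR.memLp_snd d), l2Norm_coe]
    have hy0 : 0 ≤ y T' := by positivity
    have h4 : ‖d.1.snd‖ ^ 2 ≤ 2 ^ N / θ * a := by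
      rw [div_mul_eq_mul_div, le_div_iff₀ hθ]
      linarith
    have h5 := Real.le_sqrt_of_sq_le h4
    rwa [Real.sqrt_mul (by positivity), hsq] at h5

end StrongSolutions

/-! ### Norms over shrinking time intervals. -/

section ShortTime

theorem tendsto_integral_Icc_zero {T : ℝ} (hT : 0 < T) {f : ℝ → ℝ} (hf : IntegrableOn f (Icc 0 T)) :
    Tendsto (fun s => ∫ t in Icc 0 s, f t) (𝓝[>] 0) (𝓝 0) := by
  have h := intervalIntegral.continuousOn_primitive_interval (μ := volume) (a := 0) (b := T)
    (f := f) (by rwa [uIcc_of_le hT.le])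
  rw [uIcc_of_le hT.le] at h
  have h0 := h 0 ⟨le_rfl, hT.le⟩
  rw [ContinuousWithinAt, intervalIntegral.integral_same] at h0
  have h1 := h0.mono_left (nhdsWithin_mono (0 : ℝ) (Ioc_subset_Icc_self (a := (0 : ℝ)) (b := T)))
  rw [nhdsWithin_Ioc_eq_nhdsGT hT] at h1
  refine h1.congr' ?_
  filter_upwards [self_mem_nhdsWithin] with s hs
  rw [intervalIntegral.integral_of_le (le_of_lt hs), integral_Icc_eq_integral_Ioc]

theorem tendsto_l2Norm_zero {E : Type*} [NormedAddCommGroup E] {T : ℝ} (hT : 0 < T) {f : ℝ → E}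
    (hf : MemLp f 2 (volume.restrict (Icc 0 T))) :
    Tendsto (fun s => l2Norm s f) (𝓝[>] 0) (𝓝 0) := by
  have h := (tendsto_integral_Icc_zero hT hf.norm.integrable_sq).sqrt
  rw [Real.sqrt_zero] at h
  refine h.congr' ?_
  filter_upwards [Ioc_mem_nhdsGT hT] with s hs
  have hs' : MemLp f 2 (volume.restrict (Icc 0 s)) :=
    hf.mono_measure (Measure.restrict_mono (Icc_subset_Icc_right hs.2) le_rfl)
  rw [integral_norm_sq_eq hs', Real.sqrt_sq (l2Norm_nonneg _ _)]

end ShortTime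

/-! ### The fixed point argument. -/

section FixedPoint

variable {V H : Type*}
  [NormedAddCommGroup V] [InnerProductSpace ℝ V] [CompleteSpace V]
  [TopologicalSpace.SeparableSpace V]
  [NormedAddCommGroup H] [InnerProductSpace ℝ H] [CompleteSpace H]

/-- Perturbation of a linear equation by a nonlinearity that is a contraction in a ball. -/
theorem exists_isEvolution_of_contraction {ι : V →L[ℝ] H} (hd : DenseRange ι) {T θ K r : ℝ}
    (hT : 0 < T) (hr : 0 ≤ r) {a : ℝ → V →L[ℝ] V} (ha : IsCoerciveFamily T θ K a)
    {k : MR ι T → ℝ → V} {m : MR ι T → ℝ → H}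
    (hk : ∀ u, MemLp (k u) 2 (volume.restrict (Icc 0 T))) (hm : ∀ u, IntegrableOn (m u) (Icc 0 T))
    {u₁ : MR ι T} {x x₁ : H} {k₁ : ℝ → V} (hk₁ : MemLp k₁ 2 (volume.restrict (Icc 0 T)))
    (hu₁ : IsEvolution ι x₁ (fun t => k₁ t - a t (u₁.1.snd t)) 0 u₁)
    (hstart : (2 + 1 / θ) * (‖x - x₁‖ + 2 * l2Norm T (fun t => k u₁ t - k₁ t) +
      2 * ∫ t in Icc 0 T, ‖m u₁ t‖) ≤ r / 2)
    (hcontr : ∀ u w : MR ι T, ‖u - u₁‖ ≤ r → ‖w - u₁‖ ≤ r →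
      (2 + 1 / θ) * (2 * l2Norm T (fun t => k u t - k w t) +
        2 * ∫ t in Icc 0 T, ‖m u t - m w t‖) ≤ 1 / 2 * ‖u - w‖) :
    ∃ u : MR ι T, ‖u - u₁‖ ≤ r ∧ IsEvolution ι x (fun t => k u t - a t (u.1.snd t)) (m u) u := by
  have ham : ∀ u : MR ι T, MemLp (fun t => a t (u.1.snd t)) 2 (volume.restrict (Icc 0 T)) :=
    fun u => ha.memLp (MR.memLp_snd u)
  have hlin : ∀ {y y' : H} {f g : ℝ → V} {p q : ℝ → H} {u w : MR ι T},
      MemLp f 2 (volume.restrict (Icc 0 T)) → MemLp g 2 (volume.restrict (Icc 0 T)) →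
      IntegrableOn p (Icc 0 T) → IntegrableOn q (Icc 0 T) →
      IsEvolution ι y (fun t => f t - a t (u.1.snd t)) p u →
      IsEvolution ι y' (fun t => g t - a t (w.1.snd t)) q w →
      ‖u - w‖ ≤ (2 + 1 / θ) * (‖y - y'‖ + 2 * l2Norm T (fun t => f t - g t) +
        2 * ∫ t in Icc 0 T, ‖p t - q t‖) := by
    intro y y' f g p q u w hf hg hp hq hu hw
    refine IsEvolution.norm_le_of_linear hd hT ha ?_ (hf.sub hg) (hp.sub hq)
    refine (hu.sub hw (hf.sub (ham u)) hp (hg.sub (ham w)) hq).congr ?_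
    filter_upwards [MR.snd_sub u w] with t ht
    rw [ht, map_sub (a t)]
    abel
  -- Φ u solves the linear problem with forces evaluated at u. It contracts by 1/2 and moves the
  -- centre by at most r/2, so it maps the ball of radius r into itself.
  choose Φ hΦ using fun u => exists_isEvolution_linear ι hd hT ha x (hk u) (hm u)
  set S : Set (MR ι T) := Metric.closedBall u₁ r with hS
  have hmem : ∀ u, u ∈ S ↔ ‖u - u₁‖ ≤ r := fun u => mem_closedBall_iff_norm
  have hcon : ∀ u w, u ∈ S → w ∈ S → ‖Φ u - Φ w‖ ≤ 1 / 2 * ‖u - w‖ := by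
    intro u w hu hw
    have h := hlin (hk u) (hk w) (hm u) (hm w) (hΦ u) (hΦ w)
    rw [sub_self, norm_zero, zero_add] at h
    exact h.trans (hcontr u w ((hmem u).1 hu) ((hmem w).1 hw))
  have hu₁S : u₁ ∈ S := Metric.mem_closedBall_self hr
  have h0 : ‖Φ u₁ - u₁‖ ≤ r / 2 := by
    have h := hlin (hk u₁) hk₁ (hm u₁) (integrable_zero _ _ _) (hΦ u₁) hu₁
    simp only [Pi.zero_apply, sub_zero] at h
    exact h.trans hstart
  have hmaps : MapsTo Φ S S := by
    intro u hu
    rw [hmem] at hu ⊢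
    have h := hcon u u₁ ((hmem u).2 hu) hu₁S
    have h2 := norm_sub_le_norm_sub_add_norm_sub (Φ u) (Φ u₁) u₁
    linarith
  have hdist : ∀ u w : MR ι T, dist u w = ‖u - w‖ := fun u w => dist_eq_norm u w
  have hK : ContractingWith (1 / 2 : ℝ≥0) (hmaps.restrict Φ S S) := by
    refine ⟨by
      rw [← NNReal.coe_lt_coe]
      norm_num, LipschitzWith.of_dist_le_mul fun u w => ?_⟩
    have h : dist (Φ u) (Φ w) ≤ 1 / 2 * dist u.1 w.1 := by
      rw [hdist, hdist]
      exact hcon u w u.2 w.2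
    change dist (Φ u) (Φ w) ≤ _ * dist u.1 w.1
    simpa using h
  obtain ⟨u, huS, hfix, -⟩ := hK.exists_fixedPoint' (s := S)
    Metric.isClosed_closedBall.isComplete hmaps hu₁S (edist_ne_top _ _)
  refine ⟨u, (hmem u).1 huS, ?_⟩
  have h := hΦ u
  rw [hfix] at h
  exact h

end FixedPoint

/-! ### The frozen leading operator. -/

section Frozen

variable {U V H : Type*}
  [NormedAddCommGroup U] [InnerProductSpace ℝ U] [CompleteSpace U]
  [NormedAddCommGroup V] [InnerProductSpace ℝ V] [CompleteSpace V]
  [NormedAddCommGroup H] [InnerProductSpace ℝ H] [CompleteSpace H]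

/-- The leading operator with frozen state `v₁`, shifted so that it becomes coercive. -/
noncomputable def frozenOperator (ι : V →L[ℝ] H) (c : Coefficients U V H) (M : ℝ) (v₁ : V) (t : ℝ) :
    V →L[ℝ] V :=
  (riesz V).toContinuousLinearMap.comp (c.A₀ t.toNNReal (ι v₁)) + M • (adjoint ι).comp ι

theorem frozenOperator_apply (ι : V →L[ℝ] H) (c : Coefficients U V H) (M : ℝ) (v₁ : V) (t : ℝ)
    (v : V) : frozenOperator ι c M v₁ t v =
      riesz V (c.A₀ t.toNNReal (ι v₁) v) + M • adjoint ι (ι v) := rfl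

/-- The shift M ι†ι contributes exactly M‖ι v‖² to the form and so cancels the lower-order loss in
the coercivity assumption. -/
theorem isCoerciveFamily_frozenOperator [MeasurableSpace V] [MeasurableSpace H]
    {ι : V →L[ℝ] H} {c : Coefficients U V H} (hc : CriticalVariational ι c) {T θ M K : ℝ} {v₁ : V}
    (hθ : 0 < θ) (hM : 0 ≤ M)
    (hcoer : ∀ t : ℝ≥0, (t : ℝ) ≤ T → ∀ v : V,
      θ * ‖v‖ ^ 2 - M * ‖ι v‖ ^ 2 ≤ c.A₀ t (ι v₁) v v - 1 / 2 * ‖c.B₀ t (ι v₁) v‖ ^ 2)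
    (hK : ∀ t : ℝ≥0, (t : ℝ) ≤ T → ∀ v : V, ‖c.A₀ t (ι v₁) v‖ ≤ K * ‖v‖) :
    IsCoerciveFamily T θ (K + M * ‖(adjoint ι).comp ι‖) (frozenOperator ι c M v₁) := by
  have hcast : ∀ {t : ℝ}, t ∈ Icc 0 T → ((t.toNNReal : ℝ≥0) : ℝ) ≤ T := fun {t} ht => by
    rw [Real.coe_toNNReal _ ht.1]
    exact ht.2
  refine ⟨hθ, fun v => ?_, fun t ht v => ?_, fun t ht v => ?_⟩
  · have h : StronglyMeasurable fun t : ℝ => c.A₀ t.toNNReal (ι v₁) v :=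
      (hc.meas_A₀ v).comp_measurable (measurable_real_toNNReal.prodMk measurable_const)
    exact ((riesz V).continuous.comp_stronglyMeasurable h).add stronglyMeasurable_const
  · rw [frozenOperator_apply, add_mul]
    refine (norm_add_le _ _).trans (add_le_add ?_ ?_)
    · rw [LinearIsometry.norm_map]
      exact hK _ (hcast ht) v
    · rw [norm_smul, Real.norm_of_nonneg hM, mul_assoc]
      exact mul_le_mul_of_nonneg_left (((adjoint ι).comp ι).le_opNorm v) hM
  · rw [frozenOperator_apply, inner_add_left, inner_riesz, real_inner_smul_left,
      ContinuousLinearMap.adjoint_inner_left, real_inner_self_eq_norm_sq]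
    have h1 := hcoer _ (hcast ht) v
    have h2 : 0 ≤ 1 / 2 * ‖c.B₀ t.toNNReal (ι v₁) v‖ ^ 2 := by positivity
    linarith

end Frozen

/-! ### Short-time existence. -/

section Existence

variable {U V H : Type*}
  [NormedAddCommGroup U] [InnerProductSpace ℝ U] [CompleteSpace U]
  [NormedAddCommGroup V] [InnerProductSpace ℝ V] [CompleteSpace V]
  [TopologicalSpace.SeparableSpace V] [MeasurableSpace V] [BorelSpace V]
  [NormedAddCommGroup H] [InnerProductSpace ℝ H] [CompleteSpace H]
  [MeasurableSpace H] [BorelSpace H]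
  {ι : V →L[ℝ] H} {c : Coefficients U V H}

/-- Estimate of the perturbation terms of the fixed point equation in a ball around the constant
function `v₁`. -/
theorem perturbation_le (hι : Function.Injective ι) (hc : CriticalVariational ι c)
    {T κ D M r : ℝ} (hT : 0 < T) (hκ : 0 ≤ κ) (hD : 0 ≤ D) (hM : 0 ≤ M) {n : ℝ}
    {ψ : ℝ → U} (hψ : MemLp ψ 2 (volume.restrict (Icc 0 T))) {v₁ : V} (hv₁ : ‖ι v₁‖ + r ≤ n)
    (hincr : ∀ t : ℝ≥0, (t : ℝ) ≤ T → ∀ u u' v : V, ‖ι u‖ ≤ n → ‖ι u'‖ ≤ n → ‖ι v‖ ≤ n →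
      ‖c.A ι t u - c.A ι t u' - c.A₀ t (ι v) (u - u')‖ ≤
        (κ + D * ‖ι u - ι v‖) * ‖u - u'‖ + D * ((1 + ‖u‖ + ‖u'‖) * ‖ι u - ι u'‖) ∧
      ‖c.B ι t u - c.B ι t u'‖ ≤ D * (‖u - u'‖ + (1 + ‖u‖ + ‖u'‖) * ‖ι u - ι u'‖))
    {u₁ : MR ι T} (hu₁ : u₁.1.snd =ᵐ[volume.restrict (Icc 0 T)] fun _ => v₁) {u w : MR ι T}
    (hu : ‖u - u₁‖ ≤ r) (hw : ‖w - u₁‖ ≤ r) :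
    l2Norm T (fun t => (frozenOperator ι c M v₁ t (u.1.snd t) + driftA ι c u t) -
        (frozenOperator ι c M v₁ t (w.1.snd t) + driftA ι c w t)) +
      ∫ t in Icc 0 T, ‖driftB ι c ψ u t - driftB ι c ψ w t‖ ≤
    (κ + D * r + D * (√T * (1 + 2 * ‖v₁‖) + 2 * r) + M * ‖ι‖ * √T +
      D * (1 + (√T * (1 + 2 * ‖v₁‖) + 2 * r)) * l2Norm T ψ) * ‖u - w‖ := by
  have hr : 0 ≤ r := (norm_nonneg _).trans hu
  set μ := volume.restrict (Icc (0 : ℝ) T) with hμ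
  set d := u - w with hd
  have hball : ∀ {z : MR ι T}, ‖z - u₁‖ ≤ r →
      (∀ᵐ t ∂μ, ‖ι (z.1.snd t) - ι v₁‖ ≤ r) ∧ l2Norm T (fun t => z.1.snd t) ≤ √T * ‖v₁‖ + r := by
    intro z hz
    constructor
    · filter_upwards [MR.ae_norm_le (z - u₁), MR.snd_sub z u₁, hu₁] with t h1 h2 h3
      rw [h2, h3, map_sub] at h1
      exact h1.trans ((MR.norm_fst_le _).trans hz)
    · have h1 : l2Norm T (fun t => z.1.snd t) =
          l2Norm T (fun t => v₁ + (z - u₁).1.snd t) := by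
        refine l2Norm_congr ?_
        filter_upwards [MR.snd_sub z u₁, hu₁] with t h2 h3
        rw [h2, h3, add_sub_cancel]
      rw [h1]
      refine (l2Norm_add_le (memLp_const v₁) (MR.memLp_snd _)).trans ?_
      rw [l2Norm_const hT.le, l2Norm_coe]
      have := (MR.norm_snd_le (z - u₁)).trans hz
      linarith
  obtain ⟨hu1, hu2⟩ := hball hu
  obtain ⟨hw1, hw2⟩ := hball hw
  set p : ℝ → ℝ := fun t => 1 + ‖u.1.snd t‖ + ‖w.1.snd t‖ with hp
  have hup : MemLp (fun t => ‖u.1.snd t‖) 2 μ := (MR.memLp_snd u).norm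
  have hwp : MemLp (fun t => ‖w.1.snd t‖) 2 μ := (MR.memLp_snd w).norm
  have h1p : MemLp (fun t => 1 + ‖u.1.snd t‖) 2 μ := (memLp_const (1 : ℝ)).add hup
  have hpm : MemLp p 2 μ := h1p.add hwp
  -- Bound for the L² norm of the weight 1 + ‖u‖ + ‖w‖ on the ball. The part 2r does not vanish as T
  -- → 0, so r has to be made small on its own account.
  set S := √T * (1 + 2 * ‖v₁‖) + 2 * r with hS
  have hpS : l2Norm T p ≤ S := by
    have e1 := l2Norm_add_le h1p hwp
    have e2 := l2Norm_add_le (memLp_const (1 : ℝ)) hup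
    rw [l2Norm_const hT.le, norm_one, mul_one] at e2
    rw [l2Norm_norm] at e1 e2
    rw [hS]
    linarith
  have hS0 : 0 ≤ S := (l2Norm_nonneg _ _).trans hpS
  set X := ‖d.1.fst‖ with hX
  set Y := ‖d.1.snd‖ with hY
  have hX0 : 0 ≤ X := norm_nonneg _
  have hY0 : 0 ≤ Y := norm_nonneg _
  have hXd : X ≤ ‖d‖ := MR.norm_fst_le d
  have hYd : Y ≤ ‖d‖ := MR.norm_snd_le d
  have hdm : MemLp (fun t => ‖d.1.snd t‖) 2 μ := (MR.memLp_snd d).norm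
  have hsub : ∀ᵐ t ∂μ, d.1.snd t = u.1.snd t - w.1.snd t := MR.snd_sub u w
  have hae : ∀ᵐ t ∂μ,
      ‖(frozenOperator ι c M v₁ t (u.1.snd t) + driftA ι c u t) -
        (frozenOperator ι c M v₁ t (w.1.snd t) + driftA ι c w t)‖ ≤
        (κ + D * r) * ‖d.1.snd t‖ + ((D * X) * p t + M * ‖ι‖ * X) ∧
      ‖driftB ι c ψ u t - driftB ι c ψ w t‖ ≤ D * (‖d.1.snd t‖ * ‖ψ t‖ + X * (p t * ‖ψ t‖)) := by
    filter_upwards [hu1, hw1, hsub, MR.ae_norm_le d, ae_restrict_mem measurableSet_Icc]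
      with t h1 h2 h3 h4 ht
    have htT : ((t.toNNReal : ℝ≥0) : ℝ) ≤ T := by
      rw [Real.coe_toNNReal _ ht.1]
      exact ht.2
    have hn : ∀ {z : V}, ‖ι z - ι v₁‖ ≤ r → ‖ι z‖ ≤ n := fun {z} hz =>
      (norm_le_norm_add_norm_sub' _ _).trans ((add_le_add_right hz _).trans hv₁)
    obtain ⟨hA, hB⟩ := hincr t.toNNReal htT (u.1.snd t) (w.1.snd t) v₁ (hn h1) (hn h2)
      (by linarith)
    rw [← map_sub ι (u.1.snd t) (w.1.snd t), ← h3] at hA hB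
    have hp0 : 0 ≤ p t := by positivity
    constructor
    · have e : (frozenOperator ι c M v₁ t (u.1.snd t) + driftA ι c u t) -
          (frozenOperator ι c M v₁ t (w.1.snd t) + driftA ι c w t) =
          -riesz V (c.A ι t.toNNReal (u.1.snd t) - c.A ι t.toNNReal (w.1.snd t) -
            c.A₀ t.toNNReal (ι v₁) (d.1.snd t)) + M • adjoint ι (ι (d.1.snd t)) := by
        simp only [frozenOperator_apply, driftA, h3, map_sub, smul_sub]
        abel
      rw [e]
      refine (norm_add_le _ _).trans ?_
      rw [norm_neg, LinearIsometry.norm_map, norm_smul, Real.norm_of_nonneg hM]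
      have e1 : ‖adjoint ι (ι (d.1.snd t))‖ ≤ ‖ι‖ * X := by
        refine ((adjoint ι).le_opNorm _).trans ?_
        rw [LinearIsometryEquiv.norm_map]
        gcongr
      have e2 := mul_le_mul_of_nonneg_left e1 hM
      have e3 : D * (p t * ‖ι (d.1.snd t)‖) ≤ D * (p t * X) := by gcongr
      have e4 : (κ + D * ‖ι (u.1.snd t) - ι v₁‖) * ‖d.1.snd t‖ ≤ (κ + D * r) * ‖d.1.snd t‖ := by
        gcongr
      linarith
    · have e : driftB ι c ψ u t - driftB ι c ψ w t =
          (c.B ι t.toNNReal (u.1.snd t) - c.B ι t.toNNReal (w.1.snd t)).toCLM (ψ t) := by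
        rw [HSOp.toCLM_sub_apply, driftB, driftB]
      rw [e]
      refine (HSOp.norm_toCLM_apply_le _ _).trans ?_
      have e1 : ‖c.B ι t.toNNReal (u.1.snd t) - c.B ι t.toNNReal (w.1.snd t)‖ ≤
          D * (‖d.1.snd t‖ + p t * X) := by
        refine hB.trans ?_
        gcongr
      refine (mul_le_mul_of_nonneg_right e1 (norm_nonneg _)).trans (le_of_eq ?_)
      ring
  have hk : l2Norm T (fun t => (frozenOperator ι c M v₁ t (u.1.snd t) + driftA ι c u t) -
      (frozenOperator ι c M v₁ t (w.1.snd t) + driftA ι c w t)) ≤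
      (κ + D * r) * Y + (D * X * S + √T * (M * ‖ι‖ * X)) := by
    have i1 : MemLp (fun t => (κ + D * r) * ‖d.1.snd t‖) 2 μ := hdm.const_mul _
    have i2 : MemLp (fun t => D * X * p t) 2 μ := hpm.const_mul _
    have i3 : MemLp (fun _ : ℝ => M * ‖ι‖ * X) 2 μ := memLp_const _
    have i4 : MemLp (fun t => D * X * p t + M * ‖ι‖ * X) 2 μ := i2.add i3
    refine (l2Norm_mono (i1.add i4) ?_).trans ?_
    · filter_upwards [hae] with t ht
      exact ht.1.trans (Real.le_norm_self _)
    · refine (l2Norm_add_le i1 i4).trans (add_le_add ?_ ((l2Norm_add_le i2 i3).trans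
        (add_le_add ?_ ?_)))
      · rw [l2Norm_const_mul _ _ (by positivity), l2Norm_norm, l2Norm_coe]
      · rw [l2Norm_const_mul _ _ (by positivity)]
        gcongr
      · rw [l2Norm_const hT.le, Real.norm_of_nonneg (by positivity)]
  have hm : ∫ t in Icc 0 T, ‖driftB ι c ψ u t - driftB ι c ψ w t‖ ≤
      D * (Y * l2Norm T ψ + X * (S * l2Norm T ψ)) := by
    have i1 : Integrable (fun t => ‖d.1.snd t‖ * ‖ψ t‖) μ := hdm.integrable_mul hψ.norm
    have i2 : Integrable (fun t => p t * ‖ψ t‖) μ := hpm.integrable_mul hψ.norm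
    have i3 : Integrable (fun t => X * (p t * ‖ψ t‖)) μ := i2.const_mul X
    have i0 : Integrable (fun t => ‖driftB ι c ψ u t - driftB ι c ψ w t‖) μ :=
      ((integrableOn_driftB hι hc hT hψ u).sub (integrableOn_driftB hι hc hT hψ w)).norm
    refine (integral_mono_ae i0 ((i1.add i3).const_mul D) ?_).trans ?_
    · filter_upwards [hae] with t ht
      exact ht.2
    · simp only [Pi.add_apply]
      rw [integral_const_mul, integral_add i1 i3, integral_const_mul]
      have j1 := integral_norm_mul_norm_le (MR.memLp_snd d) hψ
      rw [l2Norm_coe] at j1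
      have j2 := integral_norm_mul_norm_le hpm hψ
      have j3 : ∫ t in Icc 0 T, p t * ‖ψ t‖ ≤ S * l2Norm T ψ := by
        refine le_trans (le_of_eq ?_) (j2.trans
          (mul_le_mul_of_nonneg_right hpS (l2Norm_nonneg _ _)))
        refine integral_congr_ae (Eventually.of_forall fun t => ?_)
        have : 0 ≤ p t := by positivity
        simp only [Real.norm_of_nonneg this]
      gcongr
  have hΨ : 0 ≤ l2Norm T ψ := l2Norm_nonneg _ _
  have f1 : (κ + D * r) * Y ≤ (κ + D * r) * ‖d‖ := by gcongr
  have f2 : D * X * S ≤ D * ‖d‖ * S := by gcongr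
  have f3 : √T * (M * ‖ι‖ * X) ≤ √T * (M * ‖ι‖ * ‖d‖) := by gcongr
  have f4 : D * (Y * l2Norm T ψ + X * (S * l2Norm T ψ)) ≤
      D * (‖d‖ * l2Norm T ψ + ‖d‖ * (S * l2Norm T ψ)) := by gcongr
  linarith

/-- Local existence, with a uniform bound, for initial values in a small ball. -/
theorem CriticalVariational.exists_strongSolution (hι : Function.Injective ι) (hd : DenseRange ι)
    (hc : CriticalVariational ι c) {T : ℝ} (hT : 0 < T) {ψ : ℝ → U}
    (hψ : MemLp ψ 2 (volume.restrict (Icc 0 T))) (u₀ : H) :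
    ∃ T' ε R : ℝ, 0 < T' ∧ T' ≤ T ∧ 0 < ε ∧ 0 ≤ R ∧ ∀ v₀ ∈ Metric.ball u₀ ε,
      ∃ u : MR ι T', IsStrongSolution ι c ψ v₀ u ∧ ‖u‖ ≤ R := by
  -- The 2 leaves room for ε ≤ 1, between u₀ and ι v₁, and for r ≤ 1, the radius of the ball around
  -- v₁.
  set n := ‖u₀‖ + 2 with hndef
  have hn : 0 ≤ n := by positivity
  obtain ⟨θ, M, hθ, hM, hcoer⟩ := hc.coercive T hT n hn
  obtain ⟨K, hK, hKb⟩ := hc.exists_bounds hT hn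
  set C := 2 + 1 / θ with hC
  have hC0 : 0 < C := by positivity
  -- Order of the choices: C fixes κ, then D depends on κ, r on D, ε on r, v₁ on ε, and T' comes
  -- last. This works because C does not depend on the time interval.
  obtain ⟨D, hD, hincr⟩ := hc.exists_increment_le hι hT hn (κ := 1 / (16 * C)) (by positivity)
  set r := min 1 (1 / (48 * C * (D + 1))) with hrdef
  have hr0 : 0 < r := lt_min one_pos (by positivity)
  have hr1 : r ≤ 1 := min_le_left _ _
  have hrD : C * (D * r) ≤ 1 / 48 := by
    have h1 : r * (48 * C * (D + 1)) ≤ 1 := (le_div_iff₀ (by positivity)).1 (min_le_right _ _)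
    have h2 : 0 ≤ C * r := by positivity
    linarith
  set ε := min 1 (r / (8 * C)) with hεdef
  have hε0 : 0 < ε := lt_min one_pos (by positivity)
  have hε1 : ε ≤ 1 := min_le_left _ _
  have hεC : C * ε ≤ r / 8 := by
    have h1 : ε * (8 * C) ≤ r := (le_div_iff₀ (by positivity)).1 (min_le_right _ _)
    linarith
  -- u₀ is only in H; a nearby element of V is needed for the constant path to belong to L²(V).
  obtain ⟨v₁, hv₁⟩ := hd.exists_dist_lt u₀ hε0
  have hv₁n : ‖ι v₁‖ + r ≤ n := by
    rw [dist_eq_norm] at hv₁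
    have := norm_le_norm_add_norm_sub u₀ (ι v₁)
    linarith
  set hA : ℝ → V := fun t => -riesz V (c.A ι t.toNNReal v₁) with hAdef
  set hB : ℝ → H := fun t => (c.B ι t.toNNReal v₁).toCLM (ψ t) with hBdef
  have hmem := hc.memLp hι hT hn (u := fun _ => v₁) (memLp_const v₁)
    (Eventually.of_forall fun _ => by linarith)
  have hAm : MemLp hA 2 (volume.restrict (Icc 0 T)) :=
    ((riesz V).toContinuousLinearMap.comp_memLp' hmem.1).neg
  have hBm : IntegrableOn hB (Icc 0 T) := integrableOn_toCLM_apply hmem.2 hψ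
  have lsqrt : Tendsto (fun s : ℝ => √s) (𝓝[>] 0) (𝓝 0) := by
    have := (Real.continuous_sqrt.tendsto 0).mono_left (nhdsWithin_le_nhds (s := Ioi 0))
    rwa [Real.sqrt_zero] at this
  have lψ := tendsto_l2Norm_zero hT hψ
  have l1 : Tendsto (fun s => C * (D * (√s * (1 + 2 * ‖v₁‖)) + M * ‖ι‖ * √s +
      D * (1 + (√s * (1 + 2 * ‖v₁‖) + 2 * r)) * l2Norm s ψ)) (𝓝[>] 0) (𝓝 0) := by
    have h1 := lsqrt.mul_const (1 + 2 * ‖v₁‖)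
    have h := (((h1.const_mul D).add (lsqrt.const_mul (M * ‖ι‖))).add
      ((((h1.add_const (2 * r)).const_add 1).const_mul D).mul lψ)).const_mul C
    simpa using h
  have l2 : Tendsto (fun s => C * (2 * l2Norm s hA + 2 * ∫ t in Icc 0 s, ‖hB t‖))
      (𝓝[>] 0) (𝓝 0) := by
    have h := (((tendsto_l2Norm_zero hT hAm).const_mul 2).add
      ((tendsto_integral_Icc_zero hT hBm.norm).const_mul 2)).const_mul C
    simpa using h
  obtain ⟨T', ⟨hs1, hs2⟩, hT'0, hT'T⟩ := (((l1.eventually_le_const (u := 1 / 16) (by norm_num)).and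
    (l2.eventually_le_const (u := r / 8) (by positivity))).and (Ioc_mem_nhdsGT hT)).exists
  have hsub : volume.restrict (Icc 0 T') ≤ volume.restrict (Icc 0 T) :=
    Measure.restrict_mono (Icc_subset_Icc_right hT'T) le_rfl
  have hψ' := hψ.mono_measure hsub
  have ha := isCoerciveFamily_frozenOperator (T := T') (v₁ := v₁) (K := K) hc hθ hM.le
    (fun t ht v => hcoer t (ht.trans hT'T) _ v (by linarith))
    (fun t ht v => (((hKb v₁ (by linarith)).1 t (ht.trans hT'T) v).1))
  obtain ⟨u₁, hu₁, hu₁v⟩ := exists_isEvolution_primitive (T := T') ι v₁ (w := 0) MemLp.zero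
  simp only [Pi.zero_apply, intervalIntegral.integral_zero, add_zero, map_zero] at hu₁ hu₁v
  refine ⟨T', ε, r + ‖u₁‖, hT'0, hT'T, hε0, by positivity, fun v₀ hv₀ => ?_⟩
  suffices h : ∃ u : MR ι T', ‖u - u₁‖ ≤ r ∧
      IsEvolution ι v₀ (fun t => (frozenOperator ι c M v₁ t (u.1.snd t) + driftA ι c u t) -
        frozenOperator ι c M v₁ t (u.1.snd t)) (driftB ι c ψ u) u by
    obtain ⟨u, hur, hu⟩ := h
    refine ⟨u, (isStrongSolution_iff_isEvolution hι hc hT'0 hψ').2 (hu.congr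
      (Eventually.of_forall fun t => ?_)), ?_⟩
    · simp only [add_sub_cancel_left]
    · have := norm_le_norm_add_norm_sub' u u₁
      linarith
  refine exists_isEvolution_of_contraction (x₁ := ι v₁) (u₁ := u₁)
    (k := fun u t => frozenOperator ι c M v₁ t (u.1.snd t) + driftA ι c u t)
    (m := fun u => driftB ι c ψ u) (k₁ := fun t => frozenOperator ι c M v₁ t (u₁.1.snd t))
    hd hT'0 hr0.le ha
    (fun u => (ha.memLp (MR.memLp_snd u)).add (memLp_driftA hι hc hT'0 u))
    (fun u => integrableOn_driftB hι hc hT'0 hψ' u)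
    (ha.memLp (MR.memLp_snd u₁))
    (hu₁.congr (Eventually.of_forall fun t => by simp)) ?_ ?_
  · have e1 : l2Norm T' (fun t => frozenOperator ι c M v₁ t (u₁.1.snd t) + driftA ι c u₁ t -
        frozenOperator ι c M v₁ t (u₁.1.snd t)) = l2Norm T' hA := by
      refine l2Norm_congr ?_
      filter_upwards [hu₁v] with t ht
      rw [add_sub_cancel_left, driftA, ht]
    have e2 : ∫ t in Icc 0 T', ‖driftB ι c ψ u₁ t‖ = ∫ t in Icc 0 T', ‖hB t‖ := by
      refine integral_congr_ae ?_
      filter_upwards [hu₁v] with t ht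
      rw [driftB, ht]
    rw [e1, e2]
    have h1 : ‖v₀ - ι v₁‖ ≤ ε + ε := by
      rw [← dist_eq_norm]
      exact (dist_triangle _ u₀ _).trans (add_le_add (le_of_lt hv₀) hv₁.le)
    have h2 := mul_le_mul_of_nonneg_left h1 hC0.le
    linarith
  · intro u w hu hw
    have h := perturbation_le hι hc hT'0 (by positivity) hD hM.le hψ' hv₁n
      (fun t ht => hincr t (ht.trans hT'T)) hu₁v hu hw
    have h1 := mul_le_mul_of_nonneg_left h hC0.le
    -- Three contributions of at most 1/16: from κ, from the three terms D r (each at most 1/48),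
    -- and from the terms that vanish with T'. The two factors 2 in the linear estimate turn 1/4
    -- into 1/2.
    have h2 : C * (1 / (16 * C) + D * r + D * (√T' * (1 + 2 * ‖v₁‖) + 2 * r) + M * ‖ι‖ * √T' +
        D * (1 + (√T' * (1 + 2 * ‖v₁‖) + 2 * r)) * l2Norm T' ψ) ≤ 1 / 4 := by
      have h3 : C * (1 / (16 * C)) = 1 / 16 := by field_simp
      linarith
    have h4 := mul_le_mul_of_nonneg_right h2 (norm_nonneg (u - w))
    linarith

end Existence

end CritVar

theorem theorem3p7
    {U V H : Type*}
    [NormedAddCommGroup U] [InnerProductSpace ℝ U] [CompleteSpace U]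
    [NormedAddCommGroup V] [InnerProductSpace ℝ V] [CompleteSpace V]
    [TopologicalSpace.SeparableSpace V] [MeasurableSpace V] [BorelSpace V]
    [NormedAddCommGroup H] [InnerProductSpace ℝ H] [CompleteSpace H]
    [TopologicalSpace.SeparableSpace H] [MeasurableSpace H] [BorelSpace H]
    (ι : V →L[ℝ] H) (hι : Function.Injective ι) (hdense : DenseRange ι)
    (c : CritVar.Coefficients U V H) (hc : CritVar.CriticalVariational ι c)
    (T : ℝ) (hT : 0 < T)
    (ψ : ℝ → U) (hψ : MemLp ψ 2 (volume.restrict (Icc 0 T)))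
    (u₀ : H) :
    ∃ T' ε : ℝ, 0 < T' ∧ T' ≤ T ∧ 0 < ε ∧
      (∀ v₀ ∈ Metric.ball u₀ ε, ∃! u : CritVar.MR ι T', CritVar.IsStrongSolution ι c ψ v₀ u) ∧
      ∃ C : ℝ, 0 < C ∧
        ∀ v₀ ∈ Metric.ball u₀ ε, ∀ w₀ ∈ Metric.ball u₀ ε, ∀ u w : CritVar.MR ι T',
          CritVar.IsStrongSolution ι c ψ v₀ u → CritVar.IsStrongSolution ι c ψ w₀ w →
          ‖u - w‖ ≤ C * ‖v₀ - w₀‖ := by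
  obtain ⟨T', ε, R, hT', hT'T, hε, hR, hex⟩ := hc.exists_strongSolution hι hdense hT hψ u₀
  have hψ' : MemLp ψ 2 (volume.restrict (Icc 0 T')) :=
    hψ.mono_measure (Measure.restrict_mono (Icc_subset_Icc_right hT'T) le_rfl)
  -- For uniqueness the constants may depend on the two given solutions, so no a priori bound is
  -- needed yet.
  have huniq : ∀ {v₀ : H} {u w : CritVar.MR ι T'}, CritVar.IsStrongSolution ι c ψ v₀ u →
      CritVar.IsStrongSolution ι c ψ v₀ w → u = w := by
    intro v₀ u w hu hw
    obtain ⟨C, -, hC⟩ := hc.exists_norm_sub_le hι hdense (n := max ‖u.1.fst‖ ‖w.1.fst‖)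
      (G₀ := ∫ t in Icc 0 T', ((1 + ‖u.1.snd t‖ + ‖w.1.snd t‖) ^ 2 + ‖ψ t‖ ^ 2)) hT
      (le_max_of_le_left (norm_nonneg _))
    have h := hC T' hT' hT'T ψ hψ' v₀ v₀ u w hu hw (le_max_left _ _) (le_max_right _ _) le_rfl
    rw [sub_self, norm_zero, mul_zero] at h
    exact sub_eq_zero.1 (norm_le_zero_iff.1 h)
  -- By uniqueness any solution is the constructed one and inherits its bound R, so the Lipschitz
  -- constant below can be chosen from R, T' and ψ alone.
  have hbound : ∀ v₀ ∈ Metric.ball u₀ ε, ∀ u : CritVar.MR ι T',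
      CritVar.IsStrongSolution ι c ψ v₀ u → ‖u‖ ≤ R := by
    intro v₀ hv₀ u hu
    obtain ⟨u', hu', hle⟩ := hex v₀ hv₀
    rwa [huniq hu hu']
  obtain ⟨C, hC0, hC⟩ := hc.exists_norm_sub_le hι hdense (n := R)
    (G₀ := (√T' + R + R) ^ 2 + CritVar.l2Norm T' ψ ^ 2) hT hR
  refine ⟨T', ε, hT', hT'T, hε, fun v₀ hv₀ => ?_, C + 1, by positivity, ?_⟩
  · obtain ⟨u, hu, -⟩ := hex v₀ hv₀
    exact ⟨u, hu, fun w hw => huniq hw hu⟩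
  · intro v₀ hv₀ w₀ hw₀ u w hu hw
    have huR := hbound v₀ hv₀ u hu
    have hwR := hbound w₀ hw₀ w hw
    refine (hC T' hT' hT'T ψ hψ' v₀ w₀ u w hu hw ((CritVar.MR.norm_fst_le u).trans huR)
      ((CritVar.MR.norm_fst_le w).trans hwR) ?_).trans
      (mul_le_mul_of_nonneg_right (by linarith) (norm_nonneg _))
    have h1 : MemLp (fun t => 1 + ‖u.1.snd t‖) 2 (volume.restrict (Icc 0 T')) :=
      (memLp_const (1 : ℝ)).add (CritVar.MR.memLp_snd u).norm
    have h2 : MemLp (fun t => 1 + ‖u.1.snd t‖ + ‖w.1.snd t‖) 2 (volume.restrict (Icc 0 T')) :=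
      h1.add (CritVar.MR.memLp_snd w).norm
    rw [integral_add h2.integrable_sq hψ'.norm.integrable_sq, CritVar.integral_norm_sq_eq hψ']
    have h3 := CritVar.integral_norm_sq_eq h2
    simp only [Real.norm_eq_abs, sq_abs] at h3
    rw [h3]
    have h4 := CritVar.l2Norm_add_le h1 (CritVar.MR.memLp_snd w).norm
    have h5 := CritVar.l2Norm_add_le (memLp_const (1 : ℝ)) (CritVar.MR.memLp_snd u).norm
    rw [CritVar.l2Norm_const hT'.le, norm_one, mul_one] at h5
    rw [CritVar.l2Norm_norm, CritVar.l2Norm_coe] at h4 h5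
    have h6 := (CritVar.MR.norm_snd_le u).trans huR
    have h7 := (CritVar.MR.norm_snd_le w).trans hwR
    have h8 := CritVar.l2Norm_nonneg T' (fun t => 1 + ‖u.1.snd t‖ + ‖w.1.snd t‖)
    gcongr
    linarith
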